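/- **Setting.** Let $d\in\{2,3\}$, $\Gamma=(0,1)^{d-1}\times\{0\}$, $\Omega_1=(0,1)^{d-1}\times(0,1)$, $\Omega_2=(0,1)^{d-1}\times(-1,0)$, and $\Gamma_i=\partial\Omega_i\setminus\Gamma$. For $i,j\in\{1,2\}$ let $\nu_i>0$ and $b_{i,j}\in\mathbb R$ be constants and let $\mathbf s_i\in[W^{1,\infty}(\Omega_i)]^d$. Write $(\cdot,\cdot)$ and $(\cdot,\cdot)_\Gamma$ for the inner products of $L^2(\Omega_i)$ and $L^2(\Gamma)$, and let $$L(v,w)=\int_{\Omega_i}\nu_i\nabla v\cdot\nabla w\,d\mathbf x+\int_{\Omega_i}\nabla\cdot(\mathbf s_i v)\,w\,d\mathbf x .$$ *Space discretization.* Let $\tau_1,\tau_2$ be conforming meshes of $\Omega_1,\Omega_2$, both consisting of triangles (tetrahedra if $d=3$), or both consisting of convex quadrilaterals (parallelepipeds if $d=3$), and inducing the same mesh $\tau_\Gamma$ on $\Gamma$. Let $h_i$ be the largest diameter of an element of $\tau_i$, and $h=\max\{h_1,h_2\}$. The meshes belong to a regular family: for a fixed $\sigma>0$, every $E\in\tau_i$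 contains a ball of radius $\sigma h_i$ (shape-regularity and quasi-uniformity). Fix $k\ge 1$; local polynomials have total degree at most $k$ on triangles and tetrahedra, and degree at most $k$ in each coordinate on quadrilaterals and parallelepipeds (with the same convention on the elements of $\tau_\Gamma$). Let $U_i$ be the space of continuous functions on $\overline{\Omega_i}$ that are local polynomials on each $E\in\tau_i$ and vanish on $\Gamma_i$, and $U_\Gamma$ the space of continuous functions on $\overline\Gamma$ that are local polynomials on each element of $\tau_\Gamma$ and vanish on $\partial\Gamma$. For a vector space $V$ let $\mathbb P_p(V)$ denote the polynomials in $t$ of degree at most $p$ with coefficients in $V$. *Time discretization.* Let $t_f>0$, $N\ge1$, $\Delta t=t_f/N$, $M_1,M_2\ge 1$, $\Delta t_i=\Delta t/M_i$. For a coupling window $\tilde n\in\{1,\dots,N\}$ set $I=((\tilde n-1)\Delta t,\tilde n\Delta t)$, $t_i^n=(\tilde n-1)\Delta t+n\Delta t_i$ and $I_i^n=(t_i^{n-1},t_i^n)$. Let $q,k_s,r_1,r_2\ge 0$ and $0\le n_s\le q+1$ be integers, $-\infty<\theta_1<\dots<\theta_{n_s}\le 1$, and $\mathbb D\in\mathbb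 R^{n_s\times(k_s+1)}$. Let $\psi_0,\dots,\psi_q$ be polynomials with $\deg\psi_j\le j$ that form an $L^2(-1,1)$-orthogonal basis of the polynomials of degree at most $q$, and let $\tilde{\mathbb D}\in\mathbb R^{n_s\times n_s}$ have the entries $\tilde{\mathbb D}_{j,l}=\psi_{l+q-n_s}(2\theta_j-1)$. *The multirate DGiT problem on window $\tilde n$.* Given integrable forcings $f_i$ on $\Omega_i\times(0,t_f]$ and $g_i$ on $\Gamma\times(0,t_f]$, and previous side values $U_i^n\in U_i$ for $n\le 0$, find, for $i=1,2$ and $1\le n\le M_i$, states $u_i^n\in\mathbb P_q(U_i)$, side values $U_i^n\in U_i$, and $u_{\Gamma,i},F_i\in\mathbb P_{r_i}(U_\Gamma)$ such that $$u_i^n(t_i^{n-1}+\theta_j\Delta t_i)=\sum_{l=1}^{k_s+1}\mathbb D_{j,l}\,U_i^{n+1-l},\qquad 1\le j\le n_s,$$ $$(U_i^n,v(t_i^n))-\int_{I_i^n}(u_i^n,\dot v)\,dt=(U_i^{n-1},v(t_i^{n-1}))-\int_{I_i^n}\big[L(u_i^n,v)+(F_i,v)_\Gamma-(f_i,v)\big]dt\quad\forall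 v\in\mathbb P_{q+1-n_s}(U_i),$$ $$\int_I(u_{\Gamma,i},\lambda)_\Gamma\,dt=\sum_{n=1}^{M_i}\int_{I_i^n}(u_i^n,\lambda)_\Gamma\,dt,\qquad \int_I(F_i,\lambda)_\Gamma\,dt=\int_I(b_{i,1}u_{\Gamma,1}+b_{i,2}u_{\Gamma,2}-g_i,\lambda)_\Gamma\,dt\quad\forall\lambda\in\mathbb P_{r_i}(U_\Gamma).$$ **Theorem.** Assume that $\tilde{\mathbb D}$ is nonsingular (no condition if $n_s=0$). Then there is a constant $C>0$, depending only on $d$, $\nu_i$, $b_{i,j}$, $\mathbf s_i$, $q$, $n_s$, $\theta_j$, $k_s$, $\mathbb D$, $\psi_j$, $r_i$, $k$, the element type and $\sigma$ (in particular not on $h$, the meshes, $t_f$, $N$, $M_i$, the forcings or the previous side values), such that whenever $\Delta t\,(h^{-2}+h^{-1})\le C$, the multirate DGiT problem has exactly one solution $(u_i^n,U_i^n,u_{\Gamma,i},F_i)$ on every coupling window $\tilde n\in\{1,\dots,N\}$ and for all forcings and previous side values as above. -/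

import Mathlib

open MeasureTheory Set

namespace MultirateDGiT

noncomputable section

/-! ### Geometry

The spatial dimension is `d = m + 1`; the last coordinate is normal to the interface.  The two
subdomains, numbered 1 and 2 on paper, are indexed by `0` and `1` in `Fin 2`. -/

/-- The ambient space `ℝ^(m+1)` of the two subdomains. -/
abbrev Pt (m : ℕ) := EuclideanSpace ℝ (Fin (m + 1))

/-- Coordinates `ℝ^m` on the hyperplane that carries the interface. -/
abbrev IPt (m : ℕ) := EuclideanSpace ℝ (Fin m)

/-- The inclusion `y ↦ (y, 0)`. -/
def emb {m : ℕ} (y : IPt m) : Pt m :=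
  WithLp.toLp 2 (Fin.snoc (α := fun _ => ℝ) (fun j => y j) 0)

/-- The open unit cube `(0,1)^m`, i.e. the interface `Γ` in the coordinates `y`. -/
def cube (m : ℕ) : Set (IPt m) := {y | ∀ j, 0 < y j ∧ y j < 1}

/-- `Γ = (0,1)^m × {0}` as a subset of `ℝ^(m+1)`. -/
def Gam (m : ℕ) : Set (Pt m) := emb '' cube m

/-- `Ω₁ = (0,1)^m × (0,1)` (index `0`) and `Ω₂ = (0,1)^m × (-1,0)` (index `1`). -/
def Om (m : ℕ) (i : Fin 2) : Set (Pt m) :=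
  {x | (∀ j : Fin m, 0 < x j.castSucc ∧ x j.castSucc < 1) ∧
    if i = 0 then 0 < x (Fin.last m) ∧ x (Fin.last m) < 1
    else -1 < x (Fin.last m) ∧ x (Fin.last m) < 0}

/-- The exterior boundary `Γ_i = ∂Ω_i \ Γ`. -/
def extBdry (m : ℕ) (i : Fin 2) : Set (Pt m) := frontier (Om m i) \ Gam m

/-! ### Meshes -/

/-- The two element types: simplices, with polynomials of total degree at most `k`, and
quadrilaterals or parallelepipeds, with polynomials of degree at most `k` in each coordinate. -/
inductive Kind
  | simplex
  | tensor

/-- Triangles (`m = 1`) or tetrahedra (`m = 2`) in the first case, convex quadrilaterals (`m = 1`)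
or parallelepipeds (`m = 2`) in the second; elements are closed and nondegenerate. -/
def IsElement {m : ℕ} : Kind → Set (Pt m) → Prop
  | .simplex, E =>
      ∃ p : Fin (m + 2) → Pt m, AffineIndependent ℝ p ∧ E = convexHull ℝ (range p)
  | .tensor, E =>
      (m = 1 ∧ ∃ p : Fin 4 → Pt m, ConvexIndependent ℝ p ∧ E = convexHull ℝ (range p)) ∨
      (m = 2 ∧ ∃ (a : Pt m) (e : Fin (m + 1) → Pt m),
        LinearIndependent ℝ e ∧ E = (fun x => a + x) '' parallelepiped e)

/-- A conforming mesh of `Ω_i`: finitely many elements that cover the closed domain, any two of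
which meet in a (possibly empty) common face. -/
structure IsMesh {m : ℕ} (kd : Kind) (i : Fin 2) (T : Finset (Set (Pt m))) : Prop where
  element : ∀ E ∈ T, IsElement kd E
  cover : (⋃ E ∈ T, E) = closure (Om m i)
  conforming : ∀ E ∈ T, ∀ E' ∈ T, E ≠ E' →
    IsExposed ℝ E (E ∩ E') ∧ IsExposed ℝ E' (E ∩ E')

/-- The mesh parameter: the largest diameter of an element. -/
def meshSize {m : ℕ} (T : Finset (Set (Pt m))) : ℝ :=
  sSup (Metric.diam '' (T : Set (Set (Pt m))))

/-- Regularity with constant `σ`: each element contains a ball whose radius is `σ` times the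
mesh parameter.  A family of meshes is regular if all its members satisfy this with one `σ > 0`;
this is shape-regularity together with quasi-uniformity. -/
def IsRegularMesh {m : ℕ} (σ : ℝ) (T : Finset (Set (Pt m))) : Prop :=
  ∀ E ∈ T, ∃ x, Metric.closedBall x (σ * meshSize T) ⊆ E

/-- The mesh induced on the interface: the `m`-dimensional sets `E ∩ {x_d = 0}`, in the
coordinates `y`. -/
def traceMesh {m : ℕ} (T : Finset (Set (Pt m))) : Set (Set (IPt m)) :=
  {S | (interior S).Nonempty ∧ ∃ E ∈ T, S = emb ⁻¹' E}

/-! ### Finite element spaces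

A function on a closed domain is represented by its extension by zero to the whole space. -/

/-- Local polynomial spaces: total degree at most `k`, or degree at most `k` in each variable. -/
def localPoly (n : ℕ) : Kind → ℕ → Submodule ℝ (MvPolynomial (Fin n) ℝ)
  | .simplex, k => MvPolynomial.restrictTotalDegree (Fin n) ℝ k
  | .tensor, k => MvPolynomial.restrictDegree (Fin n) ℝ k

/-- The continuous functions on the closed domain `K` that are polynomials from the local space on
each set in `T` and vanish on `B` (extended by zero off `K`). -/
def feSpace {n : ℕ} (kd : Kind) (k : ℕ) (K B : Set (EuclideanSpace ℝ (Fin n)))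
    (T : Set (Set (EuclideanSpace ℝ (Fin n)))) :
    Submodule ℝ (EuclideanSpace ℝ (Fin n) → ℝ) where
  carrier := {v | ContinuousOn v K ∧ (∀ x ∉ K, v x = 0) ∧ (∀ x ∈ B, v x = 0) ∧
    ∀ E ∈ T, ∃ p ∈ localPoly n kd k, ∀ x ∈ E, v x = MvPolynomial.eval (fun j => x j) p}
  zero_mem' := ⟨continuousOn_const, fun _ _ => rfl, fun _ _ => rfl,
    fun _ _ => ⟨0, Submodule.zero_mem _, fun _ _ => by simp⟩⟩
  add_mem' := by
    rintro v w ⟨hv1, hv2, hv3, hv4⟩ ⟨hw1, hw2, hw3, hw4⟩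
    refine ⟨hv1.add hw1, fun x hx => by simp [hv2 x hx, hw2 x hx],
      fun x hx => by simp [hv3 x hx, hw3 x hx], fun E hE => ?_⟩
    obtain ⟨p, hp, hp'⟩ := hv4 E hE
    obtain ⟨r, hr, hr'⟩ := hw4 E hE
    exact ⟨p + r, Submodule.add_mem _ hp hr, fun x hx => by simp [hp' x hx, hr' x hx]⟩
  smul_mem' := by
    rintro c v ⟨hv1, hv2, hv3, hv4⟩
    refine ⟨hv1.const_smul c, fun x hx => by simp [hv2 x hx],
      fun x hx => by simp [hv3 x hx], fun E hE => ?_⟩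
    obtain ⟨p, hp, hp'⟩ := hv4 E hE
    exact ⟨c • p, Submodule.smul_mem _ _ hp, fun x hx => by simp [hp' x hx]⟩

/-- The space `U_i`. -/
def USpace {m : ℕ} (kd : Kind) (k : ℕ) (i : Fin 2) (T : Finset (Set (Pt m))) :
    Submodule ℝ (Pt m → ℝ) :=
  feSpace kd k (closure (Om m i)) (extBdry m i) (T : Set (Set (Pt m)))

/-- The trace space `U_Γ` for the interface mesh induced by `T`. -/
def UGam {m : ℕ} (kd : Kind) (k : ℕ) (T : Finset (Set (Pt m))) : Submodule ℝ (IPt m → ℝ) :=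
  feSpace kd k (closure (cube m)) (frontier (cube m)) (traceMesh T)

/-- Polynomials in time of degree at most `q` with coefficients in `V`.  A polynomial on an
interval is identified with its extension to `ℝ`. -/
def timePoly {W : Type*} [AddCommGroup W] [Module ℝ W] (V : Submodule ℝ W) (q : ℕ) :
    Submodule ℝ (ℝ → W) where
  carrier := {v | ∃ c : ℕ → W, (∀ l, c l ∈ V) ∧
    ∀ t, v t = ∑ l ∈ Finset.range (q + 1), t ^ l • c l}
  zero_mem' := ⟨fun _ => 0, fun _ => V.zero_mem, fun _ => by simp⟩
  add_mem' := by
    rintro v w ⟨c, hc, hv⟩ ⟨e, he, hw⟩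
    exact ⟨fun l => c l + e l, fun l => V.add_mem (hc l) (he l),
      fun t => by simp [hv, hw, Finset.sum_add_distrib]⟩
  smul_mem' := by
    rintro a v ⟨c, hc, hv⟩
    exact ⟨fun l => a • c l, fun l => V.smul_mem _ (hc l),
      fun t => by simp [hv, Finset.smul_sum, smul_comm a]⟩

/-! ### Model data and bilinear forms -/

/-- `s ∈ [W^{1,∞}(Ω)]^d`, with first-order weak derivatives `Ds x j l = ∂_l s_j (x)`. -/
structure IsW1Inf {m : ℕ} (Ω : Set (Pt m)) (s : Pt m → Pt m)
    (Ds : Pt m → Fin (m + 1) → Fin (m + 1) → ℝ) : Prop where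
  memLp : ∀ j, MemLp (fun x => s x j) ⊤ (volume.restrict Ω)
  memLp_deriv : ∀ j l, MemLp (fun x => Ds x j l) ⊤ (volume.restrict Ω)
  weak_deriv : ∀ j l, ∀ φ : Pt m → ℝ, ContDiff ℝ (⊤ : ℕ∞) φ → HasCompactSupport φ →
    tsupport φ ⊆ Ω →
    ∫ x in Ω, s x j * fderiv ℝ φ x (EuclideanSpace.single l 1) = -∫ x in Ω, Ds x j l * φ x

/-- Diffusivities `ν_i > 0`, interface coefficients `b_{i,j}`, and advection fields
`s_i ∈ [W^{1,∞}(Ω_i)]^d` with their weak derivatives. -/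
structure Model (m : ℕ) where
  ν : Fin 2 → ℝ
  ν_pos : ∀ i, 0 < ν i
  b : Fin 2 → Fin 2 → ℝ
  s : Fin 2 → Pt m → Pt m
  Ds : Fin 2 → Pt m → Fin (m + 1) → Fin (m + 1) → ℝ
  s_mem : ∀ i, IsW1Inf (Om m i) (s i) (Ds i)

/-- The inner product of `L²(Ω_i)`. -/
def ip {m : ℕ} (i : Fin 2) (v w : Pt m → ℝ) : ℝ := ∫ x in Om m i, v x * w x

/-- The inner product of `L²(Γ)`. -/
def ipG {m : ℕ} (μ w : IPt m → ℝ) : ℝ := ∫ y in cube m, μ y * w y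

/-- The trace on `Γ` of a function on the closed subdomain. -/
def tr {m : ℕ} (v : Pt m → ℝ) : IPt m → ℝ := fun y => v (emb y)

/-- `a(v,w) = ∫_{Ω_i} ν_i ∇v · ∇w`. -/
def aForm {m : ℕ} (P : Model m) (i : Fin 2) (v w : Pt m → ℝ) : ℝ :=
  ∫ x in Om m i, P.ν i * inner ℝ (gradient v x) (gradient w x)

/-- `b(v,w) = ∫_{Ω_i} ∇·(s_i v) w`, where `∇·(s_i v) = (∇·s_i) v + s_i · ∇v` a.e. -/
def bForm {m : ℕ} (P : Model m) (i : Fin 2) (v w : Pt m → ℝ) : ℝ :=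
  ∫ x in Om m i, ((∑ j, P.Ds i x j j) * v x + inner ℝ (P.s i x) (gradient v x)) * w x

/-- `L(v,w) = a(v,w) + b(v,w)`. -/
def LForm {m : ℕ} (P : Model m) (i : Fin 2) (v w : Pt m → ℝ) : ℝ :=
  aForm P i v w + bForm P i v w

/-! ### The time discretization -/

/-- A DGiT substepping method with its coupling orders: trial degree `q`, `ns` side conditions at
the relative times `θ`, of a `ks`-step method with coefficient matrix `D`, and the polynomial
orders `r i` of the interface variables. -/
structure Method where
  q : ℕ
  ns : ℕ
  ns_le : ns ≤ q + 1
  θ : Fin ns → ℝ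
  θ_strictMono : StrictMono θ
  θ_le : ∀ j, θ j ≤ 1
  ks : ℕ
  D : Matrix (Fin ns) (Fin (ks + 1)) ℝ
  r : Fin 2 → ℕ

/-- `ψ_0, …, ψ_q` is an `L²(-1,1)`-orthogonal basis of the polynomials of degree at most `q`, with
`ψ_j` of degree at most `j`. -/
structure IsOrthBasis (q : ℕ) (ψ : ℕ → Polynomial ℝ) : Prop where
  degree_le : ∀ j ≤ q, (ψ j).natDegree ≤ j
  ne_zero : ∀ j ≤ q, ψ j ≠ 0
  orthogonal : ∀ j ≤ q, ∀ l ≤ q, j ≠ l → ∫ t in (-1 : ℝ)..1, (ψ j).eval t * (ψ l).eval t = 0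

/-- The side-condition matrix, with entries `ψ_{k+q-ns}(2θ_j - 1)` for `1 ≤ j, k ≤ ns` (here `k` is
counted from `0`). -/
def Dtilde (A : Method) (ψ : ℕ → Polynomial ℝ) : Matrix (Fin A.ns) (Fin A.ns) ℝ :=
  Matrix.of fun j k => (ψ (k + (A.q + 1 - A.ns))).eval (2 * A.θ j - 1)

/-- The local time level `t_i^n = t^{ñ-1} + n Δt_i` on coupling window `w = ñ`, where
`t^{ñ-1} = (ñ-1) Δt` and `Δt_i = Δt / M_i`. -/
def tl (Δt : ℝ) (w Mi n : ℕ) : ℝ := ((w : ℝ) - 1) * Δt + n * (Δt / Mi)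

/-- The unknowns on one coupling window.  Substep `n` on paper (`1 ≤ n ≤ M_i`) has index `n - 1`
in `Fin (M i)`. -/
@[ext]
structure Unknowns (m : ℕ) (M : Fin 2 → ℕ) where
  /-- the states `u_i^n` -/
  u : (i : Fin 2) → Fin (M i) → ℝ → Pt m → ℝ
  /-- the side values `U_i^n` -/
  U : (i : Fin 2) → Fin (M i) → Pt m → ℝ
  /-- the auxiliary traces `u_{Γ,i}` -/
  uG : Fin 2 → ℝ → IPt m → ℝ
  /-- the fluxes `F_i` -/
  F : Fin 2 → ℝ → IPt m → ℝ

/-- The side value `l` substeps before the end of the substep with index `n`, i.e. `U_i^{n+1-l}`: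
one of the unknowns if `n + 1 - l ≥ 1`, and given by the earlier windows otherwise, with
`hist j = U_i^{-j}`. -/
def lagged {W : Type*} {Mi : ℕ} (hist : ℕ → W) (U : Fin Mi → W) (n : Fin Mi) (l : ℕ) : W :=
  if l ≤ n then U ⟨n - l, (Nat.sub_le _ _).trans_lt n.isLt⟩ else hist (l - (n + 1))

/-- The monolithic multirate problem on coupling window `w`, with previous side values `hist`. -/
structure IsSolution {m : ℕ} (P : Model m) (A : Method) (kd : Kind) (k : ℕ)
    (T : Fin 2 → Finset (Set (Pt m))) (Δt : ℝ) (M : Fin 2 → ℕ) (w : ℕ)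
    (f : Fin 2 → Pt m → ℝ → ℝ) (g : Fin 2 → IPt m → ℝ → ℝ)
    (hist : Fin 2 → ℕ → Pt m → ℝ) (z : Unknowns m M) : Prop where
  u_mem : ∀ i n, z.u i n ∈ timePoly (USpace kd k i (T i)) A.q
  U_mem : ∀ i n, z.U i n ∈ USpace kd k i (T i)
  uG_mem : ∀ i, z.uG i ∈ timePoly (UGam kd k (T 0)) (A.r i)
  F_mem : ∀ i, z.F i ∈ timePoly (UGam kd k (T 0)) (A.r i)
  /-- the side conditions -/
  side : ∀ i (n : Fin (M i)) (j : Fin A.ns),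
    z.u i n (tl Δt w (M i) n + A.θ j * (Δt / M i)) =
      ∑ l : Fin (A.ks + 1), A.D j l • lagged (hist i) (z.U i) n l
  /-- the variational equations of the substeps -/
  substep : ∀ i (n : Fin (M i)), ∀ v ∈ timePoly (USpace kd k i (T i)) (A.q + 1 - A.ns),
    ip i (z.U i n) (v (tl Δt w (M i) ((n : ℕ) + 1)))
        - ∫ t in tl Δt w (M i) n..tl Δt w (M i) ((n : ℕ) + 1),
            ip i (z.u i n t) (fun x => deriv (fun t' => v t' x) t) =
      ip i (lagged (hist i) (z.U i) n 1) (v (tl Δt w (M i) n))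
        - ∫ t in tl Δt w (M i) n..tl Δt w (M i) ((n : ℕ) + 1),
            (LForm P i (z.u i n t) (v t) + ipG (z.F i t) (tr (v t))
              - ip i (fun x => f i x t) (v t))
  /-- projection of the traces to the coupling window -/
  trace : ∀ i, ∀ μ ∈ timePoly (UGam kd k (T 0)) (A.r i),
    ∫ t in ((w : ℝ) - 1) * Δt..w * Δt, ipG (z.uG i t) (μ t) =
      ∑ n : Fin (M i), ∫ t in tl Δt w (M i) n..tl Δt w (M i) ((n : ℕ) + 1),
        ipG (tr (z.u i n t)) (μ t)
  /-- the flux equations -/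
  flux : ∀ i, ∀ μ ∈ timePoly (UGam kd k (T 0)) (A.r i),
    ∫ t in ((w : ℝ) - 1) * Δt..w * Δt, ipG (z.F i t) (μ t) =
      ∫ t in ((w : ℝ) - 1) * Δt..w * Δt,
        ipG (fun y => P.b i 0 * z.uG 0 t y + P.b i 1 * z.uG 1 t y - g i y t) (μ t)

end

end MultirateDGiT

open MultirateDGiT

namespace MultirateDGiT

/-! ### Linear functionals on finite-dimensional spaces -/

/-! On one coupling window the problem is a linear system for the time coefficients of states, side
values, traces and fluxes, and it is square. Each substep has `(q + 1) + 1` unknown vectors against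
`ns` side conditions and `(q + 1 - ns) + 1` monomial tests, and the interface equations match their
unknowns in number. Forcing and history enter only the right-hand side
(`exists_data_isSolution_iff`), so it suffices that the homogeneous system has no nonzero solution.

This is a contraction argument. Let `Q` bound the `L²` norms of all states on the window, `Λ` the
form `L`, and `γ` the trace operator. The two interface equations bound the traces and fluxes by
multiples of `γ Q`. Testing the substeps with constants in time and summing from the zero history
bounds all side values by `Δt (Λ + κ γ²) Q`; the sum over substeps costs only `Δt`, whatever their
number. Testing with antiderivatives of `s ^ j` that vanish at the start of the substep bounds the
moments of order `j ≤ q - ns` in the same way, and the side conditions bound the values at the nodes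
`θ`. Nonsingularity of the side-condition matrix makes these values and moments determine a
polynomial of degree at most `q` (`eq_zero_of_side_of_moments`), hence bound it. For small `Δt (Λ +
γ²)` the bound `Q` therefore improves to `Q / 2`, and iteration gives zero
(`Forms.exists_threshold_op_bijective`).

On finite element functions, `Λ` is of order `h_i⁻² + h_i⁻¹ + 1` and `γ²` of order `h_i⁻¹`
(`exists_inverse_inequalities`): a polynomial of bounded degree is controlled on an element by its
`L²` norm on an inscribed ball, and these balls are disjoint. Since the step restriction involves
the larger mesh size, `h_1` and `h_2` must be comparable; this follows from the common interface
mesh by counting elements (`exists_meshSize_comparison`). -/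

theorem exists_sq_le_of_posDef {X : Type*} [AddCommGroup X] [Module ℝ X] [FiniteDimensional ℝ X]
    (B : X →ₗ[ℝ] X →ₗ[ℝ] ℝ) (hs : ∀ x y, B x y = B y x) (h0 : ∀ x, 0 ≤ B x x)
    (hd : ∀ x, B x x = 0 → x = 0) (l : X →ₗ[ℝ] ℝ) :
    ∃ C : ℝ, 0 ≤ C ∧ ∀ x, (l x) ^ 2 ≤ C * B x x := by
  have hinj : Function.Injective B := by
    rw [← LinearMap.ker_eq_bot, LinearMap.ker_eq_bot']
    intro x hx
    exact hd x (by rw [hx]; rfl)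
  have hsurj : Function.Surjective B :=
    (LinearMap.injective_iff_surjective_of_finrank_eq_finrank
      (Subspace.dual_finrank_eq (K := ℝ) (V := X)).symm).1 hinj
  -- Riesz representation: the functional is `B y`, and Cauchy–Schwarz yields the constant `B y y`.
  obtain ⟨y, rfl⟩ := hsurj l
  refine ⟨B y y, h0 y, fun x => ?_⟩
  have := LinearMap.BilinForm.apply_mul_apply_le_of_forall_zero_le B h0 y x
  rwa [hs x y, ← sq] at this

/-- Joint injectivity makes `∑ i, f i ⊗ f i` an inner product, for which every functional is
bounded. This turns unisolvence statements into estimates. -/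
theorem exists_abs_le_of_joint_injective {X ι : Type*} [AddCommGroup X] [Module ℝ X]
    [FiniteDimensional ℝ X] [Fintype ι] (f : ι → X →ₗ[ℝ] ℝ) (hf : ∀ x, (∀ i, f i x = 0) → x = 0)
    (l : X →ₗ[ℝ] ℝ) :
    ∃ K : ℝ, 0 ≤ K ∧ ∀ x κ, 0 ≤ κ → (∀ i, |f i x| ≤ κ) → |l x| ≤ K * κ := by
  let B : X →ₗ[ℝ] X →ₗ[ℝ] ℝ := ∑ i, (LinearMap.mul ℝ ℝ).compl₁₂ (f i) (f i)
  have hB : ∀ x y, B x y = ∑ i, f i x * f i y := fun x y => by simp [B, LinearMap.sum_apply]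
  obtain ⟨C, hC, h⟩ := exists_sq_le_of_posDef B
    (fun x y => by simp only [hB, mul_comm])
    (fun x => by rw [hB]; exact Finset.sum_nonneg fun i _ => mul_self_nonneg _)
    (fun x hx => by
      rw [hB, Finset.sum_eq_zero_iff_of_nonneg fun i _ => mul_self_nonneg _] at hx
      exact hf x fun i => mul_self_eq_zero.1 (hx i (Finset.mem_univ i))) l
  refine ⟨Real.sqrt (C * Fintype.card ι), Real.sqrt_nonneg _, fun x κ hκ hx => ?_⟩
  apply abs_le_of_sq_le_sq _ (by positivity)
  rw [mul_pow, Real.sq_sqrt (by positivity)]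
  refine (h x).trans ?_
  rw [mul_assoc]
  gcongr
  rw [hB]
  calc ∑ i, f i x * f i x ≤ ∑ _i : ι, κ ^ 2 := by
        refine Finset.sum_le_sum fun i _ => ?_
        rw [← sq]
        exact sq_le_sq.2 (by rw [abs_of_nonneg hκ]; exact hx i)
    _ = Fintype.card ι * κ ^ 2 := by simp

/-- The Cauchy–Schwarz inequality for positive semidefinite bilinear forms. -/
theorem abs_apply_le_sqrt_mul_sqrt {X : Type*} [AddCommGroup X] [Module ℝ X]
    (B : X →ₗ[ℝ] X →ₗ[ℝ] ℝ) (hs : ∀ x y, B x y = B y x) (h0 : ∀ x, 0 ≤ B x x) (x y : X) :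
    |B x y| ≤ √(B x x) * √(B y y) := by
  have := LinearMap.BilinForm.apply_mul_apply_le_of_forall_zero_le B h0 x y
  rw [hs y x, ← sq] at this
  rw [← Real.sqrt_mul (h0 x)]
  exact Real.abs_le_sqrt this

/-! ### Unisolvence for univariate polynomials -/

theorem integral_sum_coeff (r p : Polynomial ℝ) (a b : ℝ) :
    ∫ s in a..b, p.eval s * r.eval s
      = ∑ l ∈ Finset.range (r.natDegree + 1), r.coeff l * ∫ s in a..b, p.eval s * s ^ l := by
  simp_rw [Polynomial.eval_eq_sum_range (p := r), Finset.mul_sum]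
  rw [intervalIntegral.integral_finsetSum]
  · refine Finset.sum_congr rfl fun l _ => ?_
    rw [← intervalIntegral.integral_const_mul]
    congr 1; ext s; ring
  · intro l _
    apply Continuous.intervalIntegrable
    fun_prop

/-- A polynomial all of whose moments vanish is zero. -/
theorem eq_zero_of_moments {q : ℕ} {p : Polynomial ℝ} (hp : p.natDegree ≤ q)
    (h : ∀ j ≤ q, ∫ s in (0 : ℝ)..1, p.eval s * s ^ j = 0) : p = 0 := by
  have h1 : ∫ s in (0 : ℝ)..1, p.eval s * p.eval s = 0 := by
    rw [integral_sum_coeff]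
    refine Finset.sum_eq_zero fun l hl => ?_
    rw [h l (by simp at hl; omega), mul_zero]
  by_contra hne
  have hpos : 0 < ∫ s in (0 : ℝ)..1, p.eval s * p.eval s := by
    obtain ⟨c, hc, hpc⟩ : ∃ c ∈ Icc (0 : ℝ) 1, p.eval c ≠ 0 := by
      by_contra! hcon
      exact hne (Polynomial.eq_zero_of_infinite_isRoot p
        ((Icc_infinite (zero_lt_one' ℝ)).mono fun c hc => hcon c hc))
    exact intervalIntegral.integral_pos zero_lt_one (by fun_prop)
      (fun x _ => mul_self_nonneg _) ⟨c, hc, mul_self_pos.2 hpc⟩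
  exact hpos.ne' h1

/-- Orthogonality of nonzero polynomials gives linear independence, and `q + 1` independent elements
span the polynomials of degree at most `q`. -/
theorem eq_sum_of_isOrthBasis {q : ℕ} {ψ : ℕ → Polynomial ℝ} (hψ : IsOrthBasis q ψ)
    {p : Polynomial ℝ} (hp : p.natDegree ≤ q) :
    ∃ α : Fin (q + 1) → ℝ, p = ∑ l, α l • ψ l := by
  have hint : ∀ f g : Polynomial ℝ, IntervalIntegrable (fun t => f.eval t * g.eval t)
      volume (-1) 1 := fun f g => by
    apply Continuous.intervalIntegrable; fun_prop
  have hmem : ∀ l : Fin (q + 1), ψ l ∈ Polynomial.degreeLT ℝ (q + 1) := fun l => by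
    rw [Polynomial.mem_degreeLT]
    refine (Polynomial.degree_le_natDegree).trans_lt ?_
    have := hψ.degree_le l (by omega)
    exact_mod_cast (by omega : (ψ l).natDegree < q + 1)
  let b : Fin (q + 1) → Polynomial.degreeLT ℝ (q + 1) := fun l => ⟨ψ l, hmem l⟩
  have hli : LinearIndependent ℝ b := by
    rw [Fintype.linearIndependent_iff]
    intro g hg j
    have hg' : ∑ l, g l • ψ l = 0 := by
      have := congrArg Subtype.val hg
      simpa [b] using this
    have h0 : ∫ t in (-1 : ℝ)..1, (∑ l, g l • ψ l).eval t * (ψ j).eval t = 0 := by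
      simp [hg']
    have h1 : ∫ t in (-1 : ℝ)..1, (∑ l, g l • ψ l).eval t * (ψ j).eval t
        = ∑ l, g l * ∫ t in (-1 : ℝ)..1, (ψ l).eval t * (ψ j).eval t := by
      simp_rw [Polynomial.eval_finsetSum, Finset.sum_mul, Polynomial.eval_smul, smul_eq_mul,
        mul_assoc]
      rw [intervalIntegral.integral_finsetSum fun l _ => (hint _ _).const_mul _]
      simp_rw [intervalIntegral.integral_const_mul]
    rw [h1, Finset.sum_eq_single j] at h0
    · rcases mul_eq_zero.1 h0 with h | h
      · exact h
      · exfalso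
        obtain ⟨c, hc, hpc⟩ : ∃ c ∈ Icc (-1 : ℝ) 1, (ψ j).eval c ≠ 0 := by
          by_contra! hcon
          exact hψ.ne_zero j (by omega) (Polynomial.eq_zero_of_infinite_isRoot _
            ((Icc_infinite (by norm_num : (-1 : ℝ) < 1)).mono fun c hc => hcon c hc))
        exact (intervalIntegral.integral_pos (by norm_num : (-1 : ℝ) < 1) (by fun_prop)
          (fun x _ => mul_self_nonneg ((ψ j).eval x)) ⟨c, hc, mul_self_pos.2 hpc⟩).ne' h
    · intro l _ hlj
      rw [hψ.orthogonal l (by omega) j (by omega) (fun h => hlj (Fin.ext h)), mul_zero]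
    · simp
  have hfr : Module.finrank ℝ (Polynomial.degreeLT ℝ (q + 1)) = q + 1 := by
    rw [(Polynomial.degreeLTEquiv ℝ (q + 1)).finrank_eq, Module.finrank_fin_fun]
  have : FiniteDimensional ℝ (Polynomial.degreeLT ℝ (q + 1)) :=
    FiniteDimensional.of_finrank_pos (by omega)
  have hsp := hli.span_eq_top_of_card_eq_finrank (by simp [hfr])
  have hpm : p ∈ Polynomial.degreeLT ℝ (q + 1) := by
    rw [Polynomial.mem_degreeLT]
    exact (Polynomial.degree_le_natDegree).trans_lt (by exact_mod_cast (by omega))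
  have : (⟨p, hpm⟩ : Polynomial.degreeLT ℝ (q + 1)) ∈ Submodule.span ℝ (range b) := by
    rw [hsp]; trivial
  obtain ⟨α, hα⟩ := (Submodule.mem_span_range_iff_exists_fun ℝ).1 this
  refine ⟨α, ?_⟩
  have := congrArg Subtype.val hα
  simpa [b] using this.symm

/-- Values at the nodes `θ` and low-order moments determine a polynomial if the side-condition
matrix is nonsingular. -/
theorem eq_zero_of_side_of_moments (A : Method) {ψ : ℕ → Polynomial ℝ} (hψ : IsOrthBasis A.q ψ)
    (hD : (Dtilde A ψ).det ≠ 0) {p : Polynomial ℝ} (hp : p.natDegree ≤ A.q)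
    (hθ : ∀ j, p.eval (A.θ j) = 0)
    (hm : ∀ j < A.q + 1 - A.ns, ∫ s in (0 : ℝ)..1, p.eval s * s ^ j = 0) : p = 0 := by
  have hns := A.ns_le
  -- The moments live on `(0,1)` and the basis `ψ` on `(-1,1)`; `e` and `e'` are the mutually
  -- inverse affine changes of variable.
  set e : Polynomial ℝ := Polynomial.C (1 / 2) * Polynomial.X + Polynomial.C (1 / 2) with he
  set e' : Polynomial ℝ := Polynomial.C 2 * Polynomial.X - Polynomial.C 1 with he'
  have hedeg : e.natDegree ≤ 1 := by rw [he]; compute_degree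
  have he'deg : e'.natDegree ≤ 1 := by rw [he']; compute_degree
  have hcompdeg : ∀ f g : Polynomial ℝ, g.natDegree ≤ 1 → (f.comp g).natDegree ≤ f.natDegree :=
    fun f g hg => by
      refine Polynomial.natDegree_comp_le.trans ?_
      nlinarith [Nat.zero_le f.natDegree]
  set pt := p.comp e with hpt
  obtain ⟨α, hα⟩ := eq_sum_of_isOrthBasis hψ (p := pt) ((hcompdeg _ _ hedeg).trans hp)
  have hmom : ∀ r : Polynomial ℝ, r.natDegree < A.q + 1 - A.ns →
      ∫ s in (0 : ℝ)..1, p.eval s * r.eval s = 0 := fun r hr => by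
    rw [integral_sum_coeff]
    refine Finset.sum_eq_zero fun l hl => ?_
    rw [hm l (by simp at hl; omega), mul_zero]
  -- The vanishing moments make `pt` orthogonal to the first `q + 1 - ns` basis polynomials, so only
  -- the top `ns` coefficients can survive.
  have hlow : ∀ j : Fin (A.q + 1), (j : ℕ) < A.q + 1 - A.ns → α j = 0 := by
    intro j hj
    have hdj := hψ.degree_le j (by omega)
    have h0 : ∫ t in (-1 : ℝ)..1, pt.eval t * (ψ j).eval t = 0 := by
      have h2 := hmom ((ψ j).comp e') ((hcompdeg _ _ he'deg).trans_lt (by omega))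
      have h3 := intervalIntegral.mul_integral_comp_mul_sub (a := 0) (b := 1)
        (f := fun t => pt.eval t * (ψ j).eval t) 2 1
      norm_num at h3
      rw [← h3]
      simp only [mul_eq_zero, OfNat.ofNat_ne_zero, false_or]
      rw [← h2]
      congr 1
      ext s
      simp only [hpt, he, he', Polynomial.eval_comp, Polynomial.eval_add, Polynomial.eval_mul,
        Polynomial.eval_C, Polynomial.eval_X, Polynomial.eval_sub]
      congr 2
      ring
    have h1 : ∫ t in (-1 : ℝ)..1, pt.eval t * (ψ j).eval t
        = ∑ l, α l * ∫ t in (-1 : ℝ)..1, (ψ l).eval t * (ψ j).eval t := by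
      rw [hα]
      simp_rw [Polynomial.eval_finsetSum, Finset.sum_mul, Polynomial.eval_smul, smul_eq_mul,
        mul_assoc]
      rw [intervalIntegral.integral_finsetSum fun l _ => ?_]
      · simp_rw [intervalIntegral.integral_const_mul]
      · apply Continuous.intervalIntegrable; fun_prop
    rw [h1, Finset.sum_eq_single j] at h0
    · rcases mul_eq_zero.1 h0 with h | h
      · exact h
      · exfalso
        obtain ⟨c, hc, hpc⟩ : ∃ c ∈ Icc (-1 : ℝ) 1, (ψ j).eval c ≠ 0 := by
          by_contra! hcon
          exact hψ.ne_zero j (by omega) (Polynomial.eq_zero_of_infinite_isRoot _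
            ((Icc_infinite (by norm_num : (-1 : ℝ) < 1)).mono fun c hc => hcon c hc))
        exact (intervalIntegral.integral_pos (by norm_num : (-1 : ℝ) < 1) (by fun_prop)
          (fun x _ => mul_self_nonneg ((ψ j).eval x)) ⟨c, hc, mul_self_pos.2 hpc⟩).ne' h
    · intro l _ hlj
      rw [hψ.orthogonal l (by omega) j (by omega) (fun h => hlj (Fin.ext h)), mul_zero]
    · simp
  -- The surviving coefficients; the vanishing values at the nodes say that the side-condition
  -- matrix annihilates them.
  let β : Fin A.ns → ℝ := fun k => α ⟨k + (A.q + 1 - A.ns), by omega⟩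
  have hvec : (Dtilde A ψ).mulVec β = 0 := by
    ext j
    have h1 : pt.eval (2 * A.θ j - 1) = 0 := by
      rw [← hθ j, hpt, Polynomial.eval_comp]
      congr 1
      simp [he]; ring
    rw [hα, Polynomial.eval_finsetSum] at h1
    have h2 : ∑ l : Fin (A.q + 1), (α l • ψ l).eval (2 * A.θ j - 1)
        = ∑ k : Fin A.ns, (β k) * (ψ (k + (A.q + 1 - A.ns))).eval (2 * A.θ j - 1) := by
      symm
      refine Finset.sum_of_injOn
        (fun k : Fin A.ns => (⟨k + (A.q + 1 - A.ns), by omega⟩ : Fin (A.q + 1))) ?_ ?_ ?_ ?_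
      · intro a _ b _ hab
        simp only [Fin.mk.injEq] at hab
        exact Fin.ext (by omega)
      · simp
      · intro l _ hl
        have : (l : ℕ) < A.q + 1 - A.ns := by
          by_contra hcon
          apply hl
          refine ⟨⟨l - (A.q + 1 - A.ns), by omega⟩, by simp, ?_⟩
          ext
          simp only
          omega
        rw [hlow l this]; simp
      · intro k _
        simp [β]
    rw [h2] at h1
    rw [Pi.zero_apply, ← h1]
    simp only [Matrix.mulVec, dotProduct, Dtilde, Matrix.of_apply]
    exact Finset.sum_congr rfl fun _ _ => mul_comm _ _
  have hβ : β = 0 := Matrix.eq_zero_of_mulVec_eq_zero hD hvec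
  have hαz : ∀ l, α l = 0 := by
    intro l
    by_cases hl : (l : ℕ) < A.q + 1 - A.ns
    · exact hlow l hl
    · have := congrFun hβ ⟨l - (A.q + 1 - A.ns), by omega⟩
      simp only [β, Pi.zero_apply] at this
      rw [← this]
      congr 1
      ext
      simp only
      omega
  have hpt0 : pt = 0 := by rw [hα]; simp [hαz]
  have : p = pt.comp e' := by
    rw [hpt, Polynomial.comp_assoc]
    have : e.comp e' = Polynomial.X := by
      apply Polynomial.funext
      intro x
      simp [he, he']
      ring
    rw [this, Polynomial.comp_X]
  rw [this, hpt0, Polynomial.zero_comp]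

/-- Each coefficient is bounded by the functionals, and the monomials are at most `1` on `[0,1]`.
The functionals themselves may be evaluations at nodes outside `[0,1]`. -/
theorem exists_abs_eval_le {ι : Type*} [Fintype ι] (q : ℕ) (f : ι → Polynomial ℝ →ₗ[ℝ] ℝ)
    (hf : ∀ p : Polynomial ℝ, p.natDegree ≤ q → (∀ i, f i p = 0) → p = 0) :
    ∃ K : ℝ, 0 ≤ K ∧ ∀ p : Polynomial ℝ, p.natDegree ≤ q → ∀ κ, 0 ≤ κ → (∀ i, |f i p| ≤ κ) →
      ∀ s ∈ Icc (0 : ℝ) 1, |p.eval s| ≤ K * κ := by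
  have hdeg : ∀ p : Polynomial ℝ, p ∈ Polynomial.degreeLT ℝ (q + 1) ↔ p.natDegree ≤ q := by
    intro p
    rw [Polynomial.mem_degreeLT, Polynomial.natDegree_le_iff_coeff_eq_zero,
      Polynomial.degree_lt_iff_coeff_zero]
    rfl
  have : FiniteDimensional ℝ (Polynomial.degreeLT ℝ (q + 1)) :=
    (Polynomial.degreeLTEquiv ℝ (q + 1)).symm.finiteDimensional
  have hK : ∀ l : ℕ, _ := fun l => exists_abs_le_of_joint_injective
    (fun i => (f i).comp (Polynomial.degreeLT ℝ (q + 1)).subtype)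
    (fun x hx => Subtype.ext (hf x ((hdeg _).1 x.2) hx))
    ((Polynomial.lcoeff ℝ l).comp (Polynomial.degreeLT ℝ (q + 1)).subtype)
  choose K hK0 hK using hK
  refine ⟨∑ l ∈ Finset.range (q + 1), K l, Finset.sum_nonneg fun l _ => hK0 l,
    fun p hp κ hκ h s hs => ?_⟩
  rw [Polynomial.eval_eq_sum_range' (n := q + 1) (by omega), Finset.sum_mul]
  refine (Finset.abs_sum_le_sum_abs _ _).trans (Finset.sum_le_sum fun l _ => ?_)
  have h1 := hK l ⟨p, (hdeg p).2 hp⟩ κ hκ h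
  rw [abs_mul]
  have h2 : |s ^ l| ≤ 1 := by
    rw [abs_of_nonneg (pow_nonneg hs.1 _)]
    exact pow_le_one₀ hs.1 hs.2
  calc |p.coeff l| * |s ^ l| ≤ |p.coeff l| * 1 := by gcongr
    _ ≤ K l * κ := by rw [mul_one]; exact h1

/-- The moment functional `p ↦ ∫₀¹ p(s) s^j ds`. -/
noncomputable def momentFunctional (j : ℕ) : Polynomial ℝ →ₗ[ℝ] ℝ where
  toFun p := ∫ s in (0 : ℝ)..1, p.eval s * s ^ j
  map_add' p r := by
    simp_rw [Polynomial.eval_add, add_mul]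
    rw [intervalIntegral.integral_add] <;>
    · apply Continuous.intervalIntegrable; fun_prop
  map_smul' c p := by
    simp_rw [Polynomial.eval_smul, smul_eq_mul, mul_assoc]
    rw [intervalIntegral.integral_const_mul]; rfl

theorem exists_abs_eval_le_of_moments (q : ℕ) :
    ∃ K : ℝ, 0 ≤ K ∧ ∀ p : Polynomial ℝ, p.natDegree ≤ q → ∀ κ, 0 ≤ κ →
      (∀ j ≤ q, |∫ s in (0 : ℝ)..1, p.eval s * s ^ j| ≤ κ) →
      ∀ s ∈ Icc (0 : ℝ) 1, |p.eval s| ≤ K * κ := by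
  obtain ⟨K, hK, h⟩ := exists_abs_eval_le q (fun j : Fin (q + 1) => momentFunctional j)
    fun p hp hz => eq_zero_of_moments hp fun j hj => hz ⟨j, by omega⟩
  exact ⟨K, hK, fun p hp κ hκ hj => h p hp κ hκ fun j => hj j (by omega)⟩

theorem exists_abs_eval_le_of_side_of_moments (A : Method) {ψ : ℕ → Polynomial ℝ}
    (hψ : IsOrthBasis A.q ψ) (hD : (Dtilde A ψ).det ≠ 0) :
    ∃ K : ℝ, 0 ≤ K ∧ ∀ p : Polynomial ℝ, p.natDegree ≤ A.q → ∀ κ, 0 ≤ κ →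
      (∀ j, |p.eval (A.θ j)| ≤ κ) →
      (∀ j < A.q + 1 - A.ns, |∫ s in (0 : ℝ)..1, p.eval s * s ^ j| ≤ κ) →
      ∀ s ∈ Icc (0 : ℝ) 1, |p.eval s| ≤ K * κ := by
  obtain ⟨K, hK, h⟩ := exists_abs_eval_le A.q
    (Sum.elim (fun j : Fin A.ns => Polynomial.leval (A.θ j))
      (fun j : Fin (A.q + 1 - A.ns) => momentFunctional j))
    fun p hp hz => eq_zero_of_side_of_moments A hψ hD hp (fun j => hz (Sum.inl j))
      fun j hj => hz (Sum.inr ⟨j, hj⟩)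
  refine ⟨K, hK, fun p hp κ hκ h1 h2 => h p hp κ hκ ?_⟩
  rintro (j | j)
  · exact h1 j
  · exact h2 j j.2

/-! ### Polynomials in time with vector coefficients -/

section TimePolynomials

variable {V : Type*} [AddCommGroup V] [Module ℝ V] {n : ℕ}

/-- The value at time `t` of the polynomial with coefficients `c`. -/
noncomputable def ev (c : Fin n → V) (t : ℝ) : V := ∑ l : Fin n, t ^ (l : ℕ) • c l

/-- The weighted integral `∫_a^b P(t) c(t) dt` of a polynomial with vector coefficients. -/
noncomputable def mom (a b : ℝ) (P : Polynomial ℝ) : (Fin n → V) →ₗ[ℝ] V :=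
  ∑ l : Fin n, (∫ t in a..b, P.eval t * t ^ (l : ℕ)) • LinearMap.proj l

theorem mom_apply (a b : ℝ) (P : Polynomial ℝ) (c : Fin n → V) :
    mom a b P c = ∑ l : Fin n, (∫ t in a..b, P.eval t * t ^ (l : ℕ)) • c l := by
  simp [mom, LinearMap.sum_apply]

theorem ev_add (c e : Fin n → V) (t : ℝ) : ev (c + e) t = ev c t + ev e t := by
  simp [ev, Finset.sum_add_distrib]

theorem ev_smul (r : ℝ) (c : Fin n → V) (t : ℝ) : ev (r • c) t = r • ev c t := by
  simp [ev, Finset.smul_sum, smul_comm r]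

theorem map_ev (β : V →ₗ[ℝ] ℝ) (c : Fin n → V) (t : ℝ) :
    β (ev c t) = ∑ l : Fin n, t ^ (l : ℕ) * β (c l) := by
  simp [ev]

theorem continuous_map_ev (β : V →ₗ[ℝ] ℝ) (c : Fin n → V) : Continuous fun t => β (ev c t) := by
  simp_rw [map_ev]; fun_prop

/-- The space `V` carries no topology, so `mom` integrates the coefficients formally; this identity
ties it to scalar integrals. -/
theorem map_mom (a b : ℝ) (P : Polynomial ℝ) (β : V →ₗ[ℝ] ℝ) (c : Fin n → V) :
    β (mom a b P c) = ∫ t in a..b, P.eval t * β (ev c t) := by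
  simp_rw [mom_apply, map_sum, map_smul, map_ev, Finset.mul_sum]
  rw [intervalIntegral.integral_finsetSum]
  · refine Finset.sum_congr rfl fun l _ => ?_
    simp_rw [← mul_assoc]
    rw [intervalIntegral.integral_mul_const, smul_eq_mul]
  · intro l _
    apply Continuous.intervalIntegrable; fun_prop

theorem map_mom_apply {X : Type*} [AddCommGroup X] [Module ℝ X] (a b : ℝ) (P : Polynomial ℝ)
    (f : V →ₗ[ℝ] X →ₗ[ℝ] ℝ) (c : Fin n → V) (v : X) :
    f (mom a b P c) v = ∫ t in a..b, P.eval t * f (ev c t) v :=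
  map_mom a b P (f.flip v) c

theorem mom_add_poly (a b : ℝ) (P Q : Polynomial ℝ) (c : Fin n → V) :
    mom a b (P + Q) c = mom a b P c + mom a b Q c := by
  simp_rw [mom_apply, ← Finset.sum_add_distrib, ← add_smul, Polynomial.eval_add, add_mul]
  refine Finset.sum_congr rfl fun l _ => ?_
  rw [intervalIntegral.integral_add] <;>
  · apply Continuous.intervalIntegrable; fun_prop

theorem mom_smul_poly (a b r : ℝ) (P : Polynomial ℝ) (c : Fin n → V) :
    mom a b (r • P) c = r • mom a b P c := by
  simp_rw [mom_apply, Finset.smul_sum, smul_smul, Polynomial.eval_smul, smul_eq_mul, mul_assoc]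
  refine Finset.sum_congr rfl fun l _ => ?_
  rw [intervalIntegral.integral_const_mul]

/-- Pairing with a functional and rescaling time reduces vector-valued polynomials on any interval
to scalar ones on `[0,1]`, where the unisolvence bounds apply with constants independent of the step
size. -/
theorem exists_poly_eval_eq_map_ev {q : ℕ} (β : V →ₗ[ℝ] ℝ) (c : Fin (q + 1) → V) (a δ : ℝ) :
    ∃ p : Polynomial ℝ, p.natDegree ≤ q ∧ ∀ s, p.eval s = β (ev c (a + s * δ)) := by
  refine ⟨∑ l : Fin (q + 1), Polynomial.C (β (c l)) *
    (Polynomial.C a + Polynomial.X * Polynomial.C δ) ^ (l : ℕ), ?_, fun s => ?_⟩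
  · refine Polynomial.natDegree_sum_le_of_forall_le _ _ fun l _ => ?_
    refine (Polynomial.natDegree_C_mul_le _ _).trans ?_
    refine Polynomial.natDegree_pow_le.trans ?_
    have : (Polynomial.C a + Polynomial.X * Polynomial.C δ).natDegree ≤ 1 := by compute_degree
    have hl := l.2
    nlinarith
  · rw [map_ev]
    simp only [Polynomial.eval_finsetSum, Polynomial.eval_mul, Polynomial.eval_C,
      Polynomial.eval_pow, Polynomial.eval_add, Polynomial.eval_X]
    exact Finset.sum_congr rfl fun _ _ => mul_comm _ _

theorem integral_eq_mul_integral_unit (g : ℝ → ℝ) (a δ : ℝ) :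
    ∫ t in a..a + δ, g t = δ * ∫ s in (0 : ℝ)..1, g (a + s * δ) := by
  have := intervalIntegral.mul_integral_comp_add_mul (a := 0) (b := 1) (f := g) δ a
  simp only [mul_zero, add_zero, mul_one] at this
  rw [← this]
  simp_rw [mul_comm δ]

theorem linearMap_eq_zero_of_monomials {N : ℕ} (E : Polynomial ℝ →ₗ[ℝ] ℝ)
    (hE : ∀ l < N, E (Polynomial.X ^ l) = 0) {P : Polynomial ℝ} (hP : P.natDegree < N) :
    E P = 0 := by
  rw [P.as_sum_range' N hP, map_sum]
  refine Finset.sum_eq_zero fun l hl => ?_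
  rw [← Polynomial.C_mul_X_pow_eq_monomial, ← Polynomial.smul_eq_C_mul, map_smul,
    hE l (Finset.mem_range.1 hl), smul_zero]

/-- Pairing with the coefficient `c l` gives a scalar polynomial with infinitely many zeros, whose
coefficient of order `l` is `B (c l) (c l)`. -/
theorem coeff_eq_zero_of_ev_eq_zero {q : ℕ} {c : Fin (q + 1) → V} {B : V →ₗ[ℝ] V →ₗ[ℝ] ℝ}
    (hB : ∀ v, B v v = 0 → v = 0) (a δ : ℝ) (hδ : 0 < δ)
    (h : ∀ s ∈ Icc (0 : ℝ) 1, ev c (a + s * δ) = 0) : c = 0 := by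
  ext l
  apply hB
  have key : (∑ j : Fin (q + 1), Polynomial.C (B.flip (c l) (c j)) * Polynomial.X ^ (j : ℕ)) = 0 := by
    apply Polynomial.eq_zero_of_infinite_isRoot
    refine (Icc_infinite (by linarith : a < a + δ)).mono fun t ht => ?_
    have h1 := h ((t - a) / δ) ⟨div_nonneg (by linarith [ht.1]) hδ.le,
      (div_le_one hδ).2 (by linarith [ht.2])⟩
    rw [div_mul_cancel₀ _ hδ.ne', add_sub_cancel] at h1
    have h2 := map_ev (B.flip (c l)) c t
    rw [h1, map_zero] at h2
    simp only [mem_ofPred_eq, Polynomial.IsRoot.def, Polynomial.eval_finsetSum, Polynomial.eval_mul,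
      Polynomial.eval_C, Polynomial.eval_pow, Polynomial.eval_X]
    rw [h2]
    exact Finset.sum_congr rfl fun _ _ => mul_comm _ _
  have h3 := congrArg (fun p => Polynomial.coeff p l) key
  simp only [Polynomial.finsetSum_coeff, Polynomial.coeff_C_mul_X_pow, Polynomial.coeff_zero] at h3
  rw [Finset.sum_eq_single l] at h3
  · simpa using h3
  · intro j _ hj
    rw [if_neg]
    exact fun hh => hj (Fin.ext hh.symm)
  · simp

theorem abs_integral_le_of_abs_le {g : ℝ → ℝ} {a δ κ : ℝ} (hδ : 0 ≤ δ)
    (h : ∀ s ∈ Icc (0 : ℝ) 1, |g (a + s * δ)| ≤ κ) : |∫ t in a..a + δ, g t| ≤ δ * κ := by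
  rw [integral_eq_mul_integral_unit, abs_mul, abs_of_nonneg hδ]
  gcongr
  have := intervalIntegral.norm_integral_le_of_norm_le_const (a := 0) (b := 1)
    (f := fun s => g (a + s * δ)) (C := κ) fun s hs => by
      rw [uIoc_of_le zero_le_one] at hs
      exact h s ⟨hs.1.le, hs.2⟩
  simpa using this

/-- Taking `w = v` suffices. Through this duality all later estimates concern scalar functions of
time with a fixed test vector. -/
theorem sqrt_apply_le_of_abs_apply_le {B : V →ₗ[ℝ] V →ₗ[ℝ] ℝ} (h0 : ∀ v, 0 ≤ B v v) {v : V}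
    {κ : ℝ} (hκ : 0 ≤ κ) (h : ∀ w, |B v w| ≤ κ * √(B w w)) : √(B v v) ≤ κ := by
  have h1 := (le_abs_self _).trans (h v)
  have h2 := Real.mul_self_sqrt (h0 v)
  by_contra hcon
  push Not at hcon
  nlinarith [Real.sqrt_nonneg (B v v)]

end TimePolynomials

/-! ### The coupled problem for abstract forms -/

/-- The bilinear forms of the semidiscrete problem, with the properties of the inner products that
the estimates use. -/
structure Forms (V : Fin 2 → Type*) (G : Type*) [∀ i, AddCommGroup (V i)] [∀ i, Module ℝ (V i)]
    [AddCommGroup G] [Module ℝ G] where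
  /-- the inner products on the subdomains -/
  ip : ∀ i, V i →ₗ[ℝ] V i →ₗ[ℝ] ℝ
  /-- the inner product on the interface -/
  ipG : G →ₗ[ℝ] G →ₗ[ℝ] ℝ
  /-- the advection–diffusion forms -/
  L : ∀ i, V i →ₗ[ℝ] V i →ₗ[ℝ] ℝ
  /-- the pairing of an interface function with a trace -/
  c : ∀ i, G →ₗ[ℝ] V i →ₗ[ℝ] ℝ
  ip_nonneg : ∀ i v, 0 ≤ ip i v v
  ip_def : ∀ i v, ip i v v = 0 → v = 0
  ipG_symm : ∀ v w, ipG v w = ipG w v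
  ipG_nonneg : ∀ v, 0 ≤ ipG v v
  ipG_def : ∀ v, ipG v v = 0 → v = 0

section Coupled

variable {V : Fin 2 → Type*} {G : Type*} [∀ i, AddCommGroup (V i)] [∀ i, Module ℝ (V i)]
  [AddCommGroup G] [Module ℝ G]

/-- Coefficients of the states, side values, interface traces and fluxes. -/
abbrev State (V : Fin 2 → Type*) (G : Type*) (q : ℕ) (r M : Fin 2 → ℕ) :=
  (∀ i, Fin (M i) → Fin (q + 1) → V i) × (∀ i, Fin (M i) → V i) ×
    (∀ i, Fin (r i + 1) → G) × (∀ i, Fin (r i + 1) → G)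

/-- Right-hand sides, tested with monomials in time. -/
abbrev Data (V : Fin 2 → Type*) (G : Type*) [∀ i, AddCommGroup (V i)] [∀ i, Module ℝ (V i)]
    [AddCommGroup G] [Module ℝ G] (q ns : ℕ) (r M : Fin 2 → ℕ) :=
  (∀ i, Fin (M i) → Fin ns → V i) ×
    (∀ i, Fin (M i) → Fin (q + 1 - ns + 1) → Module.Dual ℝ (V i)) ×
    (∀ i, Fin (r i + 1) → Module.Dual ℝ G) × (∀ i, Fin (r i + 1) → Module.Dual ℝ G)

/-- With zero history the lagged values are linear in the unknowns; this is why the homogeneous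
operators below use `fun _ => 0`. -/
theorem lagged_zero_add {W : Type*} [AddCommGroup W] {Mi : ℕ} (U U' : Fin Mi → W) (n : Fin Mi)
    (l : ℕ) : lagged (fun _ => 0) (U + U') n l
      = lagged (fun _ => 0) U n l + lagged (fun _ => 0) U' n l := by
  unfold lagged; split_ifs <;> simp

theorem lagged_zero_smul {W : Type*} [AddCommGroup W] [Module ℝ W] {Mi : ℕ} (r : ℝ)
    (U : Fin Mi → W) (n : Fin Mi) (l : ℕ) :
    lagged (fun _ => 0) (r • U) n l = r • lagged (fun _ => 0) U n l := by
  unfold lagged; split_ifs <;> simp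

namespace Forms

variable (Φ : Forms V G) (A : Method) (Δt : ℝ) (w : ℕ) {M : Fin 2 → ℕ} (b : Fin 2 → Fin 2 → ℝ)

/-- The homogeneous side conditions. -/
noncomputable def sideOp (z : State V G A.q A.r M) (i : Fin 2) (n : Fin (M i)) (j : Fin A.ns) :
    V i :=
  ev (z.1 i n) (tl Δt w (M i) n + A.θ j * (Δt / M i))
    - ∑ l : Fin (A.ks + 1), A.D j l • lagged (fun _ => 0) (z.2.1 i) n l

/-- The homogeneous variational equation of a substep, tested with `P(t)` times a vector. -/
noncomputable def stepOp (z : State V G A.q A.r M) (i : Fin 2) (n : Fin (M i))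
    (P : Polynomial ℝ) : Module.Dual ℝ (V i) :=
  P.eval (tl Δt w (M i) ((n : ℕ) + 1)) • Φ.ip i (z.2.1 i n)
    - Φ.ip i (mom (tl Δt w (M i) n) (tl Δt w (M i) ((n : ℕ) + 1)) (Polynomial.derivative P)
        (z.1 i n))
    - P.eval (tl Δt w (M i) n) • Φ.ip i (lagged (fun _ => 0) (z.2.1 i) n 1)
    + Φ.L i (mom (tl Δt w (M i) n) (tl Δt w (M i) ((n : ℕ) + 1)) P (z.1 i n))
    + Φ.c i (mom (tl Δt w (M i) n) (tl Δt w (M i) ((n : ℕ) + 1)) P (z.2.2.2 i))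

/-- The projection of the traces to the coupling window. -/
noncomputable def traceOp (z : State V G A.q A.r M) (i : Fin 2) (P : Polynomial ℝ) :
    Module.Dual ℝ G :=
  Φ.ipG (mom (((w : ℝ) - 1) * Δt) (w * Δt) P (z.2.2.1 i))
    - ∑ n : Fin (M i), (Φ.c i).flip
        (mom (tl Δt w (M i) n) (tl Δt w (M i) ((n : ℕ) + 1)) P (z.1 i n))

/-- The homogeneous flux equations. -/
noncomputable def fluxOp (z : State V G A.q A.r M) (i : Fin 2) (P : Polynomial ℝ) :
    Module.Dual ℝ G :=
  Φ.ipG (mom (((w : ℝ) - 1) * Δt) (w * Δt) P (z.2.2.2 i))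
    - Φ.ipG (b i 0 • mom (((w : ℝ) - 1) * Δt) (w * Δt) P (z.2.2.1 0)
        + b i 1 • mom (((w : ℝ) - 1) * Δt) (w * Δt) P (z.2.2.1 1))

/-- The linear operator of the coupled problem. -/
noncomputable def op : State V G A.q A.r M →ₗ[ℝ] Data V G A.q A.ns A.r M where
  toFun z :=
    (fun i n j => sideOp A Δt w z i n j,
      fun i n l => Φ.stepOp A Δt w z i n (Polynomial.X ^ (l : ℕ)),
      fun i l => Φ.traceOp A Δt w z i (Polynomial.X ^ (l : ℕ)),
      fun i l => Φ.fluxOp A Δt w b z i (Polynomial.X ^ (l : ℕ)))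
  map_add' z z' := by
    refine Prod.ext ?_ (Prod.ext ?_ (Prod.ext ?_ ?_))
    · ext i n j
      simp only [sideOp, Prod.fst_add, Prod.snd_add, Pi.add_apply, ev_add, lagged_zero_add,
        smul_add, Finset.sum_add_distrib]
      abel
    · funext i n l
      simp only [stepOp, Prod.fst_add, Prod.snd_add, Pi.add_apply, lagged_zero_add,
        smul_add, map_add]
      abel
    · funext i l
      simp only [traceOp, Prod.fst_add, Prod.snd_add, Pi.add_apply, map_add,
        Finset.sum_add_distrib]
      abel
    · funext i l
      simp only [fluxOp, Prod.fst_add, Prod.snd_add, Pi.add_apply, map_add, smul_add]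
      abel
  map_smul' r z := by
    refine Prod.ext ?_ (Prod.ext ?_ (Prod.ext ?_ ?_))
    · ext i n j
      simp only [sideOp, Prod.smul_fst, Prod.smul_snd, Pi.smul_apply, ev_smul, lagged_zero_smul,
        smul_sub, Finset.smul_sum, RingHom.id_apply, smul_comm r]
    · funext i n l
      simp only [stepOp, Prod.smul_fst, Prod.smul_snd, Pi.smul_apply, lagged_zero_smul,
        map_smul, smul_sub, smul_add, RingHom.id_apply, smul_comm r]
    · funext i l
      simp only [traceOp, Prod.smul_fst, Prod.smul_snd, Pi.smul_apply, map_smul, smul_sub,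
        Finset.smul_sum, RingHom.id_apply]
    · funext i l
      simp only [fluxOp, Prod.smul_fst, Prod.smul_snd, Pi.smul_apply, map_smul, smul_sub, map_add,
        smul_add, RingHom.id_apply, smul_comm r]

/-- The count per substep is `(q + 1) + 1 = ns + (q + 1 - ns + 1)`; the truncated subtraction is
genuine because `ns ≤ q + 1`. The interface blocks agree because the dual of `G` has the dimension
of `G`. -/
theorem finrank_state_eq_finrank_data [∀ i, FiniteDimensional ℝ (V i)] [FiniteDimensional ℝ G] :
    Module.finrank ℝ (State V G A.q A.r M) = Module.finrank ℝ (Data V G A.q A.ns A.r M) := by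
  have h := A.ns_le
  simp only [Module.finrank_prod, Module.finrank_pi_fintype, Subspace.dual_finrank_eq,
    Fin.sum_univ_two, Finset.sum_const, Finset.card_univ, Fintype.card_fin, smul_eq_mul]
  have h1 : ∀ d : ℕ, (A.q + 1) * d + d = A.ns * d + (A.q + 1 - A.ns + 1) * d := fun d => by
    rw [← add_mul, ← Nat.succ_mul]
    congr 1
    omega
  have h2 := congrArg (M 0 * ·) (h1 (Module.finrank ℝ (V 0)))
  have h3 := congrArg (M 1 * ·) (h1 (Module.finrank ℝ (V 1)))
  simp only [mul_add] at h2 h3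
  linarith

theorem op_bijective_of_injective [∀ i, FiniteDimensional ℝ (V i)] [FiniteDimensional ℝ G]
    (h : Function.Injective (Φ.op A Δt w (M := M) b)) :
    Function.Bijective (Φ.op A Δt w (M := M) b) :=
  ⟨h, (LinearMap.injective_iff_surjective_of_finrank_eq_finrank
    (finrank_state_eq_finrank_data A)).1 h⟩

end Forms

end Coupled

/-! ### Test polynomials and time levels in relative coordinates -/

/-- The affine polynomial that maps `a` to `0` and `a + δ` to `1`. -/
noncomputable def scaledX (a δ : ℝ) : Polynomial ℝ :=
  Polynomial.C δ⁻¹ * (Polynomial.X - Polynomial.C a)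

theorem eval_scaledX_pow {a δ : ℝ} (hδ : δ ≠ 0) (s : ℝ) (j : ℕ) :
    (scaledX a δ ^ j).eval (a + s * δ) = s ^ j := by
  simp only [scaledX, Polynomial.eval_pow, Polynomial.eval_mul, Polynomial.eval_C,
    Polynomial.eval_sub, Polynomial.eval_X]
  congr 1
  field_simp
  ring

theorem natDegree_scaledX_pow_le (a δ : ℝ) (j : ℕ) : (scaledX a δ ^ j).natDegree ≤ j := by
  refine Polynomial.natDegree_pow_le.trans ?_
  have : (scaledX a δ).natDegree ≤ 1 := by unfold scaledX; compute_degree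
  nlinarith

/-- As a test function, this antiderivative vanishes at the start of the substep, which removes the
previous side value, and its derivative produces the moment of order `j`. The factor `δ⁻¹` cancels
the length of the interval. -/
theorem derivative_scaledX_pow (a δ : ℝ) (j : ℕ) :
    Polynomial.derivative (Polynomial.C ((j : ℝ) + 1)⁻¹ * scaledX a δ ^ (j + 1))
      = Polynomial.C δ⁻¹ * scaledX a δ ^ j := by
  have h : ((j : ℝ) + 1) ≠ 0 := by positivity
  rw [Polynomial.derivative_C_mul, Polynomial.derivative_pow]
  simp only [scaledX, Polynomial.derivative_C_mul, Polynomial.derivative_sub,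
    Polynomial.derivative_X, Polynomial.derivative_C, sub_zero, mul_one, Nat.add_sub_cancel]
  apply Polynomial.funext
  intro x
  simp
  field_simp

theorem tl_succ (Δt : ℝ) (w Mi n : ℕ) : tl Δt w Mi (n + 1) = tl Δt w Mi n + Δt / Mi := by
  unfold tl; push_cast; ring

/-- Points of a substep in the relative coordinate of the coupling window. -/
theorem tl_add_mem_window (Δt : ℝ) (w : ℕ) {Mi : ℕ} (n : Fin Mi) {s : ℝ} (hs : s ∈ Icc (0 : ℝ) 1) :
    ∃ S ∈ Icc (0 : ℝ) 1, tl Δt w Mi n + s * (Δt / Mi) = ((w : ℝ) - 1) * Δt + S * Δt := by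
  have hM : (0 : ℝ) < Mi := by exact_mod_cast n.pos
  have hn : (n : ℝ) + 1 ≤ Mi := by exact_mod_cast n.2
  refine ⟨((n : ℝ) + s) / Mi, ⟨by have := hs.1; positivity, ?_⟩, ?_⟩
  · rw [div_le_one hM]; linarith [hs.2]
  · unfold tl; field_simp; ring

/-! ### A priori bounds for the homogeneous coupled problem -/

section Coupled

variable {V : Fin 2 → Type*} {G : Type*} [∀ i, AddCommGroup (V i)] [∀ i, Module ℝ (V i)]
  [AddCommGroup G] [Module ℝ G]

theorem lagged_zero_mem {W : Type*} [AddCommGroup W] {Mi : ℕ} (p : W → Prop) (h0 : p 0)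
    (U : Fin Mi → W) (hU : ∀ n, p (U n)) (n : Fin Mi) (l : ℕ) :
    p (lagged (fun _ => 0) U n l) := by
  unfold lagged; split_ifs
  · exact hU _
  · exact h0

namespace Forms

variable (Φ : Forms V G) (A : Method) (Δt : ℝ) (w : ℕ) {M : Fin 2 → ℕ} (b : Fin 2 → Fin 2 → ℝ)

/-- Norm of `L²(Ω_i)`. -/
noncomputable def nm (i : Fin 2) (v : V i) : ℝ := √(Φ.ip i v v)

/-- Norm of `L²(Γ)`. -/
noncomputable def nmG (μ : G) : ℝ := √(Φ.ipG μ μ)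

theorem nm_nonneg (i : Fin 2) (v : V i) : 0 ≤ Φ.nm i v := Real.sqrt_nonneg _

theorem nmG_nonneg (μ : G) : 0 ≤ Φ.nmG μ := Real.sqrt_nonneg _

theorem abs_ipG_le (μ η : G) : |Φ.ipG μ η| ≤ Φ.nmG μ * Φ.nmG η :=
  abs_apply_le_sqrt_mul_sqrt _ Φ.ipG_symm Φ.ipG_nonneg μ η

theorem eq_zero_of_nm_le_zero {i : Fin 2} {v : V i} (h : Φ.nm i v ≤ 0) : v = 0 :=
  Φ.ip_def i v ((Real.sqrt_eq_zero (Φ.ip_nonneg i v)).1 (le_antisymm h (Real.sqrt_nonneg _)))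

theorem eq_zero_of_nmG_le_zero {μ : G} (h : Φ.nmG μ ≤ 0) : μ = 0 :=
  Φ.ipG_def μ ((Real.sqrt_eq_zero (Φ.ipG_nonneg μ)).1 (le_antisymm h (Real.sqrt_nonneg _)))

/-- Moments control the size of a polynomial with values in the interface space. -/
theorem nmG_ev_le {r : ℕ} {K : ℝ} (hK0 : 0 ≤ K)
    (hK : ∀ p : Polynomial ℝ, p.natDegree ≤ r → ∀ κ, 0 ≤ κ →
      (∀ j ≤ r, |∫ s in (0 : ℝ)..1, p.eval s * s ^ j| ≤ κ) →
      ∀ s ∈ Icc (0 : ℝ) 1, |p.eval s| ≤ K * κ)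
    (x : Fin (r + 1) → G) {a δ κ : ℝ} (hδ : 0 < δ) (hκ : 0 ≤ κ)
    (h : ∀ j ≤ r, ∀ η, |∫ t in a..a + δ, (scaledX a δ ^ j).eval t * Φ.ipG (ev x t) η|
      ≤ δ * (κ * Φ.nmG η)) :
    ∀ s ∈ Icc (0 : ℝ) 1, Φ.nmG (ev x (a + s * δ)) ≤ K * κ := by
  intro s hs
  refine sqrt_apply_le_of_abs_apply_le Φ.ipG_nonneg (by positivity) fun η => ?_
  -- For a fixed `η` the problem becomes scalar on the unit interval.
  obtain ⟨p, hp, hpe⟩ := exists_poly_eval_eq_map_ev (Φ.ipG.flip η) x a δ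
  have h1 := hK p hp (κ * Φ.nmG η) (mul_nonneg hκ (Φ.nmG_nonneg η)) (fun j hj => ?_) s hs
  · rw [hpe, LinearMap.flip_apply, ← mul_assoc] at h1
    exact h1
  · have h2 := h j hj η
    rw [integral_eq_mul_integral_unit, abs_mul, abs_of_pos hδ] at h2
    have h3 := le_of_mul_le_mul_left h2 hδ
    simp_rw [hpe, LinearMap.flip_apply]
    simp_rw [eval_scaledX_pow hδ.ne', mul_comm (_ ^ j)] at h3
    exact h3

variable {Φ A Δt w b}

/-- The residual is linear in the time polynomial, so vanishing on monomials allows testing with the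
rescaled powers, which are bounded by `1` on the window. -/
theorem traceOp_eq_zero {z : State V G A.q A.r M} {i : Fin 2}
    (h : ∀ l < A.r i + 1, Φ.traceOp A Δt w z i (Polynomial.X ^ l) = 0) {P : Polynomial ℝ}
    (hP : P.natDegree < A.r i + 1) : Φ.traceOp A Δt w z i P = 0 := by
  ext η
  let E : Polynomial ℝ →ₗ[ℝ] ℝ :=
    { toFun := fun P => Φ.traceOp A Δt w z i P η
      map_add' := fun P Q => by
        simp only [traceOp, mom_add_poly, map_add, Finset.sum_add_distrib, LinearMap.sub_apply,
          LinearMap.add_apply]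
        ring
      map_smul' := fun r P => by
        simp only [traceOp, mom_smul_poly, map_smul, ← Finset.smul_sum, LinearMap.sub_apply,
          LinearMap.smul_apply, RingHom.id_apply, smul_sub] }
  exact linearMap_eq_zero_of_monomials E (fun l hl => by
    change Φ.traceOp A Δt w z i (Polynomial.X ^ l) η = 0
    rw [h l hl]; rfl) hP

theorem fluxOp_eq_zero {z : State V G A.q A.r M} {i : Fin 2}
    (h : ∀ l < A.r i + 1, Φ.fluxOp A Δt w b z i (Polynomial.X ^ l) = 0) {P : Polynomial ℝ}
    (hP : P.natDegree < A.r i + 1) : Φ.fluxOp A Δt w b z i P = 0 := by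
  ext η
  let E : Polynomial ℝ →ₗ[ℝ] ℝ :=
    { toFun := fun P => Φ.fluxOp A Δt w b z i P η
      map_add' := fun P Q => by
        simp only [fluxOp, mom_add_poly, map_add, smul_add, LinearMap.sub_apply,
          LinearMap.add_apply]
        ring
      map_smul' := fun r P => by
        simp only [fluxOp, mom_smul_poly, map_smul, map_add, LinearMap.sub_apply,
          LinearMap.smul_apply, LinearMap.add_apply, RingHom.id_apply, smul_eq_mul]
        ring }
  exact linearMap_eq_zero_of_monomials E (fun l hl => by
    change Φ.fluxOp A Δt w b z i (Polynomial.X ^ l) η = 0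
    rw [h l hl]; rfl) hP

theorem stepOp_eq_zero {z : State V G A.q A.r M} {i : Fin 2} {n : Fin (M i)} {N : ℕ}
    (h : ∀ l < N, Φ.stepOp A Δt w z i n (Polynomial.X ^ l) = 0) {P : Polynomial ℝ}
    (hP : P.natDegree < N) : Φ.stepOp A Δt w z i n P = 0 := by
  ext v
  let E : Polynomial ℝ →ₗ[ℝ] ℝ :=
    { toFun := fun P => Φ.stepOp A Δt w z i n P v
      map_add' := fun P Q => by
        simp only [stepOp, mom_add_poly, map_add, LinearMap.sub_apply,
          LinearMap.add_apply, Polynomial.eval_add, LinearMap.smul_apply, smul_eq_mul]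
        ring
      map_smul' := fun r P => by
        simp only [stepOp, mom_smul_poly, map_smul,
          LinearMap.sub_apply, LinearMap.smul_apply, LinearMap.add_apply, RingHom.id_apply,
          smul_eq_mul, Polynomial.eval_smul]
        ring }
  exact linearMap_eq_zero_of_monomials E (fun l hl => by
    change Φ.stepOp A Δt w z i n (Polynomial.X ^ l) v = 0
    rw [h l hl]; rfl) hP

theorem window_eq (Δt : ℝ) (w : ℕ) : (w : ℝ) * Δt = ((w : ℝ) - 1) * Δt + Δt := by ring

/-- Each substep contributes at most its length `Δt / M i` times a common bound. The lengths add up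
to `Δt`, so the estimate does not depend on the number of substeps. -/
theorem nmG_trace_le {z : State V G A.q A.r M} {i : Fin 2} (hΔt : 0 < Δt) (hM : 1 ≤ M i)
    (h : ∀ l < A.r i + 1, Φ.traceOp A Δt w z i (Polynomial.X ^ l) = 0)
    {K : ℝ} (hK0 : 0 ≤ K)
    (hK : ∀ p : Polynomial ℝ, p.natDegree ≤ A.r i → ∀ κ, 0 ≤ κ →
      (∀ j ≤ A.r i, |∫ s in (0 : ℝ)..1, p.eval s * s ^ j| ≤ κ) →
      ∀ s ∈ Icc (0 : ℝ) 1, |p.eval s| ≤ K * κ)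
    {γ Q : ℝ} (hγ : 0 ≤ γ) (hc : ∀ μ v, |Φ.c i μ v| ≤ γ * Φ.nmG μ * Φ.nm i v) (hQ0 : 0 ≤ Q)
    (hQ : ∀ (n : Fin (M i)), ∀ s ∈ Icc (0 : ℝ) 1,
      Φ.nm i (ev (z.1 i n) (tl Δt w (M i) n + s * (Δt / M i))) ≤ Q) :
    ∀ S ∈ Icc (0 : ℝ) 1, Φ.nmG (ev (z.2.2.1 i) (((w : ℝ) - 1) * Δt + S * Δt)) ≤ K * (γ * Q) := by
  have hMi : (0 : ℝ) < M i := by exact_mod_cast hM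
  refine Φ.nmG_ev_le hK0 hK _ hΔt (by positivity) fun j hj η => ?_
  have h1 := congrArg (fun f => f η) (traceOp_eq_zero h (P := scaledX (((w : ℝ) - 1) * Δt) Δt ^ j)
    ((natDegree_scaledX_pow_le _ _ _).trans_lt (by omega)))
  simp only [traceOp, LinearMap.sub_apply, LinearMap.sum_apply, LinearMap.zero_apply,
    LinearMap.flip_apply] at h1
  have e1 := map_mom (((w : ℝ) - 1) * Δt) (w * Δt) (scaledX (((w : ℝ) - 1) * Δt) Δt ^ j)
    (Φ.ipG.flip η) (z.2.2.1 i)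
  simp only [LinearMap.flip_apply] at e1
  rw [e1, sub_eq_zero, window_eq] at h1
  rw [h1]
  refine (Finset.abs_sum_le_sum_abs _ _).trans ?_
  have h2 : ∀ n : Fin (M i), |Φ.c i η (mom (tl Δt w (M i) n) (tl Δt w (M i) ((n : ℕ) + 1))
      (scaledX (((w : ℝ) - 1) * Δt) Δt ^ j) (z.1 i n))| ≤ Δt / M i * (γ * Q * Φ.nmG η) := by
    intro n
    rw [map_mom, tl_succ]
    refine abs_integral_le_of_abs_le (by positivity) fun s hs => ?_
    obtain ⟨S, hS, hSe⟩ := tl_add_mem_window Δt w n hs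
    rw [abs_mul]
    -- Only the test polynomial is passed to the window coordinate; the state keeps the substep
    -- coordinate in which its bound is stated.
    nth_rewrite 1 [hSe]
    rw [eval_scaledX_pow hΔt.ne', abs_of_nonneg (pow_nonneg hS.1 _)]
    calc S ^ j * |Φ.c i η (ev (z.1 i n) (tl Δt w (M i) n + s * (Δt / M i)))|
        ≤ 1 * (γ * Φ.nmG η * Q) := by
          refine mul_le_mul (pow_le_one₀ hS.1 hS.2) ((hc _ _).trans ?_) (abs_nonneg _) zero_le_one
          have := Φ.nmG_nonneg η
          gcongr
          exact hQ n s hs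
      _ = γ * Q * Φ.nmG η := by ring
  refine (Finset.sum_le_sum fun n _ => h2 n).trans (le_of_eq ?_)
  simp only [Finset.sum_const, Finset.card_univ, Fintype.card_fin, nsmul_eq_mul]
  field_simp

/-- The factor `2 * β` accounts for the two traces in the flux law; the same moment bound as for the
traces is applied a second time. -/
theorem nmG_flux_le {z : State V G A.q A.r M} {i : Fin 2} (hΔt : 0 < Δt)
    (h : ∀ l < A.r i + 1, Φ.fluxOp A Δt w b z i (Polynomial.X ^ l) = 0)
    {K : ℝ} (hK0 : 0 ≤ K)
    (hK : ∀ p : Polynomial ℝ, p.natDegree ≤ A.r i → ∀ κ, 0 ≤ κ →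
      (∀ j ≤ A.r i, |∫ s in (0 : ℝ)..1, p.eval s * s ^ j| ≤ κ) →
      ∀ s ∈ Icc (0 : ℝ) 1, |p.eval s| ≤ K * κ)
    {β κ : ℝ} (hβ0 : 0 ≤ β) (hβ : ∀ j, |b i j| ≤ β) (hκ : 0 ≤ κ)
    (hu : ∀ j, ∀ S ∈ Icc (0 : ℝ) 1,
      Φ.nmG (ev (z.2.2.1 j) (((w : ℝ) - 1) * Δt + S * Δt)) ≤ κ) :
    ∀ S ∈ Icc (0 : ℝ) 1,
      Φ.nmG (ev (z.2.2.2 i) (((w : ℝ) - 1) * Δt + S * Δt)) ≤ K * (2 * β * κ) := by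
  refine Φ.nmG_ev_le hK0 hK _ hΔt (by positivity) fun j hj η => ?_
  have h1 := congrArg (fun f => f η) (fluxOp_eq_zero h (P := scaledX (((w : ℝ) - 1) * Δt) Δt ^ j)
    ((natDegree_scaledX_pow_le _ _ _).trans_lt (by omega)))
  simp only [fluxOp, LinearMap.sub_apply, LinearMap.zero_apply, map_add, map_smul,
    LinearMap.add_apply, LinearMap.smul_apply] at h1
  have e1 : ∀ {n : ℕ} (x : Fin n → G), _ := fun {n} x =>
    map_mom (((w : ℝ) - 1) * Δt) (w * Δt) (scaledX (((w : ℝ) - 1) * Δt) Δt ^ j)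
    (Φ.ipG.flip η) x
  simp only [LinearMap.flip_apply] at e1
  rw [sub_eq_zero, e1, e1, e1, window_eq] at h1
  rw [h1]
  have h2 : ∀ l, |b i l • ∫ t in ((w : ℝ) - 1) * Δt..((w : ℝ) - 1) * Δt + Δt,
      (scaledX (((w : ℝ) - 1) * Δt) Δt ^ j).eval t * Φ.ipG (ev (z.2.2.1 l) t) η|
      ≤ β * (Δt * (κ * Φ.nmG η)) := by
    intro l
    rw [smul_eq_mul, abs_mul]
    have h3 := abs_integral_le_of_abs_le (a := ((w : ℝ) - 1) * Δt) (δ := Δt) (κ := κ * Φ.nmG η)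
      (g := fun t => (scaledX (((w : ℝ) - 1) * Δt) Δt ^ j).eval t * Φ.ipG (ev (z.2.2.1 l) t) η)
      hΔt.le fun S hS => by
        rw [abs_mul, eval_scaledX_pow hΔt.ne', abs_of_nonneg (pow_nonneg hS.1 _)]
        calc S ^ j * |Φ.ipG (ev (z.2.2.1 l) (((w : ℝ) - 1) * Δt + S * Δt)) η|
            ≤ 1 * (κ * Φ.nmG η) := by
              refine mul_le_mul (pow_le_one₀ hS.1 hS.2) ((Φ.abs_ipG_le _ _).trans ?_)
                (abs_nonneg _) zero_le_one
              have := Φ.nmG_nonneg η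
              gcongr
              exact hu l S hS
          _ = κ * Φ.nmG η := one_mul _
    exact mul_le_mul (hβ l) h3 (abs_nonneg _) hβ0
  refine (abs_add_le _ _).trans ((add_le_add (h2 0) (h2 1)).trans (le_of_eq ?_))
  ring

/-! ### Consequences of the variational equation of one substep -/

section Substep

variable {z : State V G A.q A.r M} {i : Fin 2} {n : Fin (M i)} {Λ γ Q φ : ℝ}

theorem stepOp_apply (z : State V G A.q A.r M) (i : Fin 2) (n : Fin (M i)) (P : Polynomial ℝ)
    (v : V i) : Φ.stepOp A Δt w z i n P v =
      P.eval (tl Δt w (M i) n + Δt / M i) * Φ.ip i (z.2.1 i n) v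
      - (∫ t in tl Δt w (M i) n..tl Δt w (M i) n + Δt / M i,
          (Polynomial.derivative P).eval t * Φ.ip i (ev (z.1 i n) t) v)
      - P.eval (tl Δt w (M i) n) * Φ.ip i (lagged (fun _ => 0) (z.2.1 i) n 1) v
      + (∫ t in tl Δt w (M i) n..tl Δt w (M i) n + Δt / M i,
          P.eval t * Φ.L i (ev (z.1 i n) t) v)
      + ∫ t in tl Δt w (M i) n..tl Δt w (M i) n + Δt / M i,
          P.eval t * Φ.c i (ev (z.2.2.2 i) t) v := by
  simp only [stepOp, LinearMap.sub_apply, LinearMap.add_apply, LinearMap.smul_apply, smul_eq_mul,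
    map_mom_apply, tl_succ]

theorem abs_forcing_le (hΔt : 0 < Δt) (hΛ : 0 ≤ Λ) (hγ : 0 ≤ γ)
    (hL : ∀ v w, |Φ.L i v w| ≤ Λ * Φ.nm i v * Φ.nm i w)
    (hc : ∀ μ v, |Φ.c i μ v| ≤ γ * Φ.nmG μ * Φ.nm i v)
    (hQ : ∀ s ∈ Icc (0 : ℝ) 1, Φ.nm i (ev (z.1 i n) (tl Δt w (M i) n + s * (Δt / M i))) ≤ Q)
    (hF : ∀ S ∈ Icc (0 : ℝ) 1, Φ.nmG (ev (z.2.2.2 i) (((w : ℝ) - 1) * Δt + S * Δt)) ≤ φ)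
    (P : Polynomial ℝ)
    (hP : ∀ s ∈ Icc (0 : ℝ) 1, |P.eval (tl Δt w (M i) n + s * (Δt / M i))| ≤ 1) (v : V i) :
    |(∫ t in tl Δt w (M i) n..tl Δt w (M i) n + Δt / M i, P.eval t * Φ.L i (ev (z.1 i n) t) v)
      + ∫ t in tl Δt w (M i) n..tl Δt w (M i) n + Δt / M i,
          P.eval t * Φ.c i (ev (z.2.2.2 i) t) v|
      ≤ Δt / M i * ((Λ * Q + γ * φ) * Φ.nm i v) := by
  have hδ : 0 ≤ Δt / M i := by positivity
  have h1 := abs_integral_le_of_abs_le (a := tl Δt w (M i) n) (κ := Λ * Q * Φ.nm i v)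
    (g := fun t => P.eval t * Φ.L i (ev (z.1 i n) t) v) hδ fun s hs => by
      rw [abs_mul, ← one_mul (Λ * Q * Φ.nm i v)]
      refine mul_le_mul (hP s hs) ((hL _ _).trans ?_) (abs_nonneg _) zero_le_one
      have := Φ.nm_nonneg i v
      gcongr
      exact hQ s hs
  have h2 := abs_integral_le_of_abs_le (a := tl Δt w (M i) n) (κ := γ * φ * Φ.nm i v)
    (g := fun t => P.eval t * Φ.c i (ev (z.2.2.2 i) t) v) hδ fun s hs => by
      rw [abs_mul, ← one_mul (γ * φ * Φ.nm i v)]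
      refine mul_le_mul (hP s hs) ((hc _ _).trans ?_) (abs_nonneg _) zero_le_one
      have := Φ.nm_nonneg i v
      obtain ⟨S, hS, hSe⟩ := tl_add_mem_window Δt w n hs
      gcongr
      rw [hSe]
      exact hF S hS
  refine (abs_add_le _ _).trans ((add_le_add h1 h2).trans (le_of_eq ?_))
  ring

/-- Testing with `P = 1` removes the time-derivative term, so the increment of the side value is the
integrated forcing. -/
theorem abs_ip_sub_lagged_le (hΔt : 0 < Δt) (hΛ : 0 ≤ Λ) (hγ : 0 ≤ γ)
    (hL : ∀ v w, |Φ.L i v w| ≤ Λ * Φ.nm i v * Φ.nm i w)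
    (hc : ∀ μ v, |Φ.c i μ v| ≤ γ * Φ.nmG μ * Φ.nm i v)
    (hQ : ∀ s ∈ Icc (0 : ℝ) 1, Φ.nm i (ev (z.1 i n) (tl Δt w (M i) n + s * (Δt / M i))) ≤ Q)
    (hF : ∀ S ∈ Icc (0 : ℝ) 1, Φ.nmG (ev (z.2.2.2 i) (((w : ℝ) - 1) * Δt + S * Δt)) ≤ φ)
    (h : ∀ l < A.q + 1 - A.ns + 1, Φ.stepOp A Δt w z i n (Polynomial.X ^ l) = 0) (v : V i) :
    |Φ.ip i (z.2.1 i n) v - Φ.ip i (lagged (fun _ => 0) (z.2.1 i) n 1) v|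
      ≤ Δt / M i * ((Λ * Q + γ * φ) * Φ.nm i v) := by
  have h1 := congrArg (fun f => f v) (stepOp_eq_zero h (P := 1) (by simp))
  have h2 := abs_forcing_le hΔt hΛ hγ hL hc hQ hF 1 (by simp) v
  simp only [stepOp_apply, Polynomial.derivative_one, Polynomial.eval_one, Polynomial.eval_zero,
    zero_mul, intervalIntegral.integral_zero, one_mul, LinearMap.zero_apply, sub_zero] at h1 h2
  rw [← abs_neg] at h2
  convert h2 using 2
  linarith

/-- The test polynomial is the antiderivative of the rescaled power `s ^ j` that is zero at the
start of the substep. Its degree `j + 1` is admissible exactly for `j < q + 1 - ns`, and its end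
value `1 / (j + 1)` multiplies the new side value. -/
theorem abs_moment_le (hΔt : 0 < Δt) (hΛ : 0 ≤ Λ) (hγ : 0 ≤ γ)
    (hL : ∀ v w, |Φ.L i v w| ≤ Λ * Φ.nm i v * Φ.nm i w)
    (hc : ∀ μ v, |Φ.c i μ v| ≤ γ * Φ.nmG μ * Φ.nm i v)
    (hQ : ∀ s ∈ Icc (0 : ℝ) 1, Φ.nm i (ev (z.1 i n) (tl Δt w (M i) n + s * (Δt / M i))) ≤ Q)
    (hF : ∀ S ∈ Icc (0 : ℝ) 1, Φ.nmG (ev (z.2.2.2 i) (((w : ℝ) - 1) * Δt + S * Δt)) ≤ φ)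
    (h : ∀ l < A.q + 1 - A.ns + 1, Φ.stepOp A Δt w z i n (Polynomial.X ^ l) = 0) (v : V i)
    {j : ℕ} (hj : j < A.q + 1 - A.ns) :
    |∫ s in (0 : ℝ)..1, Φ.ip i (ev (z.1 i n) (tl Δt w (M i) n + s * (Δt / M i))) v * s ^ j|
      ≤ |Φ.ip i (z.2.1 i n) v| + Δt / M i * ((Λ * Q + γ * φ) * Φ.nm i v) := by
  have hMi : (0 : ℝ) < M i := by exact_mod_cast n.pos
  have hδ : 0 < Δt / M i := by positivity
  set a := tl Δt w (M i) n with ha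
  set δ := Δt / M i with hδe
  set P : Polynomial ℝ := Polynomial.C ((j : ℝ) + 1)⁻¹ * scaledX a δ ^ (j + 1) with hPdef
  have hPe : ∀ s, P.eval (a + s * δ) = ((j : ℝ) + 1)⁻¹ * s ^ (j + 1) := fun s => by
    rw [hPdef, Polynomial.eval_mul, Polynomial.eval_C, eval_scaledX_pow hδ.ne']
  have hj1 : ((j : ℝ) + 1)⁻¹ ≤ 1 := by
    apply inv_le_one_of_one_le₀
    have : (0 : ℝ) ≤ j := by positivity
    linarith
  have hj0 : 0 ≤ ((j : ℝ) + 1)⁻¹ := by positivity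
  have h1 := congrArg (fun f => f v) (stepOp_eq_zero h (P := P)
    ((Polynomial.natDegree_C_mul_le _ _).trans_lt
      ((natDegree_scaledX_pow_le _ _ _).trans_lt (by omega))))
  have h2 := abs_forcing_le hΔt hΛ hγ hL hc hQ hF P (fun s hs => by
    rw [← ha, ← hδe, hPe, abs_of_nonneg (mul_nonneg hj0 (pow_nonneg hs.1 _))]
    exact mul_le_one₀ hj1 (pow_nonneg hs.1 _) (pow_le_one₀ hs.1 hs.2)) v
  have e1 : P.eval (a + δ) = ((j : ℝ) + 1)⁻¹ := by simpa using hPe 1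
  have e0 : P.eval a = 0 := by simpa using hPe 0
  have e2 : ∫ t in a..a + δ, (Polynomial.derivative P).eval t * Φ.ip i (ev (z.1 i n) t) v
      = ∫ s in (0 : ℝ)..1, Φ.ip i (ev (z.1 i n) (a + s * δ)) v * s ^ j := by
    rw [integral_eq_mul_integral_unit, ← intervalIntegral.integral_const_mul]
    congr 1
    ext s
    rw [hPdef, derivative_scaledX_pow, Polynomial.eval_mul, Polynomial.eval_C,
      eval_scaledX_pow hδ.ne']
    field_simp
  simp only [stepOp_apply, LinearMap.zero_apply, ← ha, ← hδe, e1, e0, e2, zero_mul,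
    sub_zero] at h1 h2
  have h3 : ∫ s in (0 : ℝ)..1, Φ.ip i (ev (z.1 i n) (a + s * δ)) v * s ^ j
      = ((j : ℝ) + 1)⁻¹ * Φ.ip i (z.2.1 i n) v
        + ((∫ t in a..a + δ, P.eval t * Φ.L i (ev (z.1 i n) t) v)
          + ∫ t in a..a + δ, P.eval t * Φ.c i (ev (z.2.2.2 i) t) v) := by linarith
  rw [h3]
  refine (abs_add_le _ _).trans (add_le_add ?_ h2)
  rw [abs_mul, abs_of_nonneg hj0]
  exact mul_le_of_le_one_left (abs_nonneg _) hj1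

end Substep

/-- The increments telescope from the zero history, and at most `M i` of them, each of order `Δt / M
i`, are summed. -/
theorem abs_ip_side_value_le {z : State V G A.q A.r M} {i : Fin 2} {B : ℝ}
    (h : ∀ (n : Fin (M i)) (v : V i),
      |Φ.ip i (z.2.1 i n) v - Φ.ip i (lagged (fun _ => 0) (z.2.1 i) n 1) v|
        ≤ Δt / M i * (B * Φ.nm i v)) (hΔt : 0 < Δt) (hB : 0 ≤ B) (n : Fin (M i)) (v : V i) :
    |Φ.ip i (z.2.1 i n) v| ≤ Δt * B * Φ.nm i v := by
  have hMi : (0 : ℝ) < M i := by exact_mod_cast n.pos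
  have hv := Φ.nm_nonneg i v
  have key : ∀ (k : ℕ) (hk : k < M i),
      |Φ.ip i (z.2.1 i ⟨k, hk⟩) v| ≤ (k + 1) * (Δt / M i * (B * Φ.nm i v)) := by
    intro k
    induction k with
    | zero =>
      intro hk
      have h1 := h ⟨0, hk⟩ v
      -- At the first substep the lagged value belongs to the history, which is zero.
      simpa [lagged] using h1
    | succ k ih =>
      intro hk
      have h1 := h ⟨k + 1, hk⟩ v
      have h2 := ih (by omega)
      have e : lagged (fun _ => 0) (z.2.1 i) ⟨k + 1, hk⟩ 1 = z.2.1 i ⟨k, by omega⟩ := by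
        simp [lagged]
      rw [e] at h1
      have h3 := abs_add_le (Φ.ip i (z.2.1 i ⟨k + 1, hk⟩) v - Φ.ip i (z.2.1 i ⟨k, by omega⟩) v)
        (Φ.ip i (z.2.1 i ⟨k, by omega⟩) v)
      rw [sub_add_cancel] at h3
      push_cast
      linarith
  refine (key n n.2).trans ?_
  have hn : (n : ℝ) + 1 ≤ M i := by exact_mod_cast n.2
  calc ((n : ℝ) + 1) * (Δt / M i * (B * Φ.nm i v)) ≤ M i * (Δt / M i * (B * Φ.nm i v)) := by
        gcongr
    _ = Δt * B * Φ.nm i v := by field_simp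

end Forms

end Coupled

/-! ### Contraction and unique solvability of the abstract problem -/

namespace Forms

section

variable {V : Fin 2 → Type*} {G : Type*} [∀ i, AddCommGroup (V i)] [∀ i, Module ℝ (V i)]
  [AddCommGroup G] [Module ℝ G] {Φ : Forms V G} {A : Method} {Δt : ℝ} {w : ℕ} {M : Fin 2 → ℕ}

/-- A starting value for the iteration, by compactness of the time intervals; its size is
irrelevant. -/
theorem exists_nm_ev_le (z : State V G A.q A.r M) :
    ∃ Q : ℝ, 0 ≤ Q ∧ ∀ i (n : Fin (M i)), ∀ s ∈ Icc (0 : ℝ) 1,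
      Φ.nm i (ev (z.1 i n) (tl Δt w (M i) n + s * (Δt / M i))) ≤ Q := by
  have h1 : ∀ i (n : Fin (M i)), ∃ B : ℝ, ∀ s ∈ Icc (0 : ℝ) 1,
      Φ.nm i (ev (z.1 i n) (tl Δt w (M i) n + s * (Δt / M i))) ≤ B := by
    intro i n
    have hcont : Continuous fun t => Φ.nm i (ev (z.1 i n) t) := by
      unfold nm
      refine Real.continuous_sqrt.comp ?_
      have : ∀ t, Φ.ip i (ev (z.1 i n) t) (ev (z.1 i n) t)
          = ∑ l : Fin (A.q + 1), t ^ (l : ℕ) * Φ.ip i (ev (z.1 i n) t) (z.1 i n l) :=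
        fun t => map_ev _ _ _
      simp_rw [this]
      refine continuous_finsetSum _ fun l _ => (continuous_pow _).mul ?_
      exact continuous_map_ev ((Φ.ip i).flip (z.1 i n l)) _
    obtain ⟨B, hB⟩ := isCompact_Icc.bddAbove_image (K := Icc (0 : ℝ) 1)
      (f := fun s => Φ.nm i (ev (z.1 i n) (tl Δt w (M i) n + s * (Δt / M i))))
      (hcont.comp (by fun_prop)).continuousOn
    exact ⟨B, fun s hs => hB (mem_image_of_mem _ hs)⟩
  choose B hB using h1
  refine ⟨∑ i, ∑ n, |B i n|, Finset.sum_nonneg fun i _ => Finset.sum_nonneg fun n _ => abs_nonneg _,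
    fun i n s hs => (hB i n s hs).trans ((le_abs_self _).trans ?_)⟩
  refine (Finset.single_le_sum (f := fun n => |B i n|) (fun n _ => abs_nonneg _)
    (Finset.mem_univ n)).trans ?_
  exact Finset.single_le_sum (f := fun i => ∑ n, |B i n|)
    (fun i _ => Finset.sum_nonneg fun n _ => abs_nonneg _) (Finset.mem_univ i)

/-- The scalar unisolvence bound is applied to the pairing with each test vector, and duality
recovers the norm. -/
theorem nm_ev_le_of_side_of_moments {K : ℝ} (hK0 : 0 ≤ K)
    (hK : ∀ p : Polynomial ℝ, p.natDegree ≤ A.q → ∀ κ, 0 ≤ κ →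
      (∀ j, |p.eval (A.θ j)| ≤ κ) →
      (∀ j < A.q + 1 - A.ns, |∫ s in (0 : ℝ)..1, p.eval s * s ^ j| ≤ κ) →
      ∀ s ∈ Icc (0 : ℝ) 1, |p.eval s| ≤ K * κ)
    {i : Fin 2} (c : Fin (A.q + 1) → V i) {a δ κ : ℝ} (hκ : 0 ≤ κ)
    (h1 : ∀ j v, |Φ.ip i (ev c (a + A.θ j * δ)) v| ≤ κ * Φ.nm i v)
    (h2 : ∀ j < A.q + 1 - A.ns, ∀ v,
      |∫ s in (0 : ℝ)..1, Φ.ip i (ev c (a + s * δ)) v * s ^ j| ≤ κ * Φ.nm i v) :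
    ∀ s ∈ Icc (0 : ℝ) 1, Φ.nm i (ev c (a + s * δ)) ≤ K * κ := by
  intro s hs
  refine sqrt_apply_le_of_abs_apply_le (Φ.ip_nonneg i) (by positivity) fun v => ?_
  obtain ⟨p, hp, hpe⟩ := exists_poly_eval_eq_map_ev ((Φ.ip i).flip v) c a δ
  have := hK p hp (κ * Φ.nm i v) (mul_nonneg hκ (Φ.nm_nonneg i v))
    (fun j => by rw [hpe]; exact h1 j v)
    (fun j hj => by simp_rw [hpe]; exact h2 j hj v) s hs
  rwa [hpe, ← mul_assoc] at this

theorem abs_ip_side_sum_le {i : Fin 2} (z : State V G A.q A.r M) (n : Fin (M i)) {D κ : ℝ}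
    (hD : ∀ j, ∑ l, |A.D j l| ≤ D) (hκ : 0 ≤ κ)
    (h : ∀ (n : Fin (M i)) v, |Φ.ip i (z.2.1 i n) v| ≤ κ * Φ.nm i v) (j : Fin A.ns) (v : V i) :
    |Φ.ip i (∑ l : Fin (A.ks + 1), A.D j l • lagged (fun _ => 0) (z.2.1 i) n l) v|
      ≤ D * κ * Φ.nm i v := by
  have hv := Φ.nm_nonneg i v
  have h1 : ∀ l : ℕ, |Φ.ip i (lagged (fun _ => 0) (z.2.1 i) n l) v| ≤ κ * Φ.nm i v := fun l =>
    lagged_zero_mem (fun x => |Φ.ip i x v| ≤ κ * Φ.nm i v) (by simp; positivity) _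
      (fun n => h n v) n l
  rw [map_sum, LinearMap.sum_apply]
  refine (Finset.abs_sum_le_sum_abs _ _).trans ?_
  calc ∑ l : Fin (A.ks + 1), |Φ.ip i (A.D j l • lagged (fun _ => 0) (z.2.1 i) n l) v|
      ≤ ∑ l : Fin (A.ks + 1), |A.D j l| * (κ * Φ.nm i v) := by
        refine Finset.sum_le_sum fun l _ => ?_
        rw [map_smul, LinearMap.smul_apply, smul_eq_mul, abs_mul]
        gcongr
        exact h1 l
    _ = (∑ l : Fin (A.ks + 1), |A.D j l|) * (κ * Φ.nm i v) := by rw [Finset.sum_mul]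
    _ ≤ D * (κ * Φ.nm i v) := by gcongr; exact hD j
    _ = D * κ * Φ.nm i v := by ring

end

/-- The coupled problem is uniquely solvable for small time steps; the threshold depends only on
the time discretization and the interface coefficients. -/
theorem exists_threshold_op_bijective (A : Method) {ψ : ℕ → Polynomial ℝ}
    (hψ : IsOrthBasis A.q ψ) (hD : (Dtilde A ψ).det ≠ 0) (b : Fin 2 → Fin 2 → ℝ) :
    ∃ C : ℝ, 0 < C ∧ ∀ {V : Fin 2 → Type} {G : Type} [∀ i, AddCommGroup (V i)]
      [∀ i, Module ℝ (V i)] [AddCommGroup G] [Module ℝ G] [∀ i, FiniteDimensional ℝ (V i)]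
      [FiniteDimensional ℝ G] (Φ : Forms V G) {Λ γ Δt : ℝ}, 0 ≤ Λ → 0 ≤ γ →
      (∀ i v w, |Φ.L i v w| ≤ Λ * Φ.nm i v * Φ.nm i w) →
      (∀ i μ v, |Φ.c i μ v| ≤ γ * Φ.nmG μ * Φ.nm i v) →
      0 < Δt → Δt * (Λ + γ ^ 2) ≤ C → ∀ (w : ℕ) {M : Fin 2 → ℕ}, (∀ i, 1 ≤ M i) →
      Function.Bijective (Φ.op A Δt w (M := M) b) := by
  obtain ⟨K, hK0, hK⟩ := exists_abs_eval_le_of_side_of_moments A hψ hD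
  choose Kr hKr0 hKr using fun i => exists_abs_eval_le_of_moments (A.r i)
  set R : ℝ := Kr 0 + Kr 1 with hR
  have hR0 : 0 ≤ R := add_nonneg (hKr0 0) (hKr0 1)
  have hKR : ∀ i, Kr i ≤ R := by
    intro i; fin_cases i
    · simpa [hR] using hKr0 1
    · simpa [hR] using hKr0 0
  set β : ℝ := ∑ i, ∑ j, |b i j| with hβ
  have hβ0 : 0 ≤ β := Finset.sum_nonneg fun i _ => Finset.sum_nonneg fun j _ => abs_nonneg _
  have hbβ : ∀ i j, |b i j| ≤ β := fun i j =>
    (Finset.single_le_sum (f := fun j => |b i j|) (fun j _ => abs_nonneg _)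
      (Finset.mem_univ j)).trans (Finset.single_le_sum (f := fun i => ∑ j, |b i j|)
      (fun i _ => Finset.sum_nonneg fun j _ => abs_nonneg _) (Finset.mem_univ i))
  set D : ℝ := ∑ j, ∑ l, |A.D j l| with hDdef
  have hD0 : 0 ≤ D := Finset.sum_nonneg fun i _ => Finset.sum_nonneg fun j _ => abs_nonneg _
  have hDj : ∀ j, ∑ l, |A.D j l| ≤ D := fun j =>
    Finset.single_le_sum (f := fun j => ∑ l, |A.D j l|)
      (fun i _ => Finset.sum_nonneg fun j _ => abs_nonneg _) (Finset.mem_univ j)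
  -- One factor `R` comes from the projection of the traces, the other from the flux equation.
  set κ : ℝ := R * (2 * β * R) with hκdef
  have hκ0 : 0 ≤ κ := by positivity
  -- The threshold makes the gain factor `K * (D + 2) * (1 + κ) * C` less than `1 / 2`; the summand
  -- `1` keeps the denominator positive.
  refine ⟨(2 * (K * (D + 2) * (1 + κ) + 1))⁻¹, by positivity, ?_⟩
  intro V G _ _ _ _ _ _ Φ Λ γ Δt hΛ hγ hL hc hΔt hsmall w M hM
  apply op_bijective_of_injective
  rw [← LinearMap.ker_eq_bot, LinearMap.ker_eq_bot']
  intro z hz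
  have hMi : ∀ i, (0 : ℝ) < M i := fun i => by exact_mod_cast hM i
  have hside : ∀ i (n : Fin (M i)) j, sideOp A Δt w z i n j = 0 := fun i n j =>
    congrFun (congrFun (congrFun (congrArg Prod.fst hz) i) n) j
  have hstep : ∀ i (n : Fin (M i)), ∀ l < A.q + 1 - A.ns + 1,
      Φ.stepOp A Δt w z i n (Polynomial.X ^ l) = 0 := fun i n l hl =>
    congrFun (congrFun (congrFun (congrArg (fun x => x.2.1) hz) i) n) ⟨l, hl⟩
  have htrace : ∀ i, ∀ l < A.r i + 1, Φ.traceOp A Δt w z i (Polynomial.X ^ l) = 0 :=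
    fun i l hl => congrFun (congrFun (congrArg (fun x => x.2.2.1) hz) i) ⟨l, hl⟩
  have hflux : ∀ i, ∀ l < A.r i + 1, Φ.fluxOp A Δt w b z i (Polynomial.X ^ l) = 0 :=
    fun i l hl => congrFun (congrFun (congrArg (fun x => x.2.2.2) hz) i) ⟨l, hl⟩
  let bound : ℝ → Prop := fun Q => ∀ i (n : Fin (M i)), ∀ s ∈ Icc (0 : ℝ) 1,
      Φ.nm i (ev (z.1 i n) (tl Δt w (M i) n + s * (Δt / M i))) ≤ Q
  -- bounds of all unknowns by the size of the states
  have hG : ∀ Q, 0 ≤ Q → bound Q → ∀ i, ∀ S ∈ Icc (0 : ℝ) 1,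
      Φ.nmG (ev (z.2.2.1 i) (((w : ℝ) - 1) * Δt + S * Δt)) ≤ R * (γ * Q) := by
    intro Q hQ0 hQ i S hS
    refine (nmG_trace_le hΔt (hM i) (htrace i) (hKr0 i) (hKr i) hγ (hc i) hQ0 (hQ i) S hS).trans ?_
    gcongr
    exact hKR i
  have hF : ∀ Q, 0 ≤ Q → bound Q → ∀ i, ∀ S ∈ Icc (0 : ℝ) 1,
      Φ.nmG (ev (z.2.2.2 i) (((w : ℝ) - 1) * Δt + S * Δt)) ≤ κ * γ * Q := by
    intro Q hQ0 hQ i S hS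
    refine (nmG_flux_le hΔt (hflux i) (hKr0 i) (hKr i) hβ0 (hbβ i) (by positivity)
      (hG Q hQ0 hQ) S hS).trans ?_
    calc Kr i * (2 * β * (R * (γ * Q))) ≤ R * (2 * β * (R * (γ * Q))) := by
          gcongr; exact hKR i
      _ = κ * γ * Q := by rw [hκdef]; ring
  have hU : ∀ Q, 0 ≤ Q → bound Q → ∀ i (n : Fin (M i)) v,
      |Φ.ip i (z.2.1 i n) v| ≤ Δt * (Λ * Q + γ * (κ * γ * Q)) * Φ.nm i v := by
    intro Q hQ0 hQ i n v
    exact abs_ip_side_value_le (fun n v => abs_ip_sub_lagged_le hΔt hΛ hγ (hL i) (hc i) (hQ i n)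
      (hF Q hQ0 hQ i) (hstep i n) v) hΔt (by positivity) n v
  -- With `ε` bounding the side values, the node values are at most `D * ε` and the moments at most
  -- `2 * ε`, one `ε` from the side value and one from the forcing. `(D + 2) * ε` is a common bound.
  have hhalf : ∀ Q, 0 ≤ Q → bound Q → bound (Q / 2) := by
    intro Q hQ0 hQ i n
    set ε := Δt * (Λ * Q + γ * (κ * γ * Q)) with hε
    have hε0 : 0 ≤ ε := by positivity
    have h1 : K * ((D + 2) * ε) ≤ Q / 2 := by
      have e1 : ε ≤ (1 + κ) * (2 * (K * (D + 2) * (1 + κ) + 1))⁻¹ * Q := by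
        calc ε ≤ (1 + κ) * (Δt * (Λ + γ ^ 2)) * Q := by
              rw [hε]
              -- The difference between `(1 + κ) * (Λ + γ ^ 2)` and `Λ + κ * γ ^ 2`, multiplied by
              -- `Δt * Q`.
              have : 0 ≤ Δt * Q * (κ * Λ + γ ^ 2) := by positivity
              linarith
          _ ≤ _ := by gcongr
      calc K * ((D + 2) * ε)
          ≤ K * ((D + 2) * ((1 + κ) * (2 * (K * (D + 2) * (1 + κ) + 1))⁻¹ * Q)) := by gcongr
        _ = (K * (D + 2) * (1 + κ)) / (K * (D + 2) * (1 + κ) + 1) * (Q / 2) := by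
            rw [mul_inv]; ring
        _ ≤ 1 * (Q / 2) := by
            gcongr
            rw [div_le_one (by positivity)]
            linarith
        _ = Q / 2 := one_mul _
    intro s hs
    refine le_trans ?_ h1
    refine nm_ev_le_of_side_of_moments hK0 hK (z.1 i n) (by positivity) ?_ ?_ s hs
    · intro j v
      have h2 := hside i n j
      rw [sideOp, sub_eq_zero] at h2
      rw [h2]
      refine (abs_ip_side_sum_le z n hDj hε0 (fun n v => hU Q hQ0 hQ i n v) j v).trans ?_
      have := Φ.nm_nonneg i v
      gcongr
      linarith
    · intro j hj v
      refine (abs_moment_le hΔt hΛ hγ (hL i) (hc i) (hQ i n) (hF Q hQ0 hQ i) (hstep i n) v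
        hj).trans ?_
      have hv := Φ.nm_nonneg i v
      have h3 : Δt / M i * ((Λ * Q + γ * (κ * γ * Q)) * Φ.nm i v) ≤ ε * Φ.nm i v := by
        rw [hε, ← mul_assoc]
        have hM1 : (1 : ℝ) ≤ M i := by exact_mod_cast hM i
        gcongr
        exact div_le_self hΔt.le hM1
      have h4 := hU Q hQ0 hQ i n v
      have h5 : 0 ≤ D * ε * Φ.nm i v := by positivity
      calc _ ≤ ε * Φ.nm i v + ε * Φ.nm i v := add_le_add h4 h3
        _ ≤ (D + 2) * ε * Φ.nm i v := by linarith
  -- Repeated halving sends the initial bound to zero.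
  have hzero : bound 0 := by
    obtain ⟨Q, hQ0, hQ⟩ := exists_nm_ev_le (Φ := Φ) (Δt := Δt) (w := w) z
    have hk : ∀ k : ℕ, bound (Q * (1 / 2) ^ k) := by
      intro k
      induction k with
      | zero => rw [pow_zero, mul_one]; exact hQ
      | succ k ih =>
        have := hhalf _ (by positivity) ih
        rwa [show Q * (1 / 2) ^ k / 2 = Q * (1 / 2 : ℝ) ^ (k + 1) by ring] at this
    intro i n s hs
    have hlim : Filter.Tendsto (fun k : ℕ => Q * (1 / 2 : ℝ) ^ k) Filter.atTop (nhds (Q * 0)) :=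
      (tendsto_pow_atTop_nhds_zero_of_lt_one (by norm_num) (by norm_num)).const_mul Q
    rw [mul_zero] at hlim
    exact ge_of_tendsto' hlim fun k => hk k i n s hs
  -- Interface polynomials that vanish throughout the window have zero coefficients, because the
  -- window has positive length.
  have hwin : ∀ {r : ℕ} (x : Fin (r + 1) → G),
      (∀ S ∈ Icc (0 : ℝ) 1, Φ.nmG (ev x (((w : ℝ) - 1) * Δt + S * Δt)) ≤ 0) → x = 0 :=
    fun x hx => coeff_eq_zero_of_ev_eq_zero Φ.ipG_def _ _ hΔt fun S hS =>
      Φ.eq_zero_of_nmG_le_zero (hx S hS)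
  refine Prod.ext ?_ (Prod.ext ?_ (Prod.ext ?_ ?_))
  · funext i n
    exact coeff_eq_zero_of_ev_eq_zero (Φ.ip_def i) _ _ (div_pos hΔt (hMi i)) fun s hs =>
      Φ.eq_zero_of_nm_le_zero (hzero i n s hs)
  · funext i n
    apply Φ.ip_def
    have := hU 0 le_rfl hzero i n (z.2.1 i n)
    simpa using this
  · funext i
    exact hwin _ fun S hS => (hG 0 le_rfl hzero i S hS).trans (by simp)
  · funext i
    exact hwin _ fun S hS => (hF 0 le_rfl hzero i S hS).trans (by simp)

end Forms

/-! ### Polynomials on balls -/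

section LocalPolynomials

variable {n : ℕ}

/-- The polynomial function of a multivariate polynomial. -/
noncomputable def polyFun (p : MvPolynomial (Fin n) ℝ) : EuclideanSpace ℝ (Fin n) → ℝ :=
  fun x => MvPolynomial.eval (fun j => x j) p

theorem contDiff_polyFun (p : MvPolynomial (Fin n) ℝ) : ContDiff ℝ 1 (polyFun p) := by
  induction p using MvPolynomial.induction_on with
  | C a =>
    unfold polyFun
    simp only [MvPolynomial.eval_C]
    exact contDiff_const
  | add p q hp hq =>
    unfold polyFun at *
    simp only [map_add]
    exact hp.add hq
  | mul_X p j hp =>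
    have : ContDiff ℝ 1 fun x : EuclideanSpace ℝ (Fin n) => x j := by fun_prop
    unfold polyFun at *
    simp only [map_mul, MvPolynomial.eval_X]
    exact hp.mul this

theorem continuous_polyFun (p : MvPolynomial (Fin n) ℝ) : Continuous (polyFun p) :=
  (contDiff_polyFun p).continuous

theorem polyFun_add (p q : MvPolynomial (Fin n) ℝ) : polyFun (p + q) = polyFun p + polyFun q := by
  ext x; simp [polyFun]

theorem polyFun_smul (r : ℝ) (p : MvPolynomial (Fin n) ℝ) : polyFun (r • p) = r • polyFun p := by
  ext x; simp [polyFun, MvPolynomial.smul_eval]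

theorem exists_polyFun_comp_affine (p : MvPolynomial (Fin n) ℝ) (x₀ : EuclideanSpace ℝ (Fin n))
    (h : ℝ) : ∃ p' : MvPolynomial (Fin n) ℝ, p'.totalDegree ≤ p.totalDegree ∧
      ∀ y, polyFun p' y = polyFun p (x₀ + h • y) := by
  set f : Fin n → MvPolynomial (Fin n) ℝ := fun j =>
    MvPolynomial.C (x₀ j) + MvPolynomial.C h * MvPolynomial.X j with hf
  have hfd : ∀ j, (f j).totalDegree ≤ 1 := by
    intro j
    refine (MvPolynomial.totalDegree_add _ _).trans (max_le (by simp) ?_)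
    refine (MvPolynomial.totalDegree_mul _ _).trans (by simp)
  refine ⟨MvPolynomial.eval₂ MvPolynomial.C f p, ?_, fun y => ?_⟩
  · rw [MvPolynomial.eval₂_eq']
    refine MvPolynomial.totalDegree_finsetSum_le fun d hd => ?_
    refine (MvPolynomial.totalDegree_mul _ _).trans ?_
    rw [MvPolynomial.totalDegree_C, zero_add]
    refine (MvPolynomial.totalDegree_finsetProd _ _).trans ?_
    refine le_trans ?_ (MvPolynomial.le_totalDegree hd)
    rw [Finsupp.sum_fintype _ _ (fun _ => rfl)]
    refine Finset.sum_le_sum fun j _ => (MvPolynomial.totalDegree_pow _ _).trans ?_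
    have := hfd j
    nlinarith
  · unfold polyFun
    rw [MvPolynomial.eval₂_eq', map_sum, MvPolynomial.eval_eq']
    simp [hf]

/-- An open set contains a product of intervals, and a polynomial that vanishes on a product of
infinite sets is zero. -/
theorem polyFun_eq_zero_of_isOpen {p : MvPolynomial (Fin n) ℝ}
    {U : Set (EuclideanSpace ℝ (Fin n))} (hU : IsOpen U) (hne : U.Nonempty)
    (h : ∀ x ∈ U, polyFun p x = 0) : p = 0 := by
  obtain ⟨x, hx⟩ := hne
  have hcont : Continuous (WithLp.toLp 2 : (Fin n → ℝ) → EuclideanSpace ℝ (Fin n)) :=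
    PiLp.continuous_toLp 2 _
  obtain ⟨ε, hε, hball⟩ := Metric.isOpen_iff.1 (hU.preimage hcont) (fun j => x j) (by exact hx)
  refine MvPolynomial.funext_set (fun j => Metric.ball (x j) ε) (fun j => ?_) fun y hy => ?_
  · rw [Real.ball_eq_Ioo]
    exact Ioo_infinite (by linarith)
  · rw [← ball_pi _ hε] at hy
    have := h _ (hball hy)
    simpa [polyFun] using this

theorem integrableOn_ball_of_continuous {f : EuclideanSpace ℝ (Fin n) → ℝ} (hf : Continuous f)
    (x : EuclideanSpace ℝ (Fin n)) (r : ℝ) : IntegrableOn f (Metric.ball x r) :=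
  (hf.continuousOn.integrableOn_compact (isCompact_closedBall x r)).mono_set
    Metric.ball_subset_closedBall

/-- On polynomials of bounded degree the values and derivatives on the unit ball are controlled by
the `L²` norm over a smaller ball. -/
theorem exists_polyFun_bound_unit (K : ℕ) {σ : ℝ} (hσ : 0 < σ) :
    ∃ C : ℝ, 0 ≤ C ∧ ∀ p : MvPolynomial (Fin n) ℝ, p.totalDegree ≤ K →
      ∀ y ∈ Metric.closedBall (0 : EuclideanSpace ℝ (Fin n)) 1,
        (polyFun p y) ^ 2 ≤ C * ∫ x in Metric.ball 0 σ, polyFun p x ^ 2 ∧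
        ‖fderiv ℝ (polyFun p) y‖ ^ 2 ≤ C * ∫ x in Metric.ball 0 σ, polyFun p x ^ 2 := by
  let X := MvPolynomial.restrictTotalDegree (Fin n) ℝ K
  let B : X →ₗ[ℝ] X →ₗ[ℝ] ℝ := LinearMap.mk₂ ℝ
    (fun p q => ∫ x in Metric.ball 0 σ, polyFun p.1 x * polyFun q.1 x)
    (fun p p' q => by
      simp only [Submodule.coe_add, polyFun_add, Pi.add_apply, add_mul]
      exact integral_add
        (integrableOn_ball_of_continuous ((continuous_polyFun _).mul (continuous_polyFun _)) _ _)
        (integrableOn_ball_of_continuous ((continuous_polyFun _).mul (continuous_polyFun _)) _ _))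
    (fun r p q => by
      simp only [Submodule.coe_smul, polyFun_smul, Pi.smul_apply, smul_eq_mul, mul_assoc]
      exact integral_const_mul _ _)
    (fun p q q' => by
      simp only [Submodule.coe_add, polyFun_add, Pi.add_apply, mul_add]
      exact integral_add
        (integrableOn_ball_of_continuous ((continuous_polyFun _).mul (continuous_polyFun _)) _ _)
        (integrableOn_ball_of_continuous ((continuous_polyFun _).mul (continuous_polyFun _)) _ _))
    (fun r p q => by
      simp only [Submodule.coe_smul, polyFun_smul, Pi.smul_apply, smul_eq_mul, mul_left_comm _ r]
      exact integral_const_mul _ _)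
  have hB : ∀ p q : X, B p q = ∫ x in Metric.ball 0 σ, polyFun p.1 x * polyFun q.1 x :=
    fun p q => rfl
  have hB0 : ∀ p : X, 0 ≤ B p p := fun p => by
    rw [hB]; exact integral_nonneg fun x => mul_self_nonneg _
  have hBd : ∀ p : X, B p p = 0 → p = 0 := by
    intro p hp
    have hc := (continuous_polyFun p.1).mul (continuous_polyFun p.1)
    rw [hB, setIntegral_eq_zero_iff_of_nonneg_ae
      (Filter.Eventually.of_forall fun x => mul_self_nonneg _)
      (integrableOn_ball_of_continuous hc _ _)] at hp
    have := Measure.eqOn_open_of_ae_eq hp Metric.isOpen_ball hc.continuousOn continuousOn_const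
    apply Subtype.ext
    exact polyFun_eq_zero_of_isOpen Metric.isOpen_ball ⟨0, Metric.mem_ball_self hσ⟩
      fun x hx => mul_self_eq_zero.1 (this hx)
  let e := Module.finBasis ℝ X
  choose c hc0 hc using fun i => exists_sq_le_of_posDef B
    (fun p q => by rw [hB, hB]; simp only [mul_comm]) hB0 hBd (e.coord i)
  have hb : ∀ i, ∃ β : ℝ, ∀ y ∈ Metric.closedBall (0 : EuclideanSpace ℝ (Fin n)) 1,
      |polyFun (e i).1 y| ≤ β ∧ ‖fderiv ℝ (polyFun (e i).1) y‖ ≤ β := by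
    intro i
    have hd := contDiff_polyFun (e i).1
    obtain ⟨β₁, h₁⟩ := (isCompact_closedBall (0 : EuclideanSpace ℝ (Fin n))
      1).exists_bound_of_continuousOn hd.continuous.continuousOn
    obtain ⟨β₂, h₂⟩ := (isCompact_closedBall (0 : EuclideanSpace ℝ (Fin n))
      1).exists_bound_of_continuousOn (hd.continuous_fderiv (by norm_num)).continuousOn
    exact ⟨max β₁ β₂, fun y hy => ⟨(h₁ y hy).trans (le_max_left _ _),
      (h₂ y hy).trans (le_max_right _ _)⟩⟩
  choose β hβ using hb
  -- Here `√(c i)` bounds the coordinates by the `L²` norm on the small ball, and `β i` bounds the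
  -- basis polynomial and its derivative on the unit ball.
  refine ⟨(∑ i, √(c i) * β i) ^ 2, sq_nonneg _, fun p hp y hy => ?_⟩
  let p' : X := ⟨p, (MvPolynomial.mem_restrictTotalDegree _ _ _).2 hp⟩
  have hβ0 : ∀ i, 0 ≤ β i := fun i => (abs_nonneg _).trans (hβ i y hy).1
  have hcoord : ∀ i, |e.repr p' i| ≤ √(c i) * √(B p' p') := by
    intro i
    rw [← Real.sqrt_mul (hc0 i)]
    exact Real.abs_le_sqrt (hc i p')
  have hsum : polyFun p = ∑ i, e.repr p' i • polyFun (e i).1 := by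
    have h1 : p = ∑ i, e.repr p' i • (e i).1 := by
      have := congrArg X.subtype (e.sum_repr p')
      simp only [map_sum, map_smul, Submodule.subtype_apply] at this
      exact this.symm
    conv_lhs => rw [h1]
    ext x
    simp [polyFun, MvPolynomial.smul_eval]
  have hBp : ∫ x in Metric.ball 0 σ, polyFun p x ^ 2 = B p' p' := by
    rw [hB]; simp only [p', sq]
  have hfin : ∀ a : ℝ, 0 ≤ a → a ≤ ∑ i, |e.repr p' i| * β i →
      a ^ 2 ≤ (∑ i, √(c i) * β i) ^ 2 * ∫ x in Metric.ball 0 σ, polyFun p x ^ 2 := by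
    intro a ha h
    have h2 : a ≤ (∑ i, √(c i) * β i) * √(B p' p') := by
      refine h.trans ?_
      rw [Finset.sum_mul]
      refine Finset.sum_le_sum fun i _ => ?_
      have := hβ0 i
      calc |e.repr p' i| * β i ≤ √(c i) * √(B p' p') * β i := by gcongr; exact hcoord i
        _ = _ := by ring
    rw [hBp]
    calc a ^ 2 ≤ ((∑ i, √(c i) * β i) * √(B p' p')) ^ 2 := by gcongr
      _ = _ := by rw [mul_pow, Real.sq_sqrt (hB0 p')]
  constructor
  · rw [← sq_abs]
    refine hfin _ (abs_nonneg _) ?_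
    rw [hsum, Finset.sum_apply]
    refine (Finset.abs_sum_le_sum_abs _ _).trans (Finset.sum_le_sum fun i _ => ?_)
    rw [Pi.smul_apply, smul_eq_mul, abs_mul]
    gcongr
    exact (hβ i y hy).1
  · refine hfin _ (norm_nonneg _) ?_
    have hd : ∀ i, DifferentiableAt ℝ (polyFun (e i).1) y := fun i =>
      (contDiff_polyFun _).differentiable (by norm_num) y
    have hder : HasFDerivAt (polyFun p) (∑ i, e.repr p' i • fderiv ℝ (polyFun (e i).1) y) y := by
      rw [hsum]
      exact HasFDerivAt.sum fun i _ => (hd i).hasFDerivAt.const_smul _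
    rw [hder.fderiv]
    refine (norm_sum_le _ _).trans (Finset.sum_le_sum fun i _ => ?_)
    rw [norm_smul, Real.norm_eq_abs]
    gcongr
    exact (hβ i y hy).2

theorem setIntegral_ball_affine (f : EuclideanSpace ℝ (Fin n) → ℝ)
    (x₀ : EuclideanSpace ℝ (Fin n)) {h σ : ℝ} (hh : 0 < h) :
    ∫ y in Metric.ball 0 σ, f (x₀ + h • y) = (h ^ n)⁻¹ * ∫ x in Metric.ball x₀ (σ * h), f x := by
  have h1 := Measure.setIntegral_comp_smul_of_pos (volume : Measure (EuclideanSpace ℝ (Fin n)))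
    (fun y => f (x₀ + y)) (Metric.ball 0 σ) hh
  rw [h1, smul_ball hh.ne', smul_zero, finrank_euclideanSpace_fin, smul_eq_mul, Real.norm_eq_abs,
    abs_of_pos hh, mul_comm h σ]
  congr 1
  have h2 := (measurePreserving_add_left (volume : Measure (EuclideanSpace ℝ (Fin n)))
    x₀).setIntegral_preimage_emb (measurableEmbedding_addLeft x₀) f (Metric.ball x₀ (σ * h))
  rw [← h2, preimage_add_ball, sub_self]

/-- The scaled local inverse estimates. -/
theorem exists_polyFun_bound (n K : ℕ) {σ : ℝ} (hσ : 0 < σ) :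
    ∃ C : ℝ, 0 ≤ C ∧ ∀ p : MvPolynomial (Fin n) ℝ, p.totalDegree ≤ K →
      ∀ (x₀ : EuclideanSpace ℝ (Fin n)) (h : ℝ), 0 < h → ∀ x ∈ Metric.closedBall x₀ h,
        (polyFun p x) ^ 2 ≤ C * (h ^ n)⁻¹ * ∫ x in Metric.ball x₀ (σ * h), polyFun p x ^ 2 ∧
        ‖fderiv ℝ (polyFun p) x‖ ^ 2
          ≤ C * (h ^ n)⁻¹ * (h ^ 2)⁻¹ * ∫ x in Metric.ball x₀ (σ * h), polyFun p x ^ 2 := by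
  obtain ⟨C, hC, hb⟩ := exists_polyFun_bound_unit (n := n) K hσ
  refine ⟨C, hC, fun p hp x₀ h hh x hx => ?_⟩
  obtain ⟨p', hp', hpe⟩ := exists_polyFun_comp_affine p x₀ h
  set y := h⁻¹ • (x - x₀) with hy
  have hxy : x₀ + h • y = x := by rw [hy, smul_inv_smul₀ hh.ne']; abel
  have hymem : y ∈ Metric.closedBall (0 : EuclideanSpace ℝ (Fin n)) 1 := by
    rw [mem_closedBall_zero_iff, hy, norm_smul, norm_inv, Real.norm_eq_abs, abs_of_pos hh,
      inv_mul_le_one₀ hh, ← dist_eq_norm]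
    exact hx
  obtain ⟨h1, h2⟩ := hb p' (hp'.trans hp) y hymem
  have hint : ∫ z in Metric.ball 0 σ, polyFun p' z ^ 2
      = (h ^ n)⁻¹ * ∫ x in Metric.ball x₀ (σ * h), polyFun p x ^ 2 := by
    simp_rw [hpe]
    exact setIntegral_ball_affine (fun x => polyFun p x ^ 2) x₀ hh
  rw [hint, ← mul_assoc] at h1 h2
  constructor
  · rwa [hpe, hxy] at h1
  · have hfun : polyFun p' = fun z => polyFun p (x₀ + h • z) := funext hpe
    have hd : HasFDerivAt (polyFun p) (fderiv ℝ (polyFun p) x) (x₀ + h • y) := by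
      rw [hxy]
      exact ((contDiff_polyFun p).differentiable (by norm_num) x).hasFDerivAt
    have hin : HasFDerivAt (fun z : EuclideanSpace ℝ (Fin n) => x₀ + h • z)
        (h • ContinuousLinearMap.id ℝ _) y :=
      ((hasFDerivAt_id y).const_smul h).const_add x₀
    have hcomp := hd.comp y hin
    have he : fderiv ℝ (polyFun p') y = h • fderiv ℝ (polyFun p) x := by
      rw [hfun]
      refine hcomp.fderiv.trans ?_
      ext v
      simp
    rw [he, norm_smul, Real.norm_eq_abs, abs_of_pos hh, mul_pow] at h2
    have hh2 : 0 < h ^ 2 := by positivity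
    -- The chain rule has produced the factor `h ^ 2` in front of the squared derivative; it is
    -- moved to the other side.
    rw [mul_right_comm, mul_comm _ (h ^ 2)⁻¹, ← div_eq_inv_mul, le_div_iff₀ hh2, mul_comm]
    exact h2

end LocalPolynomials

/-- One total degree covers both element types, so a single finite-dimensional space carries the
local estimates and no reference element is needed. -/
theorem totalDegree_le_of_mem_localPoly {n : ℕ} {kd : Kind} {k : ℕ} {p : MvPolynomial (Fin n) ℝ}
    (hp : p ∈ localPoly n kd k) : p.totalDegree ≤ (n + 1) * k := by
  cases kd with
  | simplex =>
    have h := (MvPolynomial.mem_restrictTotalDegree _ _ _).1 hp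
    refine h.trans (Nat.le_mul_of_pos_left _ (Nat.succ_pos _))
  | tensor =>
    have h := (MvPolynomial.mem_restrictDegree _ _ _).1 hp
    rw [MvPolynomial.totalDegree]
    refine Finset.sup_le fun d hd => ?_
    rw [Finsupp.sum_fintype _ _ (fun _ => rfl)]
    refine (Finset.sum_le_sum fun j _ => h d hd j).trans ?_
    simp only [Finset.sum_const, Finset.card_univ, Fintype.card_fin, smul_eq_mul]
    nlinarith

/-! ### Boxes -/

section Boxes

variable {n : ℕ}

/-- The open box with lower corner `l` and upper corner `u`. -/
def openBox (l u : Fin n → ℝ) : Set (EuclideanSpace ℝ (Fin n)) :=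
  {x | ∀ j, l j < x j ∧ x j < u j}

theorem isOpen_openBox (l u : Fin n → ℝ) : IsOpen (openBox l u) := by
  simp only [openBox, ofPred_forall]
  refine isOpen_iInter_of_finite fun j => ?_
  have : Continuous fun x : EuclideanSpace ℝ (Fin n) => x j := by fun_prop
  exact (isOpen_lt continuous_const this).inter (isOpen_lt this continuous_const)

theorem convex_openBox (l u : Fin n → ℝ) : Convex ℝ (openBox l u) := by
  intro x hx y hy a b ha hb hab j
  have := convex_Ioo (l j) (u j) (hx j) (hy j) ha hb hab
  simpa using this

theorem volume_openBox (l u : Fin n → ℝ) :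
    volume (openBox l u) = ∏ j, ENNReal.ofReal (u j - l j) := by
  rw [← Real.volume_pi_Ioo, ← (EuclideanSpace.volume_preserving_symm_measurableEquiv_toLp
    (Fin n)).measure_preimage_equiv]
  congr 1
  ext x
  simp [openBox]

theorem isBounded_openBox (l u : Fin n → ℝ) : Bornology.IsBounded (openBox l u) := by
  rw [isBounded_iff_forall_norm_le]
  refine ⟨∑ j, (|l j| + |u j|), fun x hx => ?_⟩
  have h1 : x = ∑ j, x j • EuclideanSpace.single j (1 : ℝ) := by
    have := (EuclideanSpace.basisFun (Fin n) ℝ).sum_repr x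
    simpa using this.symm
  rw [h1]
  refine (norm_sum_le _ _).trans (Finset.sum_le_sum fun j _ => ?_)
  rw [norm_smul]
  simp only [Real.norm_eq_abs, PiLp.norm_single, Real.norm_eq_abs, abs_one, mul_one]
  rw [abs_le]
  have := hx j
  constructor
  · linarith [neg_abs_le (l j), abs_nonneg (u j)]
  · linarith [le_abs_self (u j), abs_nonneg (l j)]

end Boxes

/-! ### The two subdomains and the interface -/

section Domains

variable {m : ℕ}

theorem cube_eq_openBox (m : ℕ) : cube m = openBox (fun _ => 0) (fun _ => 1) := rfl

theorem Om_eq_openBox (m : ℕ) (i : Fin 2) :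
    Om m i = openBox (Fin.snoc (α := fun _ => ℝ) (fun _ => 0) (if i = 0 then 0 else -1))
      (Fin.snoc (α := fun _ => ℝ) (fun _ => 1) (if i = 0 then 1 else 0)) := by
  ext x
  simp only [Om, openBox, mem_ofPred_eq, Fin.forall_fin_succ', Fin.snoc_castSucc, Fin.snoc_last]
  split_ifs <;> rfl

theorem isOpen_Om (i : Fin 2) : IsOpen (Om m i) := by
  rw [Om_eq_openBox]; exact isOpen_openBox _ _

theorem convex_Om (i : Fin 2) : Convex ℝ (Om m i) := by
  rw [Om_eq_openBox]; exact convex_openBox _ _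

theorem isBounded_Om (i : Fin 2) : Bornology.IsBounded (Om m i) := by
  rw [Om_eq_openBox]; exact isBounded_openBox _ _

theorem isOpen_cube : IsOpen (cube m) := by
  rw [cube_eq_openBox]; exact isOpen_openBox _ _

theorem isBounded_cube : Bornology.IsBounded (cube m) := by
  rw [cube_eq_openBox]; exact isBounded_openBox _ _

theorem volume_cube : volume (cube m) = 1 := by
  rw [cube_eq_openBox, volume_openBox]; simp

instance isFiniteMeasure_restrict_Om (i : Fin 2) : IsFiniteMeasure (volume.restrict (Om m i)) :=
  isFiniteMeasure_restrict.2 (isBounded_Om i).measure_lt_top.ne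

instance isFiniteMeasure_restrict_cube : IsFiniteMeasure (volume.restrict (cube m)) :=
  isFiniteMeasure_restrict.2 isBounded_cube.measure_lt_top.ne

theorem isCompact_closure_Om (i : Fin 2) : IsCompact (closure (Om m i)) :=
  (isBounded_Om i).isCompact_closure

theorem isCompact_closure_cube : IsCompact (closure (cube m)) :=
  isBounded_cube.isCompact_closure

theorem emb_castSucc (y : IPt m) (j : Fin m) : emb y j.castSucc = y j := by
  simp [emb]

theorem emb_last (y : IPt m) : emb y (Fin.last m) = 0 := by
  simp [emb]

theorem isLinearMap_emb : IsLinearMap ℝ (emb : IPt m → Pt m) := by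
  constructor
  · intro x y
    ext j
    refine Fin.lastCases ?_ (fun j => ?_) j
    · simp [emb_last]
    · simp [emb_castSucc]
  · intro c x
    ext j
    refine Fin.lastCases ?_ (fun j => ?_) j
    · simp [emb_last]
    · simp [emb_castSucc]

theorem norm_emb (y : IPt m) : ‖emb y‖ = ‖y‖ := by
  rw [EuclideanSpace.norm_eq, EuclideanSpace.norm_eq, Fin.sum_univ_castSucc]
  simp [emb_castSucc, emb_last]

theorem dist_emb (y z : IPt m) : dist (emb y) (emb z) = dist y z := by
  rw [dist_eq_norm, dist_eq_norm, ← norm_emb (y - z)]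
  congr 1
  exact (isLinearMap_emb.mk' _).map_sub y z |>.symm

theorem continuous_emb : Continuous (emb : IPt m → Pt m) :=
  (Isometry.of_dist_eq dist_emb).continuous

theorem nonempty_Om (i : Fin 2) : (Om m i).Nonempty := by
  refine ⟨WithLp.toLp 2 (Fin.snoc (α := fun _ => ℝ) (fun _ => 1 / 2)
    (if i = 0 then 1 / 2 else -1 / 2)), ?_⟩
  rw [Om_eq_openBox]
  intro j
  refine Fin.lastCases ?_ (fun j => ?_) j
  · simp only [Fin.snoc_last]
    split_ifs <;> norm_num
  · simp only [Fin.snoc_castSucc]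
    norm_num

theorem interior_closure_Om (i : Fin 2) : interior (closure (Om m i)) = Om m i := by
  rw [(convex_Om i).interior_closure_eq_interior_of_nonempty_interior]
  · exact (isOpen_Om i).interior_eq
  · rw [(isOpen_Om i).interior_eq]; exact nonempty_Om i

theorem emb_mem_closure_Om (i : Fin 2) {y : IPt m} (hy : y ∈ cube m) :
    emb y ∈ closure (Om m i) := by
  -- The sign of the direction pointing from the interface into the subdomain.
  set c : ℝ := if i = 0 then 1 else -1 with hc
  have hlim : Filter.Tendsto (fun t : ℝ => emb y + t • EuclideanSpace.single (Fin.last m) c)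
      (nhdsWithin 0 (Ioi 0)) (nhds (emb y)) := by
    have : Continuous fun t : ℝ => emb y + t • EuclideanSpace.single (Fin.last m) c := by fun_prop
    have h := this.tendsto 0
    simp only [zero_smul, add_zero] at h
    exact h.mono_left nhdsWithin_le_nhds
  refine mem_closure_of_tendsto hlim ?_
  filter_upwards [Ioo_mem_nhdsGT (zero_lt_one' ℝ)] with t ht
  refine ⟨fun j => ?_, ?_⟩
  · have := hy j
    simpa [emb_castSucc] using this
  · have h1 := ht.1
    have h2 := ht.2
    simp only [PiLp.add_apply, emb_last, PiLp.smul_apply, PiLp.single_apply, if_true,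
      smul_eq_mul, zero_add, hc]
    split_ifs <;> constructor <;> linarith

end Domains

/-! ### Regular meshes -/

theorem isCompact_and_convex_of_isElement {m : ℕ} {kd : Kind} {E : Set (Pt m)}
    (hE : IsElement kd E) : IsCompact E ∧ Convex ℝ E := by
  cases kd with
  | simplex =>
    obtain ⟨p, _, rfl⟩ := hE
    exact ⟨(finite_range p).isCompact_convexHull ℝ, convex_convexHull ℝ _⟩
  | tensor =>
    rcases hE with ⟨_, p, _, rfl⟩ | ⟨_, a, e, _, rfl⟩
    · exact ⟨(finite_range p).isCompact_convexHull ℝ, convex_convexHull ℝ _⟩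
    · refine ⟨?_, (convex_parallelepiped e).translate a⟩
      refine IsCompact.image ?_ (by fun_prop)
      exact isCompact_Icc.image (by fun_prop)

/-- A functional exposing a face through an interior point has a local maximum there, hence is zero,
and the face is the whole set. So elements of a conforming mesh that share an interior point
coincide. -/
theorem eq_of_interiors_meet {F : Type*} [NormedAddCommGroup F] [NormedSpace ℝ F] {E E' : Set F}
    (h : IsExposed ℝ E (E ∩ E')) (h' : IsExposed ℝ E' (E ∩ E')) {z : F} (hz : z ∈ interior E)
    (hz' : z ∈ interior E') : E = E' := by
  have key : ∀ {S : Set F}, IsExposed ℝ S (E ∩ E') → z ∈ interior S → E ∩ E' = S := by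
    intro S hS hzS
    have hzE : z ∈ E ∩ E' := ⟨interior_subset hz, interior_subset hz'⟩
    obtain ⟨l, hl⟩ := hS ⟨z, hzE⟩
    have hmax : IsLocalMax l z := by
      have h1 : z ∈ {x ∈ S | ∀ y ∈ S, l y ≤ l x} := hl ▸ hzE
      filter_upwards [mem_interior_iff_mem_nhds.1 hzS] with y hy
      exact h1.2 y hy
    have hl0 : l = 0 := hmax.hasFDerivAt_eq_zero l.hasFDerivAt
    rw [hl]
    ext x
    simp [hl0]
  exact (key h hz).symm.trans (key h' hz')

/-- The geometric facts on a regular mesh that the estimates use: convex closed elements, each of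
them between two balls around its centre `x E`, where the inner balls do not overlap. -/
structure MeshBalls {m : ℕ} (i : Fin 2) (T : Finset (Set (Pt m))) (σ h : ℝ)
    (x : Set (Pt m) → Pt m) : Prop where
  h_pos : 0 < h
  convex : ∀ E ∈ T, Convex ℝ E
  compact : ∀ E ∈ T, IsCompact E
  cover : (⋃ E ∈ T, E) = closure (Om m i)
  ball_subset : ∀ E ∈ T, Metric.ball (x E) (σ * h) ⊆ E
  dist_le : ∀ E ∈ T, ∀ p ∈ E, ∀ q ∈ E, dist p q ≤ h
  disjoint : (T : Set (Set (Pt m))).Pairwise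
    (Function.onFun Disjoint fun E => Metric.ball (x E) (σ * h))

theorem diam_le_meshSize {m : ℕ} {T : Finset (Set (Pt m))} {E : Set (Pt m)} (hE : E ∈ T) :
    Metric.diam E ≤ meshSize T :=
  le_csSup (T.finite_toSet.image _).bddAbove (mem_image_of_mem _ hE)

theorem exists_meshBalls {m : ℕ} {kd : Kind} {i : Fin 2} {T : Finset (Set (Pt m))} {σ : ℝ}
    (hT : IsMesh kd i T) (hr : IsRegularMesh σ T) :
    ∃ x, MeshBalls i T σ (meshSize T) x := by
  have hcompact : ∀ E ∈ T, IsCompact E := fun E hE =>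
    (isCompact_and_convex_of_isElement (hT.element E hE)).1
  have hdist : ∀ E ∈ T, ∀ p ∈ E, ∀ q ∈ E, dist p q ≤ meshSize T := fun E hE p hp q hq =>
    (Metric.dist_le_diam_of_mem (hcompact E hE).isBounded hp hq).trans (diam_le_meshSize hE)
  have hpos : 0 < meshSize T := by
    -- With mesh size zero every element has at most one point, and finitely many such elements
    -- cannot cover an open set.
    by_contra hcon
    have hsub : ∀ E ∈ T, E.Subsingleton := fun E hE p hp q hq =>
      dist_le_zero.1 ((hdist E hE p hp q hq).trans (not_lt.1 hcon))
    have hfin : (closure (Om m i)).Finite := by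
      rw [← hT.cover]
      exact T.finite_toSet.biUnion fun E hE => (hsub E hE).finite
    obtain ⟨z, hz⟩ := nonempty_Om (m := m) i
    exact infinite_of_mem_nhds z ((isOpen_Om i).mem_nhds hz) (hfin.subset subset_closure)
  choose! x hx using hr
  refine ⟨x, hpos, fun E hE => (isCompact_and_convex_of_isElement (hT.element E hE)).2, hcompact,
    hT.cover, fun E hE => Metric.ball_subset_closedBall.trans (hx E hE), hdist, ?_⟩
  intro E hE E' hE' hne
  rw [Function.onFun, Set.disjoint_left]
  intro z hz hz'
  obtain ⟨h1, h2⟩ := hT.conforming E hE E' hE' hne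
  refine hne (eq_of_interiors_meet h1 h2 (z := z) ?_ ?_)
  · exact interior_maximal (Metric.ball_subset_closedBall.trans (hx E hE)) Metric.isOpen_ball hz
  · exact interior_maximal (Metric.ball_subset_closedBall.trans (hx E' hE')) Metric.isOpen_ball hz'

theorem exists_meshSize_le (m : ℕ) : ∃ D : ℝ, 0 ≤ D ∧ ∀ (kd : Kind) (i : Fin 2)
    (T : Finset (Set (Pt m))), IsMesh kd i T → meshSize T ≤ D := by
  refine ⟨Metric.diam (closure (Om m 0)) + Metric.diam (closure (Om m 1)),
    add_nonneg Metric.diam_nonneg Metric.diam_nonneg, fun kd i T hT => ?_⟩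
  have hi : Metric.diam (closure (Om m i))
      ≤ Metric.diam (closure (Om m 0)) + Metric.diam (closure (Om m 1)) := by
    fin_cases i
    · exact le_add_of_nonneg_right Metric.diam_nonneg
    · exact le_add_of_nonneg_left Metric.diam_nonneg
  refine Real.sSup_le ?_ (add_nonneg Metric.diam_nonneg Metric.diam_nonneg)
  rintro _ ⟨E, hE, rfl⟩
  refine (Metric.diam_mono ?_ (isCompact_closure_Om i).isBounded).trans hi
  rw [← hT.cover]
  exact subset_biUnion_of_mem (u := fun E : Set (Pt m) => E) hE

namespace MeshBalls

variable {m : ℕ} {i : Fin 2} {T : Finset (Set (Pt m))} {σ h : ℝ} {x : Set (Pt m) → Pt m}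

theorem subset_closure_Om (H : MeshBalls i T σ h x) {E : Set (Pt m)} (hE : E ∈ T) :
    E ⊆ closure (Om m i) := by
  rw [← H.cover]
  exact subset_biUnion_of_mem (u := fun E : Set (Pt m) => E) hE

theorem exists_mem (H : MeshBalls i T σ h x) {p : Pt m} (hp : p ∈ closure (Om m i)) :
    ∃ E ∈ T, p ∈ E := by
  rw [← H.cover] at hp
  simpa using hp

theorem ball_subset_Om (H : MeshBalls i T σ h x) {E : Set (Pt m)} (hE : E ∈ T) :
    Metric.ball (x E) (σ * h) ⊆ Om m i := by
  rw [← interior_closure_Om]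
  exact interior_maximal ((H.ball_subset E hE).trans (H.subset_closure_Om hE)) Metric.isOpen_ball

theorem center_mem (H : MeshBalls i T σ h x) (hσ : 0 < σ) {E : Set (Pt m)} (hE : E ∈ T) :
    x E ∈ E :=
  H.ball_subset E hE (Metric.mem_ball_self (mul_pos hσ H.h_pos))

theorem subset_closedBall (H : MeshBalls i T σ h x) (hσ : 0 < σ) {E : Set (Pt m)} (hE : E ∈ T) :
    E ⊆ Metric.closedBall (x E) h :=
  fun p hp => H.dist_le E hE p hp _ (H.center_mem hσ hE)

theorem nonempty_interior (H : MeshBalls i T σ h x) (hσ : 0 < σ) {E : Set (Pt m)} (hE : E ∈ T) :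
    (interior E).Nonempty :=
  ⟨x E, interior_maximal (H.ball_subset E hE) Metric.isOpen_ball
    (Metric.mem_ball_self (mul_pos hσ H.h_pos))⟩

/-- Frontiers of convex sets are null sets, and there are finitely many elements. -/
theorem ae_mem_interior (H : MeshBalls i T σ h x) :
    ∀ᵐ p ∂volume.restrict (Om m i), ∃ E ∈ T, p ∈ interior E := by
  have hnull : ∀ᵐ p : Pt m, ∀ E ∈ T, p ∉ frontier E := by
    rw [Filter.eventually_all_finset]
    intro E hE
    exact measure_eq_zero_iff_ae_notMem.1 ((H.convex E hE).addHaar_frontier volume)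
  filter_upwards [ae_restrict_of_ae hnull, ae_restrict_mem (isOpen_Om i).measurableSet]
    with p hp hpO
  obtain ⟨E, hE, hpE⟩ := H.exists_mem (subset_closure hpO)
  refine ⟨E, hE, ?_⟩
  by_contra hcon
  exact hp E hE ⟨subset_closure hpE, hcon⟩

theorem convex_preimage_emb (H : MeshBalls i T σ h x) {E : Set (Pt m)} (hE : E ∈ T) :
    Convex ℝ (emb ⁻¹' E) :=
  (H.convex E hE).is_linear_preimage isLinearMap_emb

theorem isClosed_preimage_emb (H : MeshBalls i T σ h x) {E : Set (Pt m)} (hE : E ∈ T) :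
    IsClosed (emb ⁻¹' E) :=
  (H.compact E hE).isClosed.preimage continuous_emb

/-- The induced interface mesh covers the interface. -/
theorem exists_mem_traceMesh (H : MeshBalls i T σ h x) {y : IPt m} (hy : y ∈ cube m) :
    ∃ E ∈ T, (interior (emb ⁻¹' E)).Nonempty ∧ emb y ∈ E := by
  classical
  set 𝒢 := T.filter fun E => (interior (emb ⁻¹' E)).Nonempty with h𝒢
  set O := cube m \ ⋃ E ∈ 𝒢, emb ⁻¹' E with hO
  have hOo : IsOpen O := by
    refine isOpen_cube.sdiff ?_
    exact 𝒢.finite_toSet.isClosed_biUnion fun E hE =>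
      H.isClosed_preimage_emb (Finset.mem_filter.1 hE).1
  -- Uncovered points lie only in element traces with empty interior. These are closed and convex,
  -- hence null sets, and an open null set is empty.
  have hO0 : volume O = 0 := by
    have hsub : O ⊆ ⋃ E ∈ T.filter (fun E => ¬ (interior (emb ⁻¹' E)).Nonempty), emb ⁻¹' E := by
      intro z hz
      obtain ⟨E, hE, hzE⟩ := H.exists_mem (emb_mem_closure_Om i hz.1)
      have hn : ¬ (interior (emb ⁻¹' E)).Nonempty := fun hne =>
        hz.2 (mem_biUnion (Finset.mem_filter.2 ⟨hE, hne⟩) hzE)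
      exact mem_biUnion (Finset.mem_filter.2 ⟨hE, hn⟩) hzE
    refine measure_mono_null hsub ((measure_biUnion_null_iff (Finset.countable_toSet _)).2 ?_)
    intro E hE
    obtain ⟨hE, hn⟩ := Finset.mem_filter.1 hE
    refine measure_mono_null ?_ ((H.convex_preimage_emb hE).addHaar_frontier volume)
    rw [(H.isClosed_preimage_emb hE).frontier_eq, not_nonempty_iff_eq_empty.1 hn, sdiff_empty]
  have hOe := (hOo.measure_eq_zero_iff volume).1 hO0
  have hy' : y ∈ ⋃ E ∈ 𝒢, emb ⁻¹' E := by
    by_contra hcon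
    have : y ∈ O := ⟨hy, hcon⟩
    rw [hOe] at this
    exact this
  rw [mem_iUnion₂] at hy'
  obtain ⟨E, hE, hyE⟩ := hy'
  exact ⟨E, (Finset.mem_filter.1 hE).1, (Finset.mem_filter.1 hE).2, hyE⟩

end MeshBalls

/-! ### Finite element functions -/

theorem exists_polyFun_of_mem_feSpace {n : ℕ} {kd : Kind} {k : ℕ}
    {K B : Set (EuclideanSpace ℝ (Fin n))} {T : Set (Set (EuclideanSpace ℝ (Fin n)))}
    {v : EuclideanSpace ℝ (Fin n) → ℝ} (hv : v ∈ feSpace kd k K B T)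
    {E : Set (EuclideanSpace ℝ (Fin n))} (hE : E ∈ T) :
    ∃ p : MvPolynomial (Fin n) ℝ, p.totalDegree ≤ (n + 1) * k ∧ ∀ x ∈ E, v x = polyFun p x := by
  obtain ⟨p, hp, h⟩ := hv.2.2.2 E hE
  exact ⟨p, totalDegree_le_of_mem_localPoly hp, h⟩

/-- The hypothesis `h` makes the restrictions to the elements jointly injective, and each
restriction lies in the image of a space of polynomials of bounded degree. -/
theorem finiteDimensional_feSpace {n : ℕ} {kd : Kind} {k : ℕ}
    {K B : Set (EuclideanSpace ℝ (Fin n))} {T : Set (Set (EuclideanSpace ℝ (Fin n)))}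
    (hT : T.Finite)
    (h : ∀ v ∈ feSpace kd k K B T, (∀ E ∈ T, ∀ x ∈ E, v x = 0) → v = 0) :
    FiniteDimensional ℝ (feSpace kd k K B T) := by
  have : Finite T := hT
  let R : ∀ E : T, MvPolynomial.restrictTotalDegree (Fin n) ℝ ((n + 1) * k) →ₗ[ℝ] (E.1 → ℝ) :=
    fun E =>
    { toFun := fun p x => polyFun p.1 x.1
      map_add' := fun p q => by ext x; simp [polyFun_add]
      map_smul' := fun c p => by ext x; simp [polyFun_smul] }
  let S : feSpace kd k K B T →ₗ[ℝ] (∀ E : T, LinearMap.range (R E)) :=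
    LinearMap.pi fun E =>
      { toFun := fun v => ⟨fun x => v.1 x.1, by
          obtain ⟨p, hp, hpv⟩ := exists_polyFun_of_mem_feSpace v.2 E.2
          refine ⟨⟨p, (MvPolynomial.mem_restrictTotalDegree _ _ _).2 hp⟩, ?_⟩
          ext x
          exact (hpv x.1 x.2).symm⟩
        map_add' := fun v w => rfl
        map_smul' := fun c v => rfl }
  refine Module.Finite.of_injective S ?_
  rw [← LinearMap.ker_eq_bot, LinearMap.ker_eq_bot']
  intro v hv
  apply Subtype.ext
  refine h v.1 v.2 fun E hE x hx => ?_
  exact congrFun (congrArg Subtype.val (congrFun hv ⟨E, hE⟩)) ⟨x, hx⟩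

section Norms

variable {X : Type*} [MeasurableSpace X] {μ : Measure X}

/-- Summation of elementwise pointwise bounds. Elements may overlap on faces, so a sum of indicators
is used instead of a partition; no measurability of `F` is needed because it is nonnegative. -/
theorem integral_le_of_le_sum_indicator {ι : Type*} (T : Finset ι) [IsFiniteMeasure μ] {F : X → ℝ}
    (hF : 0 ≤ᵐ[μ] F) {A : ι → Set X} (hA : ∀ E ∈ T, MeasurableSet (A E)) {c : ι → ℝ}
    (hc : ∀ E ∈ T, 0 ≤ c E) {V : ℝ} (hV : ∀ E ∈ T, μ.real (A E) ≤ V)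
    (h : F ≤ᵐ[μ] fun x => ∑ E ∈ T, (A E).indicator (fun _ => c E) x) :
    ∫ x, F x ∂μ ≤ V * ∑ E ∈ T, c E := by
  have hint : ∀ E ∈ T, Integrable ((A E).indicator fun _ => c E) μ := fun E hE =>
    (integrable_const _).indicator (hA E hE)
  refine (integral_mono_of_nonneg hF (integrable_finsetSum _ hint) h).trans ?_
  rw [integral_finsetSum _ hint, Finset.mul_sum]
  refine Finset.sum_le_sum fun E hE => ?_
  rw [integral_indicator_const _ (hA E hE), smul_eq_mul]
  exact mul_le_mul_of_nonneg_right (hV E hE) (hc E hE)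

end Norms

theorem norm_gradient {m : ℕ} (v : Pt m → ℝ) (x : Pt m) : ‖gradient v x‖ = ‖fderiv ℝ v x‖ := by
  simp [gradient]

/-! ### Inverse and trace inequalities, comparison of mesh sizes -/

section USpace

variable {m : ℕ} {kd : Kind} {k : ℕ} {i : Fin 2} {T : Finset (Set (Pt m))} {v : Pt m → ℝ}

theorem memLp_top_of_mem_USpace (hv : v ∈ USpace kd k i T) :
    MemLp v ⊤ (volume.restrict (Om m i)) := by
  obtain ⟨C, hC⟩ := (isCompact_closure_Om i).exists_bound_of_continuousOn hv.1
  refine memLp_top_of_bound ((hv.1.mono subset_closure).aestronglyMeasurable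
    (isOpen_Om i).measurableSet) C ?_
  filter_upwards [ae_restrict_mem (isOpen_Om i).measurableSet] with x hx
  exact hC x (subset_closure hx)

theorem integrableOn_sq_of_mem_USpace (hv : v ∈ USpace kd k i T) :
    IntegrableOn (fun x => v x ^ 2) (Om m i) := by
  have h := ((memLp_top_of_mem_USpace hv).mul (memLp_top_of_mem_USpace hv) (r := ⊤)).integrable
    le_top
  simp only [sq]
  exact h

theorem memLp_top_tr (hv : v ∈ USpace kd k i T) :
    MemLp (tr v) ⊤ (volume.restrict (cube m)) := by
  obtain ⟨C, hC⟩ := (isCompact_closure_Om i).exists_bound_of_continuousOn hv.1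
  have hmaps : MapsTo emb (cube m) (closure (Om m i)) := fun y hy => emb_mem_closure_Om i hy
  refine memLp_top_of_bound ((hv.1.comp continuous_emb.continuousOn hmaps).aestronglyMeasurable
    isOpen_cube.measurableSet) C ?_
  filter_upwards [ae_restrict_mem isOpen_cube.measurableSet] with y hy
  exact hC _ (hmaps hy)

theorem memLp_top_of_mem_UGam {μ : IPt m → ℝ} (hμ : μ ∈ UGam kd k T) :
    MemLp μ ⊤ (volume.restrict (cube m)) := by
  obtain ⟨C, hC⟩ := isCompact_closure_cube.exists_bound_of_continuousOn hμ.1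
  refine memLp_top_of_bound ((hμ.1.mono subset_closure).aestronglyMeasurable
    isOpen_cube.measurableSet) C ?_
  filter_upwards [ae_restrict_mem isOpen_cube.measurableSet] with x hx
  exact hC x (subset_closure hx)

namespace MeshBalls

variable {σ h : ℝ} {x : Set (Pt m) → Pt m}

theorem finiteDimensional_USpace (H : MeshBalls i T σ h x) :
    FiniteDimensional ℝ (USpace kd k i T) := by
  refine finiteDimensional_feSpace T.finite_toSet fun v hv hz => ?_
  ext p
  by_cases hp : p ∈ closure (Om m i)
  · obtain ⟨E, hE, hpE⟩ := H.exists_mem hp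
    exact hz E hE p hpE
  · exact hv.2.1 p hp

theorem finite_traceMesh (T : Finset (Set (Pt m))) : (traceMesh T).Finite := by
  refine (T.finite_toSet.image fun E => emb ⁻¹' E).subset ?_
  rintro S ⟨_, E, hE, rfl⟩
  exact ⟨E, hE, rfl⟩

theorem eq_zero_of_eqOn_cube {μ : IPt m → ℝ} (hμ : μ ∈ UGam kd k T)
    (h : ∀ y ∈ cube m, μ y = 0) : μ = 0 := by
  have h1 : EqOn μ (fun _ => 0) (closure (cube m)) :=
    EqOn.of_subset_closure h hμ.1 continuousOn_const subset_closure le_rfl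
  ext y
  by_cases hy : y ∈ closure (cube m)
  · exact h1 hy
  · exact hμ.2.1 y hy

/-- The trace mesh is known to cover the open cube; continuity determines the function on the
closure and the extension by zero outside it. -/
theorem finiteDimensional_UGam (H : MeshBalls i T σ h x) :
    FiniteDimensional ℝ (UGam kd k T) := by
  refine finiteDimensional_feSpace (finite_traceMesh T) fun v hv hz =>
    eq_zero_of_eqOn_cube hv fun y hy => ?_
  obtain ⟨E, hE, hne, hyE⟩ := H.exists_mem_traceMesh hy
  exact hz _ ⟨hne, E, hE, rfl⟩ y hyE

theorem sum_setIntegral_ball_le (H : MeshBalls i T σ h x) (hv : v ∈ USpace kd k i T) :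
    ∑ E ∈ T, ∫ p in Metric.ball (x E) (σ * h), v p ^ 2 ≤ ∫ p in Om m i, v p ^ 2 := by
  have hint := integrableOn_sq_of_mem_USpace hv
  rw [← integral_biUnion_finset T (fun E _ => Metric.isOpen_ball.measurableSet) H.disjoint
    fun E hE => hint.mono_set (H.ball_subset_Om hE)]
  refine setIntegral_mono_set hint (Filter.Eventually.of_forall fun p => sq_nonneg _) ?_
  exact Filter.Eventually.of_forall (iUnion₂_subset fun E hE => H.ball_subset_Om hE)

/-- On the element the function is a polynomial, the element lies in the ball of radius `h` about `x
E`, and the inscribed ball of radius `σ * h` lies in the element; the local estimate on concentric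
balls applies. -/
theorem sq_le_of_mem {C : ℝ} {n K : ℕ} (hn : n = m + 1) (hK : K = (m + 1 + 1) * k)
    (hC : ∀ p : MvPolynomial (Fin (m + 1)) ℝ, p.totalDegree ≤ K →
      ∀ (x₀ : Pt m) (h : ℝ), 0 < h → ∀ x ∈ Metric.closedBall x₀ h,
        (polyFun p x) ^ 2 ≤ C * (h ^ n)⁻¹ * ∫ x in Metric.ball x₀ (σ * h), polyFun p x ^ 2 ∧
        ‖fderiv ℝ (polyFun p) x‖ ^ 2
          ≤ C * (h ^ n)⁻¹ * (h ^ 2)⁻¹ * ∫ x in Metric.ball x₀ (σ * h), polyFun p x ^ 2)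
    (H : MeshBalls i T σ h x) (hσ : 0 < σ) (hv : v ∈ USpace kd k i T) {E : Set (Pt m)}
    (hE : E ∈ T) {y : Pt m} (hy : y ∈ E) :
    v y ^ 2 ≤ C * (h ^ n)⁻¹ * ∫ p in Metric.ball (x E) (σ * h), v p ^ 2 ∧
    ‖gradient v y‖ ^ 2
      ≤ C * (h ^ n)⁻¹ * (h ^ 2)⁻¹ * ∫ p in Metric.ball (x E) (σ * h), v p ^ 2 := by
  subst hn hK
  obtain ⟨p, hp, hpv⟩ := exists_polyFun_of_mem_feSpace hv hE
  have hint : ∫ z in Metric.ball (x E) (σ * h), v z ^ 2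
      = ∫ z in Metric.ball (x E) (σ * h), polyFun p z ^ 2 :=
    setIntegral_congr_fun Metric.isOpen_ball.measurableSet fun z hz => by
      rw [hpv z (H.ball_subset E hE hz)]
  obtain ⟨h1, h2⟩ := hC p hp (x E) h H.h_pos y (H.subset_closedBall hσ hE hy)
  rw [hint]
  refine ⟨by rw [hpv y hy]; exact h1, ?_⟩
  rw [norm_gradient]
  by_cases hd : DifferentiableAt ℝ v y
  -- At points of the element's frontier too, a derivative of `v` must be that of the polynomial:
  -- convex sets with interior have unique derivatives.
  · have hpd : HasFDerivWithinAt (polyFun p) (fderiv ℝ (polyFun p) y) E y :=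
      (((contDiff_polyFun p).differentiable (by norm_num) y).hasFDerivAt).hasFDerivWithinAt
    have hvd : HasFDerivWithinAt v (fderiv ℝ (polyFun p) y) E y :=
      hpd.congr hpv (hpv y hy)
    have huniq := uniqueDiffWithinAt_convex (H.convex E hE) (H.nonempty_interior hσ hE)
      (subset_closure hy)
    rw [huniq.eq hd.hasFDerivAt.hasFDerivWithinAt hvd]
    exact h2
  -- Where `v` is not differentiable, on faces only, the gradient has the default value zero.
  · rw [fderiv_zero_of_not_differentiableAt hd, norm_zero]
    refine le_trans (by simp) h2

end MeshBalls

/-- The inverse inequality for gradients and the discrete trace inequality on regular meshes. -/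
theorem exists_inverse_inequalities (m k : ℕ) {σ : ℝ} (hσ : 0 < σ) :
    ∃ C : ℝ, 0 ≤ C ∧ ∀ (kd : Kind) (i : Fin 2) (T : Finset (Set (Pt m))) (h : ℝ)
      (x : Set (Pt m) → Pt m), MeshBalls i T σ h x → ∀ v ∈ USpace kd k i T,
        (∫ p in Om m i, ‖gradient v p‖ ^ 2 ≤ C * (h ^ 2)⁻¹ * ∫ p in Om m i, v p ^ 2) ∧
        (∫ y in cube m, tr v y ^ 2 ≤ C * h⁻¹ * ∫ p in Om m i, v p ^ 2) := by
  obtain ⟨C, hC0, hC⟩ := exists_polyFun_bound (m + 1) ((m + 1 + 1) * k) hσ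
  set ω₁ := (volume : Measure (Pt m)).real (Metric.ball 0 1) with hω₁
  set ω₀ := (volume : Measure (IPt m)).real (Metric.ball 0 1) with hω₀
  have hω₁0 : 0 ≤ ω₁ := measureReal_nonneg
  have hω₀0 : 0 ≤ ω₀ := measureReal_nonneg
  refine ⟨C * (ω₁ + ω₀), by positivity, fun kd i T h x H v hv => ?_⟩
  have hh := H.h_pos
  have hI : ∀ E ∈ T, 0 ≤ ∫ p in Metric.ball (x E) (σ * h), v p ^ 2 := fun E _ =>
    integral_nonneg fun p => sq_nonneg _
  have hsum := H.sum_setIntegral_ball_le hv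
  have hI0 : 0 ≤ ∫ p in Om m i, v p ^ 2 := integral_nonneg fun p => sq_nonneg _
  constructor
  -- The measure of an element, at most `h ^ (m + 1) * ω₁`, cancels the scaling of the local
  -- estimate and leaves `h⁻²`.
  · have key := integral_le_of_le_sum_indicator (μ := volume.restrict (Om m i)) T
      (F := fun p => ‖gradient v p‖ ^ 2) (Filter.Eventually.of_forall fun p => sq_nonneg _)
      (A := fun E => E) (fun E hE => (H.compact E hE).isClosed.measurableSet)
      (c := fun E => C * (h ^ (m + 1))⁻¹ * (h ^ 2)⁻¹ * ∫ p in Metric.ball (x E) (σ * h), v p ^ 2)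
      (fun E hE => mul_nonneg (by positivity) (hI E hE)) (V := h ^ (m + 1) * ω₁)
      (fun E hE => by
        refine (measureReal_mono (h₂ := ?_) (s₂ := Metric.closedBall (x E) h)
          (H.subset_closedBall hσ hE)).trans ?_
        · exact (measure_lt_top _ _).ne
        refine (ENNReal.toReal_mono Metric.isBounded_closedBall.measure_lt_top.ne
          (Measure.restrict_apply_le _ _)).trans ?_
        change (volume : Measure (Pt m)).real _ ≤ _
        rw [Measure.addHaar_real_closedBall _ _ hh.le, finrank_euclideanSpace_fin])
      (by
        filter_upwards [ae_restrict_mem (isOpen_Om i).measurableSet] with p hp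
        obtain ⟨E, hE, hpE⟩ := H.exists_mem (subset_closure hp)
        refine (MeshBalls.sq_le_of_mem rfl rfl hC H hσ hv hE hpE).2.trans ?_
        refine le_trans ?_ (Finset.single_le_sum (f := fun E : Set (Pt m) => E.indicator (fun _ =>
          C * (h ^ (m + 1))⁻¹ * (h ^ 2)⁻¹ * ∫ p in Metric.ball (x E) (σ * h), v p ^ 2) p)
          (fun E hE => indicator_nonneg (fun _ _ => mul_nonneg (by positivity) (hI E hE)) _) hE)
        simp only [indicator_of_mem hpE, le_refl])
    refine key.trans ?_
    rw [← Finset.mul_sum]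
    calc h ^ (m + 1) * ω₁ * (C * (h ^ (m + 1))⁻¹ * (h ^ 2)⁻¹
          * ∑ E ∈ T, ∫ p in Metric.ball (x E) (σ * h), v p ^ 2)
        = C * ω₁ * (h ^ 2)⁻¹ * ∑ E ∈ T, ∫ p in Metric.ball (x E) (σ * h), v p ^ 2 := by
          field_simp
      _ ≤ C * (ω₁ + ω₀) * (h ^ 2)⁻¹ * ∫ p in Om m i, v p ^ 2 := by
          gcongr
          linarith
  -- The trace of an element has measure at most `h ^ m * ω₀`, one power of `h` short of the local
  -- scaling, which leaves `h⁻¹`.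
  · have key := integral_le_of_le_sum_indicator (μ := volume.restrict (cube m)) T
      (F := fun y => tr v y ^ 2) (Filter.Eventually.of_forall fun p => sq_nonneg _)
      (A := fun E => emb ⁻¹' E) (fun E hE => (H.isClosed_preimage_emb hE).measurableSet)
      (c := fun E => C * (h ^ (m + 1))⁻¹ * ∫ p in Metric.ball (x E) (σ * h), v p ^ 2)
      (fun E hE => mul_nonneg (by positivity) (hI E hE)) (V := h ^ m * ω₀)
      (fun E hE => by
        rcases (emb ⁻¹' E).eq_empty_or_nonempty with he | ⟨z, hz⟩
        · rw [he, measureReal_empty]; positivity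
        refine (measureReal_mono (h₂ := ?_) (s₂ := Metric.closedBall z h) ?_).trans ?_
        · intro y hy
          rw [Metric.mem_closedBall, ← dist_emb]
          exact H.dist_le E hE _ hy _ hz
        · exact (measure_lt_top _ _).ne
        refine (ENNReal.toReal_mono Metric.isBounded_closedBall.measure_lt_top.ne
          (Measure.restrict_apply_le _ _)).trans ?_
        change (volume : Measure (IPt m)).real _ ≤ _
        rw [Measure.addHaar_real_closedBall _ _ hh.le, finrank_euclideanSpace_fin])
      (by
        filter_upwards [ae_restrict_mem isOpen_cube.measurableSet] with y hy
        obtain ⟨E, hE, hpE⟩ := H.exists_mem (emb_mem_closure_Om i hy)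
        refine (MeshBalls.sq_le_of_mem rfl rfl hC H hσ hv hE hpE).1.trans ?_
        refine le_trans ?_ (Finset.single_le_sum (f := fun E : Set (Pt m) =>
          (emb ⁻¹' E).indicator (fun _ =>
          C * (h ^ (m + 1))⁻¹ * ∫ p in Metric.ball (x E) (σ * h), v p ^ 2) y)
          (fun E hE => indicator_nonneg (fun _ _ => mul_nonneg (by positivity) (hI E hE)) _) hE)
        simp only [indicator_of_mem (show y ∈ emb ⁻¹' E from hpE), le_refl])
    refine key.trans ?_
    rw [← Finset.mul_sum]
    calc h ^ m * ω₀ * (C * (h ^ (m + 1))⁻¹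
          * ∑ E ∈ T, ∫ p in Metric.ball (x E) (σ * h), v p ^ 2)
        = C * ω₀ * h⁻¹ * ∑ E ∈ T, ∫ p in Metric.ball (x E) (σ * h), v p ^ 2 := by
          rw [pow_succ h m]; field_simp
      _ ≤ C * (ω₁ + ω₀) * h⁻¹ * ∫ p in Om m i, v p ^ 2 := by
          gcongr
          linarith

/-- The mesh parameters of two regular meshes with the same interface mesh are comparable. -/
theorem exists_meshSize_comparison {m : ℕ} (hm : m ≠ 0) {σ : ℝ} (hσ : 0 < σ) :
    ∃ C : ℝ, 0 < C ∧ ∀ (i i' : Fin 2) (T T' : Finset (Set (Pt m))) (h h' : ℝ)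
      (x x' : Set (Pt m) → Pt m), MeshBalls i T σ h x → MeshBalls i' T' σ h' x' →
      traceMesh T = traceMesh T' → h ≤ C * h' := by
  classical
  set ω₁ := (volume : Measure (Pt m)).real (Metric.ball 0 1) with hω₁
  set ω₀ := (volume : Measure (IPt m)).real (Metric.ball 0 1) with hω₀
  have hω₁0 : 0 < ω₁ := ENNReal.toReal_pos (Metric.measure_ball_pos _ _ one_pos).ne'
    Metric.isBounded_ball.measure_lt_top.ne
  have hω₀0 : 0 ≤ ω₀ := measureReal_nonneg
  -- The constant obtained by eliminating the number of interface elements: it is at least `1 / (h'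
  -- ^ m * ω₀)` by covering and at most `4 * h / ((σ * h) ^ (m + 1) * ω₁)` by packing.
  set c : ℝ := 4 * ω₀ / (σ ^ (m + 1) * ω₁) with hc
  have hc0 : 0 ≤ c := by positivity
  refine ⟨1 + c, by positivity, fun i i' T T' h h' x x' H H' htr => ?_⟩
  have hh := H.h_pos
  have hh' := H'.h_pos
  set 𝒢 := T.filter fun E => (interior (emb ⁻¹' E)).Nonempty with h𝒢
  -- each interface element has small measure
  have hsmall : ∀ E ∈ 𝒢, (volume : Measure (IPt m)).real (emb ⁻¹' E) ≤ h' ^ m * ω₀ := by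
    intro E hE
    obtain ⟨hE, hne⟩ := Finset.mem_filter.1 hE
    have hmem : emb ⁻¹' E ∈ traceMesh T' := by
      rw [← htr]; exact ⟨hne, E, hE, rfl⟩
    obtain ⟨_, E', hE', hEE'⟩ := hmem
    obtain ⟨z, hz⟩ := hne
    have hz : z ∈ emb ⁻¹' E := interior_subset hz
    rw [hEE'] at hz ⊢
    have hsub : emb ⁻¹' E' ⊆ Metric.closedBall z h' := by
      intro y hy
      rw [Metric.mem_closedBall, ← dist_emb]
      exact H'.dist_le E' hE' _ hy _ hz
    refine (measureReal_mono (h₂ := Metric.isBounded_closedBall.measure_lt_top.ne) hsub).trans ?_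
    rw [Measure.addHaar_real_closedBall _ _ hh'.le, finrank_euclideanSpace_fin]
  -- they cover the interface
  have hcov : 1 ≤ (𝒢.card : ℝ) * (h' ^ m * ω₀) := by
    have hbdd : ∀ E ∈ 𝒢, volume (emb ⁻¹' E) ≠ ⊤ := by
      intro E hE
      obtain ⟨hE, -⟩ := Finset.mem_filter.1 hE
      rcases (emb ⁻¹' E).eq_empty_or_nonempty with he | ⟨z, hz⟩
      · rw [he, measure_empty]; exact ENNReal.zero_ne_top
      have hsub : emb ⁻¹' E ⊆ Metric.closedBall z h := by
        intro y hy
        rw [Metric.mem_closedBall, ← dist_emb]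
        exact H.dist_le E hE _ hy _ hz
      exact (Metric.isBounded_closedBall.subset hsub).measure_lt_top.ne
    have h1 : (volume : Measure (IPt m)).real (cube m)
        ≤ (volume : Measure (IPt m)).real (⋃ E ∈ 𝒢, emb ⁻¹' E) := by
      refine measureReal_mono (fun y hy => ?_) (measure_biUnion_lt_top 𝒢.finite_toSet
        fun E hE => (hbdd E hE).lt_top).ne
      · obtain ⟨E, hE, hne, hyE⟩ := H.exists_mem_traceMesh hy
        exact mem_biUnion (Finset.mem_filter.2 ⟨hE, hne⟩) (show y ∈ emb ⁻¹' E from hyE)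
    rw [measureReal_def, volume_cube, ENNReal.toReal_one] at h1
    refine h1.trans ((measureReal_biUnion_finset_le _ _).trans
      ((Finset.sum_le_sum hsmall).trans (le_of_eq ?_)))
    simp
  -- their number is bounded because the inner balls lie in a thin strip
  have hcard : (𝒢.card : ℝ) * ((σ * h) ^ (m + 1) * ω₁) ≤ 4 * h := by
    -- Elements that touch the interface stay within distance `h` of it; the half-width `2 * h`
    -- makes the inequalities of the open strip strict.
    set S : Set (Pt m) := openBox (Fin.snoc (α := fun _ => ℝ) (fun _ => 0) (-(2 * h)))
      (Fin.snoc (α := fun _ => ℝ) (fun _ => 1) (2 * h)) with hS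
    have hSvol : (volume : Measure (Pt m)).real S = 4 * h := by
      rw [measureReal_def, hS, volume_openBox, Fin.prod_univ_castSucc]
      simp only [Fin.snoc_castSucc, Fin.snoc_last, sub_zero, ENNReal.ofReal_one,
        Finset.prod_const_one, one_mul]
      rw [ENNReal.toReal_ofReal (by linarith)]
      ring
    have hsub : (⋃ E ∈ 𝒢, Metric.ball (x E) (σ * h)) ⊆ S := by
      refine iUnion₂_subset fun E hE p hp => ?_
      obtain ⟨hE, z, hz⟩ := Finset.mem_filter.1 hE
      have hz : z ∈ emb ⁻¹' E := interior_subset hz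
      have hpO := H.ball_subset_Om hE hp
      have hd := H.dist_le E hE p (H.ball_subset E hE hp) _ hz
      have hlast : |p (Fin.last m)| ≤ h := by
        have := PiLp.norm_apply_le (p - emb z) (Fin.last m)
        rw [PiLp.sub_apply, emb_last, sub_zero, Real.norm_eq_abs, ← dist_eq_norm] at this
        exact this.trans hd
      rw [hS]
      intro j
      refine Fin.lastCases ?_ (fun j => ?_) j
      · simp only [Fin.snoc_last]
        obtain ⟨h1, h2⟩ := abs_le.1 hlast
        constructor <;> linarith
      · simp only [Fin.snoc_castSucc]
        exact hpO.1 j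
    have hballs : (volume : Measure (Pt m)).real (⋃ E ∈ 𝒢, Metric.ball (x E) (σ * h))
        = (𝒢.card : ℝ) * ((σ * h) ^ (m + 1) * ω₁) := by
      rw [measureReal_biUnion_finset]
      · have : ∀ E ∈ 𝒢, (volume : Measure (Pt m)).real (Metric.ball (x E) (σ * h))
            = (σ * h) ^ (m + 1) * ω₁ := fun E _ => by
          rw [measureReal_def, Measure.addHaar_ball_of_pos _ _ (by positivity), ENNReal.toReal_mul,
            ENNReal.toReal_ofReal (by positivity), finrank_euclideanSpace_fin]
          rfl
        rw [Finset.sum_congr rfl this]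
        simp
      · intro E hE E' hE' hne
        exact H.disjoint (Finset.mem_filter.1 hE).1 (Finset.mem_filter.1 hE').1 hne
      · exact fun E _ => Metric.isOpen_ball.measurableSet
    rw [← hballs, ← hSvol]
    exact measureReal_mono (h₂ := (isBounded_openBox _ _).measure_lt_top.ne) hsub
  have hpow : h ^ m ≤ c * h' ^ m := by
    have h1 : (𝒢.card : ℝ) ≤ 4 * h / ((σ * h) ^ (m + 1) * ω₁) := by
      rw [le_div_iff₀ (by positivity)]; exact hcard
    have h2 : 1 ≤ 4 * h / ((σ * h) ^ (m + 1) * ω₁) * (h' ^ m * ω₀) :=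
      hcov.trans (by gcongr)
    have h3 : 4 * h / ((σ * h) ^ (m + 1) * ω₁) * (h' ^ m * ω₀) = c * h' ^ m / h ^ m := by
      rw [hc, mul_pow, pow_succ h m]; field_simp
    rw [h3, le_div_iff₀ (by positivity), one_mul] at h2
    exact h2
  -- Since `m ≠ 0`, `c ≤ (1 + c) ^ m`, so the `m`-th root can be taken without real powers.
  have hfin : h ^ m ≤ ((1 + c) * h') ^ m := by
    rw [mul_pow]
    refine hpow.trans ?_
    gcongr
    calc c ≤ 1 + c := by linarith
      _ ≤ (1 + c) ^ m := le_self_pow₀ (by linarith) hm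
  exact (pow_le_pow_iff_left₀ hh.le (by positivity) hm).1 hfin

end USpace

/-! ### Bilinear forms given by integrals of bounded functions -/

section IntegralForms

variable {X : Type*} [MeasurableSpace X] {μ : Measure X}

theorem exists_ae_abs_le {f : X → ℝ} (hf : MemLp f ⊤ μ) : ∃ S : ℝ, 0 ≤ S ∧ ∀ᵐ x ∂μ, |f x| ≤ S := by
  refine ⟨(eLpNorm f ⊤ μ).toReal, ENNReal.toReal_nonneg, ?_⟩
  have h := ae_le_eLpNormEssSup (f := f) (μ := μ)
  filter_upwards [h] with x hx
  rw [← eLpNorm_exponent_top] at hx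
  have := ENNReal.toReal_mono hf.2.ne hx
  simpa using this

theorem memLp_top_mul {f g : X → ℝ} (hf : MemLp f ⊤ μ) (hg : MemLp g ⊤ μ) :
    MemLp (fun x => f x * g x) ⊤ μ :=
  hg.mul hf

/-- A map into the functions on `X` with bounded values that is linear up to null sets. -/
structure AELinear {V : Type*} [AddCommGroup V] [Module ℝ V] (μ : Measure X)
    (f : V → X → ℝ) : Prop where
  memLp : ∀ v, MemLp (f v) ⊤ μ
  add : ∀ v v', ∀ᵐ x ∂μ, f (v + v') x = f v x + f v' x
  smul : ∀ (c : ℝ) v, ∀ᵐ x ∂μ, f (c • v) x = c * f v x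

theorem AELinear.mul_left {V : Type*} [AddCommGroup V] [Module ℝ V] {f : V → X → ℝ}
    (hf : AELinear μ f) {a : X → ℝ} (ha : MemLp a ⊤ μ) : AELinear μ fun v x => a x * f v x where
  memLp v := memLp_top_mul ha (hf.memLp v)
  add v v' := by filter_upwards [hf.add v v'] with x hx; rw [hx, mul_add]
  smul c v := by filter_upwards [hf.smul c v] with x hx; rw [hx, mul_left_comm]

variable [IsFiniteMeasure μ]

theorem integrable_mul_of_memLp_top {f g : X → ℝ} (hf : MemLp f ⊤ μ) (hg : MemLp g ⊤ μ) :
    Integrable (fun x => f x * g x) μ :=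
  (hg.mul hf (r := ⊤)).integrable le_top

theorem abs_integral_mul_le {f g : X → ℝ} (hf : MemLp f ⊤ μ) (hg : MemLp g ⊤ μ) :
    |∫ x, f x * g x ∂μ| ≤ √(∫ x, f x ^ 2 ∂μ) * √(∫ x, g x ^ 2 ∂μ) := by
  have h2 : ENNReal.ofReal 2 = 2 := by simp
  have h := integral_mul_norm_le_Lp_mul_Lq (μ := μ) (f := f) (g := g) Real.HolderConjugate.two_two
    (by rw [h2]; exact hf.mono_exponent le_top) (by rw [h2]; exact hg.mono_exponent le_top)
  have h1 : |∫ x, f x * g x ∂μ| ≤ ∫ x, ‖f x‖ * ‖g x‖ ∂μ := by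
    refine (norm_integral_le_integral_norm (μ := μ) fun x => f x * g x).trans (le_of_eq ?_)
    simp_rw [norm_mul]
  refine h1.trans (h.trans (le_of_eq ?_))
  simp [Real.sqrt_eq_rpow]

/-- The form `(v, w) ↦ ∫ f(v) g(w)`. -/
noncomputable def intForm {V W : Type*} [AddCommGroup V] [Module ℝ V] [AddCommGroup W] [Module ℝ W]
    (μ : Measure X) [IsFiniteMeasure μ] {f : V → X → ℝ} {g : W → X → ℝ}
    (hf : AELinear μ f) (hg : AELinear μ g) : V →ₗ[ℝ] W →ₗ[ℝ] ℝ :=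
  LinearMap.mk₂ ℝ (fun v w => ∫ x, f v x * g w x ∂μ)
    (fun v v' w => by
      rw [← integral_add (integrable_mul_of_memLp_top (hf.memLp v) (hg.memLp w))
        (integrable_mul_of_memLp_top (hf.memLp v') (hg.memLp w))]
      refine integral_congr_ae ?_
      filter_upwards [hf.add v v'] with x hx
      rw [hx, add_mul])
    (fun c v w => by
      rw [smul_eq_mul, ← integral_const_mul]
      refine integral_congr_ae ?_
      filter_upwards [hf.smul c v] with x hx
      rw [hx, mul_assoc])
    (fun v w w' => by
      rw [← integral_add (integrable_mul_of_memLp_top (hf.memLp v) (hg.memLp w))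
        (integrable_mul_of_memLp_top (hf.memLp v) (hg.memLp w'))]
      refine integral_congr_ae ?_
      filter_upwards [hg.add w w'] with x hx
      rw [hx, mul_add])
    (fun c v w => by
      rw [smul_eq_mul, ← integral_const_mul]
      refine integral_congr_ae ?_
      filter_upwards [hg.smul c w] with x hx
      rw [hx, mul_left_comm])

theorem intForm_apply {V W : Type*} [AddCommGroup V] [Module ℝ V] [AddCommGroup W] [Module ℝ W]
    {f : V → X → ℝ} {g : W → X → ℝ} (hf : AELinear μ f) (hg : AELinear μ g) (v : V) (w : W) :
    intForm μ hf hg v w = ∫ x, f v x * g w x ∂μ := rfl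

end IntegralForms

/-! ### Gradients of finite element functions -/

section Gradients

variable {m : ℕ} {kd : Kind} {k : ℕ} {i : Fin 2} {T : Finset (Set (Pt m))} {v w : Pt m → ℝ}
  {σ h : ℝ} {x : Set (Pt m) → Pt m}

namespace MeshBalls

theorem ae_differentiableAt (H : MeshBalls i T σ h x) (hv : v ∈ USpace kd k i T) :
    ∀ᵐ p ∂volume.restrict (Om m i), DifferentiableAt ℝ v p := by
  filter_upwards [H.ae_mem_interior] with p hp
  obtain ⟨E, hE, hpE⟩ := hp
  obtain ⟨P, _, hP⟩ := exists_polyFun_of_mem_feSpace hv hE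
  refine ((contDiff_polyFun P).differentiable (by norm_num) p).congr_of_eventuallyEq ?_
  filter_upwards [mem_interior_iff_mem_nhds.1 hpE] with y hy
  exact hP y hy

/-- Only almost everywhere: on faces one gradient may take its default value zero while that of the
sum exists. This is why the integral forms are built from maps that are linear up to null sets. -/
theorem ae_gradient_add (H : MeshBalls i T σ h x) (hv : v ∈ USpace kd k i T)
    (hw : w ∈ USpace kd k i T) :
    ∀ᵐ p ∂volume.restrict (Om m i), gradient (v + w) p = gradient v p + gradient w p := by
  filter_upwards [H.ae_differentiableAt hv, H.ae_differentiableAt hw] with p h1 h2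
  simp only [gradient]
  rw [fderiv_add h1 h2, map_add]

theorem ae_gradient_smul (H : MeshBalls i T σ h x) (c : ℝ) (hv : v ∈ USpace kd k i T) :
    ∀ᵐ p ∂volume.restrict (Om m i), gradient (c • v) p = c • gradient v p := by
  filter_upwards [H.ae_differentiableAt hv] with p h1
  simp only [gradient]
  rw [fderiv_const_smul h1, map_smulₛₗ]
  simp

theorem memLp_top_gradient (H : MeshBalls i T σ h x) (hσ : 0 < σ) (hv : v ∈ USpace kd k i T) :
    MemLp (fun p => gradient v p) ⊤ (volume.restrict (Om m i)) := by
  obtain ⟨C, hC0, hC⟩ := exists_polyFun_bound (m + 1) ((m + 1 + 1) * k) hσ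
  have hh := H.h_pos
  have hmeas : Measurable fun p => gradient v p := by
    unfold gradient
    exact (LinearIsometryEquiv.continuous _).measurable.comp (measurable_fderiv ℝ v)
  have hI : ∀ E ∈ T, 0 ≤ C * (h ^ (m + 1))⁻¹ * (h ^ 2)⁻¹
      * ∫ p in Metric.ball (x E) (σ * h), v p ^ 2 := fun E _ =>
    mul_nonneg (by positivity) (integral_nonneg fun p => sq_nonneg _)
  refine memLp_top_of_bound hmeas.aestronglyMeasurable (√(∑ E ∈ T, C * (h ^ (m + 1))⁻¹ * (h ^ 2)⁻¹
      * ∫ p in Metric.ball (x E) (σ * h), v p ^ 2)) ?_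
  filter_upwards [ae_restrict_mem (isOpen_Om i).measurableSet] with p hp
  obtain ⟨E, hE, hpE⟩ := H.exists_mem (subset_closure hp)
  refine Real.le_sqrt_of_sq_le (((sq_le_of_mem rfl rfl hC H hσ hv hE hpE).2).trans ?_)
  exact Finset.single_le_sum (f := fun E => C * (h ^ (m + 1))⁻¹ * (h ^ 2)⁻¹
      * ∫ p in Metric.ball (x E) (σ * h), v p ^ 2) hI hE

theorem memLp_top_gradient_apply (H : MeshBalls i T σ h x) (hσ : 0 < σ) (hv : v ∈ USpace kd k i T)
    (j : Fin (m + 1)) : MemLp (fun p => gradient v p j) ⊤ (volume.restrict (Om m i)) := by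
  refine (H.memLp_top_gradient hσ hv).mono ?_ (Filter.Eventually.of_forall fun p =>
    PiLp.norm_apply_le _ j)
  have hc : Continuous fun z : Pt m => z j := by fun_prop
  exact hc.comp_aestronglyMeasurable (H.memLp_top_gradient hσ hv).1

theorem integral_gradient_apply_sq_le (H : MeshBalls i T σ h x) (hσ : 0 < σ)
    (hv : v ∈ USpace kd k i T) (j : Fin (m + 1)) :
    ∫ p in Om m i, gradient v p j ^ 2 ≤ ∫ p in Om m i, ‖gradient v p‖ ^ 2 := by
  have hn := (H.memLp_top_gradient hσ hv).norm
  refine integral_mono_of_nonneg (Filter.Eventually.of_forall fun p => sq_nonneg _) ?_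
    (Filter.Eventually.of_forall fun p => ?_)
  · simpa only [sq] using integrable_mul_of_memLp_top hn hn
  · simp only
    rw [← sq_abs (gradient v p j)]
    refine pow_le_pow_left₀ (abs_nonneg _) ?_ 2
    exact PiLp.norm_apply_le (gradient v p) j

end MeshBalls

end Gradients

/-! ### The forms of the problem -/

section Forms

variable {m : ℕ} {kd : Kind} {k : ℕ}

theorem aeLinear_USpace {i : Fin 2} {T : Finset (Set (Pt m))} :
    AELinear (volume.restrict (Om m i)) fun (v : USpace kd k i T) p => v.1 p where
  memLp v := memLp_top_of_mem_USpace v.2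
  add _ _ := Filter.Eventually.of_forall fun _ => rfl
  smul _ _ := Filter.Eventually.of_forall fun _ => rfl

theorem aeLinear_tr {i : Fin 2} {T : Finset (Set (Pt m))} :
    AELinear (volume.restrict (cube m)) fun (v : USpace kd k i T) p => tr v.1 p where
  memLp v := memLp_top_tr v.2
  add _ _ := Filter.Eventually.of_forall fun _ => rfl
  smul _ _ := Filter.Eventually.of_forall fun _ => rfl

theorem aeLinear_UGam {T : Finset (Set (Pt m))} :
    AELinear (volume.restrict (cube m)) fun (v : UGam kd k T) p => v.1 p where
  memLp v := memLp_top_of_mem_UGam v.2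
  add _ _ := Filter.Eventually.of_forall fun _ => rfl
  smul _ _ := Filter.Eventually.of_forall fun _ => rfl

theorem aeLinear_gradient_apply {i : Fin 2} {T : Finset (Set (Pt m))} {σ h : ℝ}
    {x : Set (Pt m) → Pt m} (hσ : 0 < σ) (H : MeshBalls i T σ h x) (j : Fin (m + 1)) :
    AELinear (volume.restrict (Om m i)) fun (v : USpace kd k i T) p => gradient v.1 p j where
  memLp v := H.memLp_top_gradient_apply hσ v.2 j
  add v v' := by
    filter_upwards [H.ae_gradient_add v.2 v'.2] with p hp
    exact congrArg (fun z : Pt m => z j) hp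
  smul c v := by
    filter_upwards [H.ae_gradient_smul c v.2] with p hp
    exact congrArg (fun z : Pt m => z j) hp

/-- The advection–diffusion form on the finite element space, as a sum over coordinates. -/
noncomputable def advDiffForm (P : Model m) {i : Fin 2} {T : Finset (Set (Pt m))} {σ h : ℝ}
    {x : Set (Pt m) → Pt m} (hσ : 0 < σ) (H : MeshBalls i T σ h x) :
    USpace kd k i T →ₗ[ℝ] USpace kd k i T →ₗ[ℝ] ℝ :=
  ∑ j : Fin (m + 1),
    (P.ν i • intForm (volume.restrict (Om m i)) (aeLinear_gradient_apply hσ H j)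
        (aeLinear_gradient_apply hσ H j)
      + intForm (volume.restrict (Om m i))
        (aeLinear_USpace.mul_left ((P.s_mem i).memLp_deriv j j)) aeLinear_USpace
      + intForm (volume.restrict (Om m i))
        ((aeLinear_gradient_apply hσ H j).mul_left ((P.s_mem i).memLp j)) aeLinear_USpace)

theorem advDiffForm_apply (P : Model m) {i : Fin 2} {T : Finset (Set (Pt m))} {σ h : ℝ}
    {x : Set (Pt m) → Pt m} (hσ : 0 < σ) (H : MeshBalls i T σ h x) (v w : USpace kd k i T) :
    advDiffForm P hσ H v w = ∑ j : Fin (m + 1),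
      (P.ν i * (∫ p in Om m i, gradient v.1 p j * gradient w.1 p j)
        + (∫ p in Om m i, P.Ds i p j j * v.1 p * w.1 p)
        + ∫ p in Om m i, P.s i p j * gradient v.1 p j * w.1 p) := by
  simp only [advDiffForm, LinearMap.sum_apply, LinearMap.add_apply, LinearMap.smul_apply,
    intForm_apply, smul_eq_mul]

/-- Interchanging the sum over coordinates with the integral is legitimate because all factors are
essentially bounded on a bounded domain. -/
theorem advDiffForm_eq_LForm (P : Model m) {i : Fin 2} {T : Finset (Set (Pt m))} {σ h : ℝ}
    {x : Set (Pt m) → Pt m} (hσ : 0 < σ) (H : MeshBalls i T σ h x) (v w : USpace kd k i T) :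
    advDiffForm P hσ H v w = LForm P i v.1 w.1 := by
  have hg := fun (v : USpace kd k i T) j => H.memLp_top_gradient_apply hσ v.2 j
  have hv := fun v : USpace kd k i T => memLp_top_of_mem_USpace v.2
  have i1 := fun j => integrable_mul_of_memLp_top (hg v j) (hg w j)
  have i2 := fun j => integrable_mul_of_memLp_top
    (memLp_top_mul ((P.s_mem i).memLp_deriv j j) (hv v)) (hv w)
  have i3 := fun j => integrable_mul_of_memLp_top
    (memLp_top_mul ((P.s_mem i).memLp j) (hg v j)) (hv w)
  have i4 : ∀ j, Integrable (fun p => P.Ds i p j j * v.1 p * w.1 p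
      + P.s i p j * gradient v.1 p j * w.1 p) (volume.restrict (Om m i)) :=
    fun j => (i2 j).add (i3 j)
  rw [advDiffForm_apply, LForm, aForm, bForm]
  have e1 : ∫ p in Om m i, P.ν i * inner ℝ (gradient v.1 p) (gradient w.1 p)
      = ∑ j, P.ν i * ∫ p in Om m i, gradient v.1 p j * gradient w.1 p j := by
    rw [integral_const_mul, ← Finset.mul_sum, ← integral_finsetSum _ fun j _ => i1 j]
    congr 1
    refine integral_congr_ae (Filter.Eventually.of_forall fun p => ?_)
    simp only [PiLp.inner_apply, RCLike.inner_apply, conj_trivial]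
    exact Finset.sum_congr rfl fun j _ => mul_comm _ _
  have e2 : ∫ p in Om m i, ((∑ j, P.Ds i p j j) * v.1 p + inner ℝ (P.s i p) (gradient v.1 p)) * w.1 p
      = ∑ j, ((∫ p in Om m i, P.Ds i p j j * v.1 p * w.1 p)
        + ∫ p in Om m i, P.s i p j * gradient v.1 p j * w.1 p) := by
    rw [Finset.sum_congr rfl fun j _ => (integral_add (i2 j) (i3 j)).symm,
      ← integral_finsetSum _ fun j _ => i4 j]
    refine integral_congr_ae (Filter.Eventually.of_forall fun p => ?_)
    simp only [PiLp.inner_apply, RCLike.inner_apply, conj_trivial, Finset.sum_add_distrib,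
      add_mul, Finset.sum_mul]
    congr 1
    exact Finset.sum_congr rfl fun j _ => by ring
  rw [e1, e2, ← Finset.sum_add_distrib]
  exact Finset.sum_congr rfl fun j _ => add_assoc _ _ _

/-- Boundedness of the advection–diffusion form on finite element functions. -/
theorem exists_abs_LForm_le (P : Model m) (k : ℕ) {σ : ℝ} (hσ : 0 < σ) :
    ∃ C : ℝ, 0 ≤ C ∧ ∀ (kd : Kind) (i : Fin 2) (T : Finset (Set (Pt m))) (h : ℝ)
      (x : Set (Pt m) → Pt m), MeshBalls i T σ h x → ∀ v ∈ USpace kd k i T,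
      ∀ w ∈ USpace kd k i T,
        |LForm P i v w| ≤ C * ((h ^ 2)⁻¹ + h⁻¹ + 1) * √(∫ p in Om m i, v p ^ 2)
          * √(∫ p in Om m i, w p ^ 2) := by
  obtain ⟨C₀, hC₀, hinv⟩ := exists_inverse_inequalities m k hσ
  choose D hD0 hD using fun i j => exists_ae_abs_le ((P.s_mem i).memLp_deriv j j)
  choose S hS0 hS using fun i j => exists_ae_abs_le ((P.s_mem i).memLp j)
  -- Per coordinate: diffusion uses the inverse inequality twice and gives `h⁻²`, the divergence
  -- term uses none and gives `1`, advection uses it once and gives `h⁻¹`.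
  set c : Fin 2 → ℝ := fun i => ∑ j, (P.ν i * C₀ + D i j + S i j * √C₀) with hc
  have hc0 : ∀ i, 0 ≤ c i := fun i => Finset.sum_nonneg fun j _ => by
    have := (P.ν_pos i).le
    have := hD0 i j
    have := hS0 i j
    positivity
  refine ⟨∑ i, c i, Finset.sum_nonneg fun i _ => hc0 i, ?_⟩
  intro kd i T h x H v hv w hw
  have hh := H.h_pos
  have hhi : 0 ≤ h⁻¹ := by positivity
  set N : (Pt m → ℝ) → ℝ := fun v => √(∫ p in Om m i, v p ^ 2) with hN
  have hN0 : ∀ v, 0 ≤ N v := fun v => Real.sqrt_nonneg _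
  have hgrad : ∀ v ∈ USpace kd k i T, ∀ j, √(∫ p in Om m i, gradient v p j ^ 2)
      ≤ √C₀ * h⁻¹ * N v := by
    intro v hv j
    have h1 := (H.integral_gradient_apply_sq_le hσ hv j).trans (hinv kd i T h x H v hv).1
    refine (Real.sqrt_le_sqrt h1).trans (le_of_eq ?_)
    rw [Real.sqrt_mul (by positivity), Real.sqrt_mul hC₀, Real.sqrt_inv, Real.sqrt_sq hh.le]
  have hscale : ∀ (a u : Pt m → ℝ) (A : ℝ), 0 ≤ A →
      (∀ᵐ p ∂volume.restrict (Om m i), |a p| ≤ A) →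
      MemLp u ⊤ (volume.restrict (Om m i)) →
      √(∫ p in Om m i, (a p * u p) ^ 2) ≤ A * √(∫ p in Om m i, u p ^ 2) := by
    intro a u A hA ha hu
    have hu2 : Integrable (fun p => u p ^ 2) (volume.restrict (Om m i)) := by
      simpa only [sq] using integrable_mul_of_memLp_top hu hu
    rw [← Real.sqrt_sq hA, ← Real.sqrt_mul (sq_nonneg A), ← integral_const_mul]
    refine Real.sqrt_le_sqrt ?_
    refine integral_mono_of_nonneg (Filter.Eventually.of_forall fun p => sq_nonneg _)
      (hu2.const_mul _) ?_
    filter_upwards [ha] with p hp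
    rw [mul_pow, ← sq_abs (a p)]
    gcongr
  have hform := advDiffForm_eq_LForm P hσ H ⟨v, hv⟩ ⟨w, hw⟩
  rw [advDiffForm_apply] at hform
  rw [← hform]
  have hgm := fun {v} (hv : v ∈ USpace kd k i T) j => H.memLp_top_gradient_apply hσ hv j
  have hvm := fun {v} (hv : v ∈ USpace kd k i T) => memLp_top_of_mem_USpace hv
  have hterm : ∀ j : Fin (m + 1),
      |P.ν i * (∫ p in Om m i, gradient v p j * gradient w p j)
        + (∫ p in Om m i, P.Ds i p j j * v p * w p)
        + ∫ p in Om m i, P.s i p j * gradient v p j * w p|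
      ≤ (P.ν i * C₀ + D i j + S i j * √C₀) * (((h ^ 2)⁻¹ + h⁻¹ + 1) * N v * N w) := by
    intro j
    have t1 : |P.ν i * (∫ p in Om m i, gradient v p j * gradient w p j)|
        ≤ P.ν i * C₀ * ((h ^ 2)⁻¹ * N v * N w) := by
      rw [abs_mul, abs_of_pos (P.ν_pos i), mul_assoc]
      refine mul_le_mul_of_nonneg_left ?_ (P.ν_pos i).le
      refine (abs_integral_mul_le (hgm hv j) (hgm hw j)).trans ?_
      refine (mul_le_mul (hgrad v hv j) (hgrad w hw j) (Real.sqrt_nonneg _)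
        (by have := hN0 v; positivity)).trans (le_of_eq ?_)
      have : √C₀ * √C₀ = C₀ := Real.mul_self_sqrt hC₀
      calc √C₀ * h⁻¹ * N v * (√C₀ * h⁻¹ * N w)
          = (√C₀ * √C₀) * ((h ^ 2)⁻¹ * N v * N w) := by field_simp
        _ = _ := by rw [this]
    have t2 : |∫ p in Om m i, P.Ds i p j j * v p * w p| ≤ D i j * (1 * N v * N w) := by
      refine (abs_integral_mul_le (memLp_top_mul ((P.s_mem i).memLp_deriv j j) (hvm hv))
        (hvm hw)).trans ?_
      refine (mul_le_mul_of_nonneg_right (hscale _ v _ (hD0 i j) (hD i j) (hvm hv))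
        (Real.sqrt_nonneg _)).trans (le_of_eq ?_)
      simp only [hN]; ring
    have t3 : |∫ p in Om m i, P.s i p j * gradient v p j * w p|
        ≤ S i j * √C₀ * (h⁻¹ * N v * N w) := by
      refine (abs_integral_mul_le (memLp_top_mul ((P.s_mem i).memLp j) (hgm hv j))
        (hvm hw)).trans ?_
      refine (mul_le_mul_of_nonneg_right ((hscale _ _ _ (hS0 i j) (hS i j) (hgm hv j)).trans
        (mul_le_mul_of_nonneg_left (hgrad v hv j) (hS0 i j)))
        (Real.sqrt_nonneg _)).trans (le_of_eq ?_)
      simp only [hN]; ring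
    have hνC : 0 ≤ P.ν i * C₀ := mul_nonneg (P.ν_pos i).le hC₀
    have hSC : 0 ≤ S i j * √C₀ := mul_nonneg (hS0 i j) (Real.sqrt_nonneg _)
    have hNN : 0 ≤ N v * N w := mul_nonneg (hN0 v) (hN0 w)
    have hh2 : 0 ≤ (h ^ 2)⁻¹ := by positivity
    have mono : ∀ a, 0 ≤ a → a ≤ (h ^ 2)⁻¹ + h⁻¹ + 1 → ∀ e, 0 ≤ e →
        e * (a * N v * N w) ≤ e * (((h ^ 2)⁻¹ + h⁻¹ + 1) * N v * N w) := by
      intro a _ ha e he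
      rw [mul_assoc a, mul_assoc (_ + _ + _)]
      gcongr
    have m1 := mono _ hh2 (by linarith) _ hνC
    have m2 := mono _ zero_le_one (by linarith) _ (hD0 i j)
    have m3 := mono _ hhi (by linarith) _ hSC
    refine (abs_add_le _ _).trans ((add_le_add_left (abs_add_le _ _) _).trans ?_)
    rw [add_mul, add_mul]
    linarith
  refine (Finset.abs_sum_le_sum_abs _ _).trans ((Finset.sum_le_sum fun j _ => hterm j).trans ?_)
  rw [← Finset.sum_mul]
  have hsum : c i ≤ ∑ i, c i := Finset.single_le_sum (f := c) (fun i _ => hc0 i) (Finset.mem_univ i)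
  have hpos : 0 ≤ ((h ^ 2)⁻¹ + h⁻¹ + 1) * N v * N w := by
    have := hN0 v
    have := hN0 w
    positivity
  calc c i * (((h ^ 2)⁻¹ + h⁻¹ + 1) * N v * N w)
      ≤ (∑ i, c i) * (((h ^ 2)⁻¹ + h⁻¹ + 1) * N v * N w) := by gcongr
    _ = _ := by ring

/-- The forms of the semidiscrete problem. -/
noncomputable def feForms (P : Model m) (kd : Kind) (k : ℕ) {T : Fin 2 → Finset (Set (Pt m))}
    {σ : ℝ} {h : Fin 2 → ℝ} {x : Fin 2 → Set (Pt m) → Pt m} (hσ : 0 < σ)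
    (H : ∀ i, MeshBalls i (T i) σ (h i) (x i)) :
    Forms (fun i => USpace kd k i (T i)) (UGam kd k (T 0)) where
  ip i := intForm (volume.restrict (Om m i)) aeLinear_USpace aeLinear_USpace
  ipG := intForm (volume.restrict (cube m)) aeLinear_UGam aeLinear_UGam
  L i := advDiffForm P hσ (H i)
  c i := intForm (volume.restrict (cube m)) aeLinear_UGam aeLinear_tr
  ip_nonneg i v := integral_nonneg fun x => mul_self_nonneg _
  -- A zero `L²` norm forces a continuous function to vanish on the open domain, then on its
  -- closure; elsewhere it is zero by convention.
  ip_def i v hv := by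
    have hcont : ContinuousOn v.1 (Om m i) := v.2.1.mono subset_closure
    have hi := integrable_mul_of_memLp_top (memLp_top_of_mem_USpace v.2)
      (memLp_top_of_mem_USpace v.2)
    have h0 := (setIntegral_eq_zero_iff_of_nonneg_ae
      (Filter.Eventually.of_forall fun x => mul_self_nonneg _) hi).1 hv
    have h1 := Measure.eqOn_open_of_ae_eq h0 (isOpen_Om i) (hcont.mul hcont) continuousOn_const
    have h2 : EqOn v.1 (fun _ => 0) (closure (Om m i)) :=
      EqOn.of_subset_closure (fun y hy => mul_self_eq_zero.1 (h1 hy)) v.2.1 continuousOn_const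
        subset_closure le_rfl
    apply Subtype.ext
    ext y
    by_cases hy : y ∈ closure (Om m i)
    · exact h2 hy
    · exact v.2.2.1 y hy
  ipG_symm v w := by simp only [intForm_apply, mul_comm]
  ipG_nonneg v := integral_nonneg fun x => mul_self_nonneg _
  ipG_def v hv := by
    have hcont : ContinuousOn v.1 (cube m) := v.2.1.mono subset_closure
    have hi := integrable_mul_of_memLp_top (memLp_top_of_mem_UGam v.2)
      (memLp_top_of_mem_UGam v.2)
    have h0 := (setIntegral_eq_zero_iff_of_nonneg_ae
      (Filter.Eventually.of_forall fun x => mul_self_nonneg _) hi).1 hv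
    have h1 := Measure.eqOn_open_of_ae_eq h0 isOpen_cube (hcont.mul hcont) continuousOn_const
    exact Subtype.ext (MeshBalls.eq_zero_of_eqOn_cube v.2 fun y hy => mul_self_eq_zero.1 (h1 hy))

section FeForms

variable (P : Model m) (kd : Kind) (k : ℕ) {T : Fin 2 → Finset (Set (Pt m))}
  {σ : ℝ} {h : Fin 2 → ℝ} {x : Fin 2 → Set (Pt m) → Pt m} (hσ : 0 < σ)
  (H : ∀ i, MeshBalls i (T i) σ (h i) (x i))

theorem feForms_ip (i : Fin 2) (v w : USpace kd k i (T i)) :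
    (feForms P kd k hσ H).ip i v w = ip i v.1 w.1 := rfl

theorem feForms_ipG (v w : UGam kd k (T 0)) :
    (feForms P kd k hσ H).ipG v w = ipG v.1 w.1 := rfl

theorem feForms_L (i : Fin 2) (v w : USpace kd k i (T i)) :
    (feForms P kd k hσ H).L i v w = LForm P i v.1 w.1 :=
  advDiffForm_eq_LForm P hσ (H i) v w

theorem feForms_c (i : Fin 2) (μ : UGam kd k (T 0)) (v : USpace kd k i (T i)) :
    (feForms P kd k hσ H).c i μ v = ipG μ.1 (tr v.1) := rfl

theorem feForms_nm (i : Fin 2) (v : USpace kd k i (T i)) :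
    (feForms P kd k hσ H).nm i v = √(∫ p in Om m i, v.1 p ^ 2) := by
  rw [Forms.nm, feForms_ip, ip]; simp only [sq]

theorem feForms_abs_c_le {γ : ℝ} (i : Fin 2) (hγ : ∀ v ∈ USpace kd k i (T i),
      √(∫ y in cube m, tr v y ^ 2) ≤ γ * √(∫ p in Om m i, v p ^ 2))
    (μ : UGam kd k (T 0)) (v : USpace kd k i (T i)) :
    |(feForms P kd k hσ H).c i μ v|
      ≤ γ * (feForms P kd k hσ H).nmG μ * (feForms P kd k hσ H).nm i v := by
  have h1 := abs_integral_mul_le (memLp_top_of_mem_UGam μ.2) (memLp_top_tr v.2)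
  have h2 : (feForms P kd k hσ H).nmG μ = √(∫ y in cube m, μ.1 y ^ 2) := by
    rw [Forms.nmG, feForms_ipG, ipG]; simp only [sq]
  rw [feForms_nm, h2, feForms_c, ipG]
  refine h1.trans ((mul_le_mul_of_nonneg_left (hγ v.1 v.2) (Real.sqrt_nonneg _)).trans
    (le_of_eq (by ring)))

end FeForms

end Forms

/-! ### Time polynomials in function spaces -/

theorem mem_timePoly_iff {W : Type*} [AddCommGroup W] [Module ℝ W] {V : Submodule ℝ W} {q : ℕ}
    {v : ℝ → W} :
    v ∈ timePoly V q ↔ ∃ e : Fin (q + 1) → V, v = fun t => ((ev e t : V) : W) := by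
  constructor
  · rintro ⟨c, hc, hv⟩
    refine ⟨fun l => ⟨c l, hc l⟩, funext fun t => ?_⟩
    rw [hv, Finset.sum_range]
    simp [ev]
  · rintro ⟨e, rfl⟩
    refine ⟨fun l => if h : l < q + 1 then (e ⟨l, h⟩ : W) else 0, fun l => ?_, fun t => ?_⟩
    · by_cases h : l < q + 1
      · simp only [h, dite_true]
        exact (e _).2
      · simp only [h, dite_false]
        exact V.zero_mem
    · simp only [Finset.sum_range, ev, Submodule.coe_sum, Submodule.coe_smul, Fin.is_lt, dite_true]

theorem forall_timePoly_iff {W : Type*} [AddCommGroup W] [Module ℝ W] {V : Submodule ℝ W} {q : ℕ}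
    {p : (ℝ → W) → Prop} :
    (∀ v ∈ timePoly V q, p v) ↔ ∀ e : Fin (q + 1) → V, p fun t => ((ev e t : V) : W) := by
  constructor
  · exact fun h e => h _ (mem_timePoly_iff.2 ⟨e, rfl⟩)
  · intro h v hv
    obtain ⟨e, rfl⟩ := mem_timePoly_iff.1 hv
    exact h e

/-- An equation tested with all time polynomials has the form `∑ l, R l (e l) = 0` in the free
coefficients `e l`, so it splits into one equation for each monomial. -/
theorem forall_sum_dual_eq_zero_iff {V : Type*} [AddCommGroup V] [Module ℝ V] {N : ℕ}
    (R : Fin N → Module.Dual ℝ V) : (∀ e : Fin N → V, ∑ l, R l (e l) = 0) ↔ ∀ l, R l = 0 := by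
  constructor
  · intro h l
    ext v
    have := h (Pi.single l v)
    rw [Finset.sum_eq_single l] at this
    · simpa using this
    · intro j _ hj
      simp [Pi.single_eq_of_ne hj]
    · simp
  · intro h e
    simp [h]

theorem ev_eq_sum_eval {V : Type*} [AddCommGroup V] [Module ℝ V] {N : ℕ} (e : Fin N → V) (t : ℝ) :
    ev e t = ∑ l : Fin N, (Polynomial.X ^ (l : ℕ) : Polynomial ℝ).eval t • e l := by
  simp [ev]

theorem continuous_form_ev {V W : Type*} [AddCommGroup V] [Module ℝ V] [AddCommGroup W]
    [Module ℝ W] {N N' : ℕ} (B : V →ₗ[ℝ] W →ₗ[ℝ] ℝ) (c : Fin N → V) (e : Fin N' → W) :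
    Continuous fun t => B (ev c t) (ev e t) := by
  have : ∀ t, B (ev c t) (ev e t) = ∑ l : Fin N', t ^ (l : ℕ) * B (ev c t) (e l) :=
    fun t => map_ev _ _ _
  simp_rw [this]
  exact continuous_finsetSum _ fun l _ => (continuous_pow _).mul (continuous_map_ev (B.flip (e l)) c)

theorem integral_form_sum {V W : Type*} [AddCommGroup V] [Module ℝ V] [AddCommGroup W] [Module ℝ W]
    {N N' : ℕ} (B : V →ₗ[ℝ] W →ₗ[ℝ] ℝ) (c : Fin N → V) (P : Fin N' → Polynomial ℝ) (e : Fin N' → W)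
    (a b : ℝ) :
    ∫ t in a..b, B (ev c t) (∑ l, (P l).eval t • e l) = ∑ l, B (mom a b (P l) c) (e l) := by
  simp_rw [map_sum, map_smul, map_mom_apply, smul_eq_mul]
  refine intervalIntegral.integral_finsetSum fun l _ => ?_
  apply Continuous.intervalIntegrable
  exact (Polynomial.continuous _).mul (continuous_map_ev (B.flip (e l)) c)

theorem integral_form_ev {V W : Type*} [AddCommGroup V] [Module ℝ V] [AddCommGroup W] [Module ℝ W]
    {N N' : ℕ} (B : V →ₗ[ℝ] W →ₗ[ℝ] ℝ) (c : Fin N → V) (e : Fin N' → W) (a b : ℝ) :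
    ∫ t in a..b, B (ev c t) (ev e t)
      = ∑ l : Fin N', B (mom a b (Polynomial.X ^ (l : ℕ)) c) (e l) := by
  simp_rw [ev_eq_sum_eval e]
  exact integral_form_sum B c _ e a b

theorem deriv_coe_ev {X : Type*} {V : Submodule ℝ (X → ℝ)} {N : ℕ} (e : Fin N → V) (t : ℝ) :
    (fun x => deriv (fun t' => (ev e t' : V).1 x) t)
      = (∑ l : Fin N, (Polynomial.derivative (Polynomial.X ^ (l : ℕ) : Polynomial ℝ)).eval t • e l :
          V).1 := by
  ext x
  have h1 : (fun t' => (ev e t' : V).1 x)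
      = fun t' => ∑ l : Fin N, (Polynomial.X ^ (l : ℕ) : Polynomial ℝ).eval t' * (e l).1 x := by
    ext t'
    simp [ev, Finset.sum_apply]
  rw [h1]
  have h2 : HasDerivAt
      (fun t' => ∑ l : Fin N, (Polynomial.X ^ (l : ℕ) : Polynomial ℝ).eval t' * (e l).1 x)
      (∑ l : Fin N, (Polynomial.derivative (Polynomial.X ^ (l : ℕ) : Polynomial ℝ)).eval t
        * (e l).1 x) t :=
    HasDerivAt.fun_sum fun l _ => (Polynomial.hasDerivAt _ t).mul_const _
  rw [h2.deriv]
  simp [Finset.sum_apply]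

theorem coe_lagged {W : Type*} [AddCommGroup W] [Module ℝ W] {V : Submodule ℝ W} {Mi : ℕ}
    (hist : ℕ → V) (U : Fin Mi → V) (n : Fin Mi) (l : ℕ) :
    ((lagged hist U n l : V) : W) = lagged (fun j => (hist j : W)) (fun n => (U n : W)) n l := by
  unfold lagged; split_ifs <;> rfl

/-- Separates the part that is linear in the unknowns from the contribution of the earlier windows,
which becomes data. -/
theorem lagged_eq_add {W : Type*} [AddCommGroup W] {Mi : ℕ} (hist : ℕ → W) (U : Fin Mi → W)
    (n : Fin Mi) (l : ℕ) :
    lagged hist U n l = lagged (fun _ => 0) U n l + lagged hist (fun _ => 0) n l := by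
  unfold lagged; split_ifs <;> simp

/-! ### Forcing functionals -/

section Forcing

variable {X : Type*} [MeasurableSpace X] {μ : Measure X} [IsFiniteMeasure μ] {f : X → ℝ → ℝ}
  {tf : ℝ}

theorem integrable_integral_mul
    (hf : Integrable (fun p : X × ℝ => f p.1 p.2) (μ.prod (volume.restrict (Ioc 0 tf))))
    {u : X → ℝ} (hu : MemLp u ⊤ μ) :
    IntegrableOn (fun t => ∫ x, f x t * u x ∂μ) (Ioc 0 tf) := by
  obtain ⟨S, _, hS⟩ := exists_ae_abs_le hu
  have hu' : MemLp (fun p : X × ℝ => u p.1) ⊤ (μ.prod (volume.restrict (Ioc 0 tf))) :=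
    memLp_top_of_bound hu.1.comp_fst S (Measure.quasiMeasurePreserving_fst.ae hS)
  exact (hf.mul_of_top_left hu').integral_prod_right

/-- By Fubini, `f` is integrable in space for almost every time only, so the sum over time
coefficients leaves the spatial integral only for such times. -/
theorem ae_integral_mul_ev
    (hf : Integrable (fun p : X × ℝ => f p.1 p.2) (μ.prod (volume.restrict (Ioc 0 tf))))
    {V : Submodule ℝ (X → ℝ)} (hV : ∀ v ∈ V, MemLp v ⊤ μ) {N : ℕ} (e : Fin N → V) :
    ∀ᵐ t ∂volume.restrict (Ioc 0 tf), Integrable (fun x => f x t * (ev e t : V).1 x) μ ∧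
      ∫ x, f x t * (ev e t : V).1 x ∂μ = ∑ l : Fin N, t ^ (l : ℕ) * ∫ x, f x t * (e l).1 x ∂μ := by
  filter_upwards [hf.prod_left_ae] with t ht
  refine ⟨ht.mul_of_top_left (hV _ (ev e t).2), ?_⟩
  have hi : ∀ l, Integrable (fun x => f x t * (e l).1 x) μ := fun l =>
    ht.mul_of_top_left (hV _ (e l).2)
  simp_rw [← integral_const_mul]
  rw [← integral_finsetSum _ fun l _ => (hi l).const_mul _]
  congr 1
  ext x
  simp only [ev, Submodule.coe_sum, Submodule.coe_smul, Finset.sum_apply, Pi.smul_apply,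
    smul_eq_mul, Finset.mul_sum]
  exact Finset.sum_congr rfl fun l _ => by ring

theorem intervalIntegrable_pow_mul_integral
    (hf : Integrable (fun p : X × ℝ => f p.1 p.2) (μ.prod (volume.restrict (Ioc 0 tf))))
    {u : X → ℝ} (hu : MemLp u ⊤ μ) (l : ℕ) {a b : ℝ} (ha : 0 ≤ a) (hab : a ≤ b) (hb : b ≤ tf) :
    IntervalIntegrable (fun t => t ^ l * ∫ x, f x t * u x ∂μ) volume a b := by
  have h1 : IntervalIntegrable (fun t => ∫ x, f x t * u x ∂μ) volume a b := by
    rw [intervalIntegrable_iff_integrableOn_Ioc_of_le hab]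
    exact (integrable_integral_mul hf hu).mono_set (Ioc_subset_Ioc ha hb)
  exact h1.continuousOn_mul (continuous_pow l).continuousOn

/-- The functional `v ↦ ∫_a^b t^l (f(t), v) dt`. -/
noncomputable def forceDual
    (hf : Integrable (fun p : X × ℝ => f p.1 p.2) (μ.prod (volume.restrict (Ioc 0 tf))))
    {V : Submodule ℝ (X → ℝ)} (hV : ∀ v ∈ V, MemLp v ⊤ μ) (l : ℕ) {a b : ℝ} (ha : 0 ≤ a)
    (hab : a ≤ b) (hb : b ≤ tf) : Module.Dual ℝ V where
  toFun v := ∫ t in a..b, t ^ l * ∫ x, f x t * v.1 x ∂μ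
  map_add' v v' := by
    rw [← intervalIntegral.integral_add
      (intervalIntegrable_pow_mul_integral hf (hV _ v.2) l ha hab hb)
      (intervalIntegrable_pow_mul_integral hf (hV _ v'.2) l ha hab hb)]
    -- Additivity of the spatial integral is available only at times where the forcing is integrable
    -- in space.
    refine intervalIntegral.integral_congr_ae ?_
    have h := (ae_restrict_iff' measurableSet_Ioc).1 hf.prod_left_ae
    filter_upwards [h] with t ht htI
    rw [uIoc_of_le hab] at htI
    have ht := ht (Ioc_subset_Ioc ha hb htI)
    have i1 : Integrable (fun x => f x t * v.1 x) μ := ht.mul_of_top_left (hV _ v.2)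
    have i2 : Integrable (fun x => f x t * v'.1 x) μ := ht.mul_of_top_left (hV _ v'.2)
    rw [← mul_add, ← integral_add i1 i2]
    simp only [Submodule.coe_add, Pi.add_apply, mul_add]
  map_smul' r v := by
    rw [RingHom.id_apply, smul_eq_mul, ← intervalIntegral.integral_const_mul]
    congr 1
    ext t
    -- Scalars leave the integral at every time, integrable or not, so no exceptional set appears
    -- here.
    have h : ∫ x, f x t * (r • v).1 x ∂μ = r * ∫ x, f x t * v.1 x ∂μ := by
      rw [← integral_const_mul]
      simp only [Submodule.coe_smul, Pi.smul_apply, smul_eq_mul, mul_left_comm r]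
    rw [h, mul_left_comm]

/-- Splitting off the forcing from the integral of a polynomial expression. -/
theorem integral_sub_forcing
    (hf : Integrable (fun p : X × ℝ => f p.1 p.2) (μ.prod (volume.restrict (Ioc 0 tf))))
    {V : Submodule ℝ (X → ℝ)} (hV : ∀ v ∈ V, MemLp v ⊤ μ) {a b : ℝ} (ha : 0 ≤ a)
    (hab : a ≤ b) (hb : b ≤ tf) {N : ℕ} (e : Fin N → V) {p F : ℝ → ℝ} (hp : Continuous p)
    (hF : ∀ t, Integrable (fun x => f x t * (ev e t : V).1 x) μ →
      F t = p t - ∫ x, f x t * (ev e t : V).1 x ∂μ) :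
    ∫ t in a..b, F t = (∫ t in a..b, p t) - ∑ l : Fin N, forceDual hf hV l ha hab hb (e l) := by
  have hi := fun l : Fin N => intervalIntegrable_pow_mul_integral hf (hV _ (e l).2) l ha hab hb
  have h1 : ∑ l : Fin N, forceDual hf hV l ha hab hb (e l)
      = ∫ t in a..b, ∑ l : Fin N, t ^ (l : ℕ) * ∫ x, f x t * (e l).1 x ∂μ :=
    (intervalIntegral.integral_finsetSum fun l _ => hi l).symm
  have h2 : IntervalIntegrable (fun t => ∑ l : Fin N, t ^ (l : ℕ) * ∫ x, f x t * (e l).1 x ∂μ)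
      volume a b := by
    have := IntervalIntegrable.sum Finset.univ fun l _ => hi l
    simpa only [Finset.sum_fn] using this
  rw [h1, ← intervalIntegral.integral_sub (hp.intervalIntegrable _ _) h2]
  refine intervalIntegral.integral_congr_ae ?_
  have h := (ae_restrict_iff' measurableSet_Ioc).1 (ae_integral_mul_ev hf hV e)
  filter_upwards [h] with t ht htI
  rw [uIoc_of_le hab] at htI
  obtain ⟨h3, h4⟩ := ht (Ioc_subset_Ioc ha hb htI)
  rw [hF t h3, h4]

end Forcing

/-! ### Solutions of the discrete problem as solutions of a linear system -/

section Solutions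

variable {m : ℕ} {kd : Kind} {k : ℕ} {T : Fin 2 → Finset (Set (Pt m))} {A : Method}
  {M : Fin 2 → ℕ}

/-- The unknowns with given coefficients in the finite element spaces. -/
noncomputable def toUnknowns
    (ζ : State (fun i => USpace kd k i (T i)) (UGam kd k (T 0)) A.q A.r M) : Unknowns m M where
  u i n t := (ev (ζ.1 i n) t).1
  U i n := (ζ.2.1 i n).1
  uG i t := (ev (ζ.2.2.1 i) t).1
  F i t := (ev (ζ.2.2.2 i) t).1

/-- Every solution arises from coefficients in the finite element spaces, so uniqueness among
`Unknowns` reduces to injectivity of the linear operator. -/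
theorem exists_toUnknowns_eq {P : Model m} {Δt : ℝ} {w : ℕ} {f : Fin 2 → Pt m → ℝ → ℝ}
    {g : Fin 2 → IPt m → ℝ → ℝ} {hist : Fin 2 → ℕ → Pt m → ℝ} {z : Unknowns m M}
    (hz : IsSolution P A kd k T Δt M w f g hist z) :
    ∃ ζ : State (fun i => USpace kd k i (T i)) (UGam kd k (T 0)) A.q A.r M, toUnknowns ζ = z := by
  choose c hc using fun i n => mem_timePoly_iff.1 (hz.u_mem i n)
  choose e he using fun i => mem_timePoly_iff.1 (hz.uG_mem i)
  choose F hF using fun i => mem_timePoly_iff.1 (hz.F_mem i)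
  refine ⟨(c, fun i n => ⟨z.U i n, hz.U_mem i n⟩, e, F), ?_⟩
  apply Unknowns.ext
  · funext i n
    exact (hc i n).symm
  · rfl
  · funext i
    exact (he i).symm
  · funext i
    exact (hF i).symm

variable (P : Model m) {σ : ℝ} {h : Fin 2 → ℝ} {x : Fin 2 → Set (Pt m) → Pt m} (hσ : 0 < σ)
  (H : ∀ i, MeshBalls i (T i) σ (h i) (x i)) {Δt : ℝ} {w : ℕ} {tf : ℝ}
  (ζ : State (fun i => USpace kd k i (T i)) (UGam kd k (T 0)) A.q A.r M)

/-- The history part of the lagged values is moved to the right-hand side. -/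
theorem side_iff (hist : Fin 2 → ℕ → Pt m → ℝ) (hh : ∀ i j, hist i j ∈ USpace kd k i (T i))
    (i : Fin 2) (n : Fin (M i)) (j : Fin A.ns) :
    ((toUnknowns ζ).u i n (tl Δt w (M i) n + A.θ j * (Δt / M i)) =
        ∑ l : Fin (A.ks + 1), A.D j l • lagged (hist i) ((toUnknowns ζ).U i) n l)
      ↔ Forms.sideOp A Δt w ζ i n j = ∑ l : Fin (A.ks + 1), A.D j l •
          lagged (fun s => (⟨hist i s, hh i s⟩ : USpace kd k i (T i))) (fun _ => 0) n l := by
  have e1 : ∑ l : Fin (A.ks + 1), A.D j l • lagged (hist i) ((toUnknowns ζ).U i) n l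
      = (∑ l : Fin (A.ks + 1), A.D j l •
          lagged (fun s => (⟨hist i s, hh i s⟩ : USpace kd k i (T i))) (ζ.2.1 i) n l).1 := by
    simp only [AddSubmonoidClass.coe_finsetSum, SetLike.val_smul, coe_lagged]
    rfl
  rw [e1]
  have e2 : ∑ l : Fin (A.ks + 1), A.D j l •
        lagged (fun s => (⟨hist i s, hh i s⟩ : USpace kd k i (T i))) (ζ.2.1 i) n l
      = ∑ l : Fin (A.ks + 1), A.D j l • lagged (fun _ => 0) (ζ.2.1 i) n l
        + ∑ l : Fin (A.ks + 1), A.D j l •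
          lagged (fun s => (⟨hist i s, hh i s⟩ : USpace kd k i (T i))) (fun _ => 0) n l := by
    rw [← Finset.sum_add_distrib]
    exact Finset.sum_congr rfl fun l _ => by rw [← smul_add, ← lagged_eq_add]
  rw [e2, Forms.sideOp, sub_eq_iff_eq_add']
  exact (Subtype.ext_iff (p := (· ∈ USpace kd k i (T i)))).symm

theorem trace_iff (i : Fin 2) :
    (∀ μ ∈ timePoly (UGam kd k (T 0)) (A.r i),
      ∫ t in ((w : ℝ) - 1) * Δt..w * Δt, ipG ((toUnknowns ζ).uG i t) (μ t) =
        ∑ n : Fin (M i), ∫ t in tl Δt w (M i) n..tl Δt w (M i) ((n : ℕ) + 1),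
          ipG (tr ((toUnknowns ζ).u i n t)) (μ t))
      ↔ ∀ l : Fin (A.r i + 1),
        (feForms P kd k hσ H).traceOp A Δt w ζ i (Polynomial.X ^ (l : ℕ)) = 0 := by
  rw [forall_timePoly_iff, ← forall_sum_dual_eq_zero_iff]
  refine forall_congr' fun e => ?_
  have e1 : ∫ t in ((w : ℝ) - 1) * Δt..w * Δt, ipG ((toUnknowns ζ).uG i t) (ev e t).1
      = ∑ l : Fin (A.r i + 1), (feForms P kd k hσ H).ipG
        (mom (((w : ℝ) - 1) * Δt) (w * Δt) (Polynomial.X ^ (l : ℕ)) (ζ.2.2.1 i)) (e l) :=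
    integral_form_ev (feForms P kd k hσ H).ipG (ζ.2.2.1 i) e _ _
  have e2 : ∀ n : Fin (M i), ∫ t in tl Δt w (M i) n..tl Δt w (M i) ((n : ℕ) + 1),
        ipG (tr ((toUnknowns ζ).u i n t)) (ev e t).1
      = ∑ l : Fin (A.r i + 1), ((feForms P kd k hσ H).c i).flip
          (mom (tl Δt w (M i) n) (tl Δt w (M i) ((n : ℕ) + 1)) (Polynomial.X ^ (l : ℕ)) (ζ.1 i n))
          (e l) := fun n => by
    rw [← integral_form_ev]
    congr 1
    ext t
    rw [LinearMap.flip_apply, feForms_c]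
    simp only [ipG, toUnknowns]
    congr 1
    ext y
    exact mul_comm _ _
  rw [e1, Finset.sum_congr rfl fun n _ => e2 n, Finset.sum_comm, ← sub_eq_zero,
    ← Finset.sum_sub_distrib]
  simp only [Forms.traceOp, LinearMap.sub_apply, LinearMap.sum_apply]

theorem flux_iff {g : Fin 2 → IPt m → ℝ → ℝ}
    (hg : ∀ i, Integrable (fun p : IPt m × ℝ => g i p.1 p.2)
      ((volume.restrict (cube m)).prod (volume.restrict (Ioc 0 tf))))
    (ha : 0 ≤ ((w : ℝ) - 1) * Δt) (hab : ((w : ℝ) - 1) * Δt ≤ w * Δt) (hb : w * Δt ≤ tf)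
    (i : Fin 2) :
    (∀ μ ∈ timePoly (UGam kd k (T 0)) (A.r i),
      ∫ t in ((w : ℝ) - 1) * Δt..w * Δt, ipG ((toUnknowns ζ).F i t) (μ t) =
        ∫ t in ((w : ℝ) - 1) * Δt..w * Δt,
          ipG (fun y => P.b i 0 * (toUnknowns ζ).uG 0 t y + P.b i 1 * (toUnknowns ζ).uG 1 t y
            - g i y t) (μ t))
      ↔ ∀ l : Fin (A.r i + 1),
        (feForms P kd k hσ H).fluxOp A Δt w P.b ζ i (Polynomial.X ^ (l : ℕ))
          = -forceDual (hg i) (fun _ => memLp_top_of_mem_UGam (kd := kd) (k := k) (T := T 0))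
              l ha hab hb := by
  simp only [← sub_eq_zero (b := -forceDual _ _ _ _ _ _)]
  rw [forall_timePoly_iff, ← forall_sum_dual_eq_zero_iff]
  refine forall_congr' fun e => ?_
  have e1 : ∫ t in ((w : ℝ) - 1) * Δt..w * Δt, ipG ((toUnknowns ζ).F i t) (ev e t).1
      = ∑ l : Fin (A.r i + 1), (feForms P kd k hσ H).ipG
        (mom (((w : ℝ) - 1) * Δt) (w * Δt) (Polynomial.X ^ (l : ℕ)) (ζ.2.2.2 i)) (e l) :=
    integral_form_ev (feForms P kd k hσ H).ipG (ζ.2.2.2 i) e _ _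
  have hc := fun j => continuous_form_ev (feForms P kd k hσ H).ipG (ζ.2.2.1 j) e
  have e2 : ∫ t in ((w : ℝ) - 1) * Δt..w * Δt,
          ipG (fun y => P.b i 0 * (toUnknowns ζ).uG 0 t y + P.b i 1 * (toUnknowns ζ).uG 1 t y
            - g i y t) (ev e t).1
      = (∫ t in ((w : ℝ) - 1) * Δt..w * Δt,
          (P.b i 0 * (feForms P kd k hσ H).ipG (ev (ζ.2.2.1 0) t) (ev e t)
            + P.b i 1 * (feForms P kd k hσ H).ipG (ev (ζ.2.2.1 1) t) (ev e t)))
        - ∑ l : Fin (A.r i + 1), forceDual (hg i)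
          (fun _ => memLp_top_of_mem_UGam (kd := kd) (k := k) (T := T 0)) l ha hab hb (e l) := by
    refine integral_sub_forcing (hg i) _ ha hab hb e
      (((hc 0).const_mul _).add ((hc 1).const_mul _)) fun t ht => ?_
    have hu := fun j => (integrable_mul_of_memLp_top
      (memLp_top_of_mem_UGam (ev (ζ.2.2.1 j) t).2) (memLp_top_of_mem_UGam (ev e t).2)).const_mul
        (P.b i j)
    rw [feForms_ipG, feForms_ipG, ipG, ipG, ipG, ← integral_const_mul, ← integral_const_mul,
      ← integral_add (hu 0) (hu 1)]
    -- `g` stands inside the spatial integral, so splitting it off requires `ht`;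
    -- `integral_sub_forcing` asks for the identity only at such times.
    refine Eq.trans ?_ (integral_sub ((hu 0).add (hu 1)) ht)
    congr 1
    ext y
    simp only [toUnknowns]
    ring
  rw [e1, e2, intervalIntegral.integral_add (((hc 0).const_mul _).intervalIntegrable _ _)
    (((hc 1).const_mul _).intervalIntegrable _ _), intervalIntegral.integral_const_mul,
    intervalIntegral.integral_const_mul, integral_form_ev, integral_form_ev, ← sub_eq_zero]
  simp only [Forms.fluxOp, LinearMap.sub_apply, LinearMap.add_apply, LinearMap.neg_apply,
    LinearMap.smul_apply, map_add, map_smul, Finset.sum_sub_distrib, Finset.sum_add_distrib,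
    Finset.mul_sum, Finset.sum_neg_distrib, smul_eq_mul]
  refine ⟨fun h => ?_, fun h => ?_⟩ <;> linarith

theorem substep_iff {f : Fin 2 → Pt m → ℝ → ℝ}
    (hf : ∀ i, Integrable (fun p : Pt m × ℝ => f i p.1 p.2)
      ((volume.restrict (Om m i)).prod (volume.restrict (Ioc 0 tf))))
    (hist : Fin 2 → ℕ → Pt m → ℝ) (hh : ∀ i j, hist i j ∈ USpace kd k i (T i))
    (i : Fin 2) (n : Fin (M i)) (ha : 0 ≤ tl Δt w (M i) n)
    (hab : tl Δt w (M i) n ≤ tl Δt w (M i) ((n : ℕ) + 1)) (hb : tl Δt w (M i) ((n : ℕ) + 1) ≤ tf) :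
    (∀ v ∈ timePoly (USpace kd k i (T i)) (A.q + 1 - A.ns),
      ip i ((toUnknowns ζ).U i n) (v (tl Δt w (M i) ((n : ℕ) + 1)))
          - ∫ t in tl Δt w (M i) n..tl Δt w (M i) ((n : ℕ) + 1),
              ip i ((toUnknowns ζ).u i n t) (fun x => deriv (fun t' => v t' x) t) =
        ip i (lagged (hist i) ((toUnknowns ζ).U i) n 1) (v (tl Δt w (M i) n))
          - ∫ t in tl Δt w (M i) n..tl Δt w (M i) ((n : ℕ) + 1),
              (LForm P i ((toUnknowns ζ).u i n t) (v t) + ipG ((toUnknowns ζ).F i t) (tr (v t))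
                - ip i (fun x => f i x t) (v t)))
      ↔ ∀ l : Fin (A.q + 1 - A.ns + 1),
        (feForms P kd k hσ H).stepOp A Δt w ζ i n (Polynomial.X ^ (l : ℕ))
          = tl Δt w (M i) n ^ (l : ℕ) • (feForms P kd k hσ H).ip i
              (lagged (fun s => (⟨hist i s, hh i s⟩ : USpace kd k i (T i))) (fun _ => 0) n 1)
            + forceDual (hf i) (fun _ => memLp_top_of_mem_USpace (kd := kd) (k := k) (T := T i))
              l ha hab hb := by
  simp only [← sub_eq_zero (a := Forms.stepOp _ _ _ _ _ _ _ _)]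
  rw [forall_timePoly_iff, ← forall_sum_dual_eq_zero_iff]
  refine forall_congr' fun e => ?_
  set a := tl Δt w (M i) n with ha_def
  set b := tl Δt w (M i) ((n : ℕ) + 1) with hb_def
  have e1 : ip i ((toUnknowns ζ).U i n) (ev e b).1
      = ∑ l : Fin (A.q + 1 - A.ns + 1),
        b ^ (l : ℕ) * (feForms P kd k hσ H).ip i (ζ.2.1 i n) (e l) :=
    map_ev ((feForms P kd k hσ H).ip i (ζ.2.1 i n)) e b
  have e2 : ∫ t in a..b, ip i ((toUnknowns ζ).u i n t)
        (fun x => deriv (fun t' => (ev e t').1 x) t)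
      = ∑ l : Fin (A.q + 1 - A.ns + 1), (feForms P kd k hσ H).ip i
          (mom a b (Polynomial.derivative (Polynomial.X ^ (l : ℕ))) (ζ.1 i n)) (e l) := by
    simp_rw [deriv_coe_ev]
    exact integral_form_sum ((feForms P kd k hσ H).ip i) (ζ.1 i n) _ e a b
  have e3 : ip i (lagged (hist i) ((toUnknowns ζ).U i) n 1) (ev e a).1
      = ∑ l : Fin (A.q + 1 - A.ns + 1), a ^ (l : ℕ) * ((feForms P kd k hσ H).ip i
          (lagged (fun _ => 0) (ζ.2.1 i) n 1) (e l)
        + (feForms P kd k hσ H).ip i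
          (lagged (fun s => (⟨hist i s, hh i s⟩ : USpace kd k i (T i))) (fun _ => 0) n 1)
            (e l)) := by
    have h1 := map_ev ((feForms P kd k hσ H).ip i
      (lagged (fun s => (⟨hist i s, hh i s⟩ : USpace kd k i (T i))) (ζ.2.1 i) n 1)) e a
    have h2 : lagged (hist i) ((toUnknowns ζ).U i) n 1
        = (lagged (fun s => (⟨hist i s, hh i s⟩ : USpace kd k i (T i))) (ζ.2.1 i) n 1).1 :=
      (coe_lagged (fun s => (⟨hist i s, hh i s⟩ : USpace kd k i (T i))) (ζ.2.1 i) n 1).symm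
    rw [h2, ← feForms_ip P kd k hσ H, h1]
    refine Finset.sum_congr rfl fun l _ => ?_
    rw [lagged_eq_add, map_add, LinearMap.add_apply]
  have hL := continuous_form_ev ((feForms P kd k hσ H).L i) (ζ.1 i n) e
  have hc := continuous_form_ev ((feForms P kd k hσ H).c i) (ζ.2.2.2 i) e
  have e4 : ∫ t in a..b, (LForm P i ((toUnknowns ζ).u i n t) (ev e t).1
        + ipG ((toUnknowns ζ).F i t) (tr (ev e t).1) - ip i (fun x => f i x t) (ev e t).1)
      = (∫ t in a..b, ((feForms P kd k hσ H).L i (ev (ζ.1 i n) t) (ev e t)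
          + (feForms P kd k hσ H).c i (ev (ζ.2.2.2 i) t) (ev e t)))
        - ∑ l : Fin (A.q + 1 - A.ns + 1), forceDual (hf i)
          (fun _ => memLp_top_of_mem_USpace (kd := kd) (k := k) (T := T i)) l ha hab hb (e l) := by
    refine integral_sub_forcing (hf i) _ ha hab hb e (hL.add hc) fun t _ => ?_
    rw [feForms_L, feForms_c]
    rfl
  rw [e1, e2, e3, e4, intervalIntegral.integral_add (hL.intervalIntegrable _ _)
    (hc.intervalIntegrable _ _), integral_form_ev, integral_form_ev, ← sub_eq_zero]
  simp only [Forms.stepOp, LinearMap.sub_apply, LinearMap.add_apply,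
    LinearMap.smul_apply, Finset.sum_sub_distrib, Finset.sum_add_distrib, Polynomial.eval_pow,
    Polynomial.eval_X, smul_eq_mul, mul_add, ← ha_def, ← hb_def]
  refine ⟨fun h => ?_, fun h => ?_⟩ <;> linarith

/-- Solutions are the fibre of the linear operator over one datum made of the history and the
forcings; the trace equations contribute zero. -/
theorem exists_data_isSolution_iff {f : Fin 2 → Pt m → ℝ → ℝ} {g : Fin 2 → IPt m → ℝ → ℝ}
    (hf : ∀ i, Integrable (fun p : Pt m × ℝ => f i p.1 p.2)
      ((volume.restrict (Om m i)).prod (volume.restrict (Ioc 0 tf))))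
    (hg : ∀ i, Integrable (fun p : IPt m × ℝ => g i p.1 p.2)
      ((volume.restrict (cube m)).prod (volume.restrict (Ioc 0 tf))))
    {hist : Fin 2 → ℕ → Pt m → ℝ} (hh : ∀ i j, hist i j ∈ USpace kd k i (T i))
    (hΔt : 0 ≤ Δt) (hw : 1 ≤ w) (hwt : w * Δt ≤ tf) :
    ∃ d, ∀ ζ : State (fun i => USpace kd k i (T i)) (UGam kd k (T 0)) A.q A.r M,
      IsSolution P A kd k T Δt M w f g hist (toUnknowns ζ)
        ↔ (feForms P kd k hσ H).op A Δt w (M := M) P.b ζ = d := by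
  have hw' : (1 : ℝ) ≤ w := by exact_mod_cast hw
  have ha : 0 ≤ ((w : ℝ) - 1) * Δt := mul_nonneg (by linarith) hΔt
  have hab : ((w : ℝ) - 1) * Δt ≤ w * Δt := by rw [Forms.window_eq]; linarith
  have ta : ∀ i (n : Fin (M i)), 0 ≤ tl Δt w (M i) n := fun i n => by unfold tl; positivity
  have tab : ∀ i (n : Fin (M i)), tl Δt w (M i) n ≤ tl Δt w (M i) ((n : ℕ) + 1) := fun i n => by
    rw [tl_succ]
    have : 0 ≤ Δt / M i := by positivity
    linarith
  -- The end of a substep is a point of the window, which lies in `[0, tf]`, where the forcing is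
  -- integrable.
  have tb : ∀ i (n : Fin (M i)), tl Δt w (M i) ((n : ℕ) + 1) ≤ tf := fun i n => by
    obtain ⟨S, hS, h⟩ := tl_add_mem_window Δt w n (s := 1) (by simp)
    rw [one_mul, ← tl_succ] at h
    rw [h]
    refine le_trans ?_ hwt
    rw [Forms.window_eq]
    nlinarith [hS.2]
  refine ⟨(fun i n j => ∑ l : Fin (A.ks + 1), A.D j l •
        lagged (fun s => (⟨hist i s, hh i s⟩ : USpace kd k i (T i))) (fun _ => 0) n l,
      fun i n l => tl Δt w (M i) n ^ (l : ℕ) • (feForms P kd k hσ H).ip i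
          (lagged (fun s => (⟨hist i s, hh i s⟩ : USpace kd k i (T i))) (fun _ => 0) n 1)
        + forceDual (hf i) (fun _ => memLp_top_of_mem_USpace) l (ta i n) (tab i n) (tb i n),
      fun i l => 0,
      fun i l => -forceDual (hg i) (fun _ => memLp_top_of_mem_UGam) l ha hab hwt),
    fun ζ => ?_⟩
  have hside := fun i n j => side_iff (Δt := Δt) (w := w) ζ hist hh i n j
  have hsub := fun i n => substep_iff P hσ H ζ hf hist hh i n (ta i n) (tab i n) (tb i n)
  have htrace := fun i => trace_iff P hσ H (Δt := Δt) (w := w) ζ i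
  have hflux := fun i => flux_iff P hσ H ζ hg ha hab hwt i
  constructor
  · intro hz
    refine Prod.ext ?_ (Prod.ext ?_ (Prod.ext ?_ ?_))
    · funext i n j
      exact (hside i n j).1 (hz.side i n j)
    · funext i n l
      exact (hsub i n).1 (hz.substep i n) l
    · funext i l
      exact (htrace i).1 (hz.trace i) l
    · funext i l
      exact (hflux i).1 (hz.flux i) l
  · intro hz
    obtain ⟨h1, h2⟩ := Prod.ext_iff.1 hz
    obtain ⟨h2, h3⟩ := Prod.ext_iff.1 h2
    obtain ⟨h3, h4⟩ := Prod.ext_iff.1 h3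
    exact
      { u_mem := fun i n => mem_timePoly_iff.2 ⟨_, rfl⟩
        U_mem := fun i n => (ζ.2.1 i n).2
        uG_mem := fun i => mem_timePoly_iff.2 ⟨_, rfl⟩
        F_mem := fun i => mem_timePoly_iff.2 ⟨_, rfl⟩
        side := fun i n j => (hside i n j).2 (congrFun (congrFun (congrFun h1 i) n) j)
        substep := fun i n => (hsub i n).2 fun l => congrFun (congrFun (congrFun h2 i) n) l
        trace := fun i => (htrace i).2 fun l => congrFun (congrFun h3 i) l
        flux := fun i => (hflux i).2 fun l => congrFun (congrFun h4 i) l }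

end Solutions

end MultirateDGiT

/-- Existence and uniqueness for the monolithic multirate DGiT problem on a coupling window.  The
constant `C` depends neither on the meshes (beyond their regularity constant `σ`), the step sizes
and numbers of substeps, nor on the forcing and the data from earlier windows. -/
theorem theorem5p5 (m : ℕ) (hm : m = 1 ∨ m = 2) (P : Model m) (A : Method)
    (ψ : ℕ → Polynomial ℝ) (hψ : IsOrthBasis A.q ψ) (hD : (Dtilde A ψ).det ≠ 0)
    (kd : Kind) (k : ℕ) (hk : 1 ≤ k) (σ : ℝ) (hσ : 0 < σ) :
    ∃ C : ℝ, 0 < C ∧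
      ∀ T : Fin 2 → Finset (Set (Pt m)),
        (∀ i, IsMesh kd i (T i)) → (∀ i, IsRegularMesh σ (T i)) →
        traceMesh (T 0) = traceMesh (T 1) →
      ∀ h : ℝ, h = max (meshSize (T 0)) (meshSize (T 1)) →
      ∀ (tf : ℝ) (N : ℕ), 0 < tf → 1 ≤ N →
      ∀ Δt : ℝ, Δt = tf / N → Δt * ((h ^ 2)⁻¹ + h⁻¹) ≤ C →
      ∀ M : Fin 2 → ℕ, (∀ i, 1 ≤ M i) →
      ∀ (f : Fin 2 → Pt m → ℝ → ℝ) (g : Fin 2 → IPt m → ℝ → ℝ),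
        (∀ i, MeasureTheory.IntegrableOn (fun p : Pt m × ℝ => f i p.1 p.2)
          (Om m i ×ˢ Set.Ioc 0 tf)) →
        (∀ i, MeasureTheory.IntegrableOn (fun p : IPt m × ℝ => g i p.1 p.2)
          (cube m ×ˢ Set.Ioc 0 tf)) →
      ∀ w : ℕ, 1 ≤ w → w ≤ N →
      ∀ hist : Fin 2 → ℕ → Pt m → ℝ, (∀ i j, hist i j ∈ USpace kd k i (T i)) →
        ∃! z : Unknowns m M, IsSolution P A kd k T Δt M w f g hist z := by
  obtain ⟨C₀, hC₀, hbij⟩ := Forms.exists_threshold_op_bijective A hψ hD P.b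
  obtain ⟨D, hD0, hdiam⟩ := exists_meshSize_le m
  obtain ⟨C₁, hC₁, hL⟩ := exists_abs_LForm_le P k hσ
  obtain ⟨C₂, hC₂, hinv⟩ := exists_inverse_inequalities m k hσ
  obtain ⟨c, -, hcomp⟩ := exists_meshSize_comparison (m := m) (by omega) hσ
  set κ : ℝ := max 1 c with hκ_def
  have hκ1 : 1 ≤ κ := le_max_left _ _
  have hκ0 : 0 ≤ κ := zero_le_one.trans hκ1
  -- The denominator dominates the ratio of `Λ + γ ^ 2` to `h⁻² + h⁻¹` for the bounds chosen below;
  -- the summand `1` keeps it positive.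
  refine ⟨C₀ / (1 + C₁ * (κ ^ 2 + κ + D) + C₂ * κ), by positivity, ?_⟩
  rintro T hT hreg htr h rfl tf N htf hN Δt rfl hsmall M hM f g hf hg w hw hwN hist hh
  set h := max (meshSize (T 0)) (meshSize (T 1)) with h_def
  choose x H using fun i => exists_meshBalls (hT i) (hreg i)
  -- The inverse estimates involve each mesh's own size, whereas the step restriction involves the
  -- maximum.
  have hle : ∀ i j, meshSize (T i) ≤ κ * meshSize (T j) := by
    have h1 : ∀ j, meshSize (T j) ≤ κ * meshSize (T j) := fun j =>
      le_mul_of_one_le_left (H j).h_pos.le hκ1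
    have h2 : ∀ i j, traceMesh (T i) = traceMesh (T j) → meshSize (T i) ≤ κ * meshSize (T j) :=
      fun i j hij => (hcomp _ _ _ _ _ _ _ _ (H i) (H j) hij).trans
        (mul_le_mul_of_nonneg_right (le_max_right _ _) (H j).h_pos.le)
    intro i j
    fin_cases i <;> fin_cases j
    · exact h1 0
    · exact h2 0 1 htr
    · exact h2 1 0 htr.symm
    · exact h1 1
  have hpos : 0 < h := (H 0).h_pos.trans_le (le_max_left _ _)
  have hinvle : ∀ i, (meshSize (T i))⁻¹ ≤ κ * h⁻¹ := fun i => by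
    have h1 := (H i).h_pos
    have h2 : h ≤ κ * meshSize (T i) := max_le (hle 0 i) (hle 1 i)
    rw [← div_eq_mul_inv, inv_eq_one_div, div_le_div_iff₀ h1 hpos]
    linarith
  -- Mesh sizes are bounded by the domain, so the zeroth-order contribution of the advection form is
  -- absorbed into `h⁻¹`.
  have hone : 1 ≤ D * h⁻¹ := by
    rw [← div_eq_mul_inv, one_le_div hpos]
    exact max_le (hdiam _ _ _ (hT 0)) (hdiam _ _ _ (hT 1))
  have hh0 : 0 ≤ h⁻¹ := by positivity
  have hfac : ∀ i, (meshSize (T i) ^ 2)⁻¹ + (meshSize (T i))⁻¹ + 1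
      ≤ (κ ^ 2 + κ + D) * ((h ^ 2)⁻¹ + h⁻¹) := fun i => by
    have h1 : (meshSize (T i) ^ 2)⁻¹ ≤ κ ^ 2 * (h ^ 2)⁻¹ := by
      rw [← inv_pow, ← inv_pow, ← mul_pow]
      exact pow_le_pow_left₀ (inv_nonneg.2 (H i).h_pos.le) (hinvle i) 2
    have h2 := hinvle i
    have h3 : 0 ≤ κ ^ 2 * h⁻¹ := by positivity
    have h4 : 0 ≤ κ * (h ^ 2)⁻¹ := by positivity
    have h5 : 0 ≤ D * (h ^ 2)⁻¹ := by positivity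
    nlinarith
  have : ∀ i, FiniteDimensional ℝ (USpace kd k i (T i)) := fun i => (H i).finiteDimensional_USpace
  have : FiniteDimensional ℝ (UGam kd k (T 0)) := (H 0).finiteDimensional_UGam
  have hN0 : (0 : ℝ) < N := by exact_mod_cast hN
  have hΔt : 0 < tf / N := by positivity
  set Φ := feForms P kd k hσ H with hΦ
  have hop : Function.Bijective (Φ.op A (tf / N) w (M := M) P.b) := by
    -- `Λ` comes from the bound of the advection–diffusion form and `γ` from the discrete trace
    -- inequality, both rewritten with the common `h`.
    refine hbij Φ (Λ := C₁ * (κ ^ 2 + κ + D) * ((h ^ 2)⁻¹ + h⁻¹)) (γ := √(C₂ * (κ * h⁻¹)))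
      (by positivity) (Real.sqrt_nonneg _) ?_ ?_ hΔt ?_ w hM
    · intro i v v'
      rw [hΦ, feForms_L, feForms_nm, feForms_nm]
      refine (hL kd i (T i) _ _ (H i) v.1 v.2 v'.1 v'.2).trans ?_
      rw [mul_assoc C₁ (κ ^ 2 + κ + D)]
      gcongr
      exact hfac i
    · intro i μ v
      refine feForms_abs_c_le P kd k hσ H i (fun v hv => ?_) μ v
      rw [← Real.sqrt_mul (by positivity)]
      refine Real.sqrt_le_sqrt ((hinv kd i (T i) _ _ (H i) v hv).2.trans ?_)
      have h1 : 0 ≤ ∫ p in Om m i, v p ^ 2 := integral_nonneg fun _ => sq_nonneg _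
      gcongr
      exact hinvle i
    · rw [Real.sq_sqrt (by positivity)]
      rw [le_div_iff₀ (by positivity)] at hsmall
      refine le_trans ?_ hsmall
      rw [mul_assoc (tf / N)]
      refine mul_le_mul_of_nonneg_left ?_ hΔt.le
      have h1 : 0 ≤ (h ^ 2)⁻¹ := by positivity
      have h2 : 0 ≤ C₂ * κ * (h ^ 2)⁻¹ := by positivity
      nlinarith
  have hwt : (w : ℝ) * (tf / N) ≤ tf := by
    rw [mul_div_assoc', div_le_iff₀ hN0, mul_comm]
    exact mul_le_mul_of_nonneg_left (by exact_mod_cast hwN) htf.le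
  obtain ⟨d, hd⟩ := exists_data_isSolution_iff P hσ H (A := A) (M := M) (tf := tf)
    (f := f) (g := g)
    (fun i => by rw [Measure.prod_restrict, ← Measure.volume_eq_prod]; exact hf i)
    (fun i => by rw [Measure.prod_restrict, ← Measure.volume_eq_prod]; exact hg i)
    hh hΔt.le hw hwt
  obtain ⟨ζ, hζ⟩ := hop.2 d
  refine ⟨toUnknowns ζ, (hd ζ).2 hζ, fun z hz => ?_⟩
  obtain ⟨ζ', rfl⟩ := exists_toUnknowns_eq hz
  rw [hop.1 (((hd ζ').1 hz).trans hζ.symm)]
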